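/- Setting. Let $t\ge 0$ be an integer and let $\sigma_t$ be the substitution $1\mapsto 1^{t+1}2,\ 2\mapsto 3,\ 3\mapsto 4,\ 4\mapsto 1^t5,\ 5\mapsto 1$ on $\mathcal A=\{1,\dots,5\}$, with incidence matrix $M$ ($M_{b,a}$ is the number of letters $b$ in $\sigma_t(a)$). Let $\beta$ be the dominant eigenvalue of $M$, $f$ its minimal polynomial over $\mathbb Q$, $\mathbb K_e$ the $\beta$-eigenspace, $\mathbb K_c=\ker (f/(X-\beta))(M)$, $\mathbb K_n=f(M)\mathbb R^5$, and $\pi_c$ the projection of $\mathbb R^5$ onto the plane $\mathbb K_c$ along $\mathbb K_e\oplus\mathbb K_n$. For $0\le k\le 5$ let $C_k$ be the free $\mathbb Z$-module on the $k$-dimensional faces $(\mathbf x,a_1\wedge\dots\wedge a_k)$ with $\mathbf x\in\mathbb Z^5$ and $a_1<\dots<a_k$ in $\mathcal A$; for arbitrary letters the symbol $(\mathbf x,a_1\wedge\dots\wedge a_k)$ is defined by antisymmetry. The support of a face is $\{\mathbf x+\sum_i s_i\mathbf e_{a_i}: s_i\in[0,1]\}$. For $P\in C_k$, let $\{P\}$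 be the set of faces with non-zero coefficient in $P$, and $\overline P$ the union of their supports. $P$ is geometric if all its non-zero coefficients are $\pm1$; a geometric $P$ projects well if the $\pi_c$-images of the supports of distinct faces of $P$ have disjoint interiors in $\mathbb K_c$. The boundary is $$\partial(\mathbf x,a_1\wedge\dots\wedge a_k)=\sum_{i}(-1)^i\big((\mathbf x,a_1\wedge\cdots\widehat{a_i}\cdots\wedge a_k)-(\mathbf x+\mathbf e_{a_i},a_1\wedge\cdots\widehat{a_i}\cdots\wedge a_k)\big).$$ Let $C_3^*$ be the free module on symbols $(\mathbf x,\underline a)^*$ for three-dimensional faces $(\mathbf x,\underline a)$, let $\mathbf E_3^*(\sigma_t)(\mathbf x,\underline a)^*=\sum (M^{-1}(\mathbf x-\mathbf l(p_1p_2p_3)),b_1\wedge b_2\wedge b_3)^*$, the sum being over all letters $b_i$ and words $p_i,s_i$ with $\sigma_t(b_i)=p_ia_is_i$ for $i=1,2,3$ ($\mathbf l$ is abelianization), and let $\varphi:C_3^*\to C_2$ be the isomorphism $(\mathbf x,\underline a)^*\mapsto(-1)^{a_1+a_2+a_3}(\mathbf x+\mathbf e_{a_1}+\mathbf e_{a_2}+\mathbf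 e_{a_3},\underline a^*)$, where $\underline a^*$ is the type formed by the two other letters. Put $E:=\mathbf E^2(\sigma_t)=\varphi\circ\mathbf E_3^*(\sigma_t)\circ\varphi^{-1}:C_2\to C_2$. A geometric $P\in C_2$ is edge-connected if any two of its faces are joined by a path of faces of $P$ in which consecutive supports share an edge. $A$ surrounds $P$ if $A$ and $P$ are edge-connected geometric elements, $\{P\}\subseteq\{A\}$ and $\overline{\partial P}\cap\overline{\partial A}=\emptyset$. A geometric, well-projecting $U$ with all faces based at $\mathbf 0$ satisfies the geometric finiteness property if there is $m\ge1$ such that $E^m(U)$ is geometric, $\{U\}\subseteq\{E^m(U)\}$, and the $\pi_c$-images of the supports of the faces in $\Gamma_U=\bigcup_{j\ge0}\{E^{mj}(U)\}$ cover $\mathbb K_c$. Proposition. For every $t\ge0$: (1) Every geometric $U\in C_2$ all of whose faces are based at $\mathbf 0$ satisfies $\{U\}\subseteq\{E^5(U)\}$. (2) Let $U_0=(\mathbf 0,a\wedge b)+(\mathbf 0,b\wedge c)+(\mathbf 0,c\wedge a)$ with $a,b,c\in\mathcal A$ pairwise distinct be a coherently oriented $3$-touching element, that is, assume that $U_0$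 projects well; and put $U_{i+1}=E^{15}(U_i)$ for $i\ge 0$. Then (a) $U_{i+1}$ surrounds $U_i$ for every $i\ge0$; (b) (annulus property along the orbit of $U_0$) this is preserved under all iterations of $E$: $E^j(U_{i+1})$ surrounds $E^j(U_i)$ for all $i,j\ge0$; (c) for every geometric $V$ with $\{V\}=\{U_0\}$ (any choice of signs of the three faces), $\{E^j(V)\}=\{E^j(U_0)\}$ for all $j\ge0$, and $V$, in particular $U_0$, satisfies the geometric finiteness property. -/

import Mathlib

open Polynomial

/-! ## Substitutions -/

/-- A substitution on the alphabet `Fin n` (the letter `a` of `{1, …, n}` is `a - 1 : Fin n`),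
given by the images of the letters. -/
abbrev Substitution (n : ℕ) : Type := Fin n → List (Fin n)

/-- Abelianization of a word. -/
def abel {n : ℕ} (w : List (Fin n)) : Fin n → ℤ := fun b => (w.count b : ℤ)

/-- The incidence matrix `M_σ`: the entry at `(b, a)` is the number of letters `b` in `σ(a)`. -/
def incidence {n : ℕ} (σ : Substitution n) : Matrix (Fin n) (Fin n) ℤ :=
  Matrix.of fun b a => abel (σ a) b

/-- The family `σ_t : 1 ↦ 1^{t+1} 2, 2 ↦ 3, 3 ↦ 4, 4 ↦ 1^t 5, 5 ↦ 1`. -/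
def sigma (t : ℕ) : Substitution 5 :=
  ![List.replicate (t + 1) 0 ++ [1], [2], [3], List.replicate t 0 ++ [4], [0]]

/-! ## Faces -/

/-- The set `O_k` of types `a_1 ∧ ⋯ ∧ a_k` with `a_1 < ⋯ < a_k`, as `k`-element sets of letters. -/
abbrev FaceType (n k : ℕ) : Type := {a : Finset (Fin n) // a.card = k}

/-- `k`-dimensional faces `(x, a)`: base point and type. -/
abbrev Face (n k : ℕ) : Type := (Fin n → ℤ) × FaceType n k

/-- The module `C_k` of formal integer combinations of `k`-dimensional faces; the same type is used
for the free module `C_k^*` on the dual faces `(x, a)^*`. For `P : Chain n k` the set `{P}` of faces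
appearing in `P` is `P.support`. -/
abbrev Chain (n k : ℕ) : Type := Face n k →₀ ℤ

/-- The letters `a_1 < ⋯ < a_k` of a type. -/
def FaceType.letter {n k : ℕ} (a : FaceType n k) : Fin k → Fin n := a.1.orderEmbOfFin a.2

/-- The sign of the permutation that sorts a tuple of distinct letters: `(-1)` to the number of
inversions. -/
def sortSign {n k : ℕ} (c : Fin k → Fin n) : ℤ :=
  ∏ i : Fin k, ∏ j : Fin k, if i < j ∧ c j < c i then -1 else 1

/-- `(x, c_1 ∧ ⋯ ∧ c_k)` for an arbitrary tuple of letters: it is `0` if a letter is repeated, and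
otherwise the sign of the sorting permutation times the face with the sorted letters. -/
noncomputable def wedge {n k : ℕ} (x : Fin n → ℤ) (c : Fin k → Fin n) : Chain n k :=
  if h : Function.Injective c then
    Finsupp.single (x, ⟨Finset.univ.image c, by simp [Finset.card_image_of_injective _ h]⟩)
      (sortSign c)
  else 0

/-- An element is geometric if all the coefficients that occur in it are `1` or `-1`. -/
def IsGeometric {n k : ℕ} (P : Chain n k) : Prop :=
  ∀ F ∈ P.support, P F = 1 ∨ P F = -1

/-- The support `{x + ∑ t_i e_{a_i} : t_i ∈ [0, 1]}` of a face. -/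
def faceSupport {n k : ℕ} (F : Face n k) : Set (Fin n → ℝ) :=
  {y | ∃ s : Fin n → ℝ, (∀ i, s i ∈ Set.Icc (0 : ℝ) 1) ∧
    y = (fun j => (F.1 j : ℝ)) + ∑ i ∈ F.2.1, s i • (Pi.single i 1 : Fin n → ℝ)}

/-- The support of a set of faces; the support of a chain `P` is `supportOf P.support`. -/
def supportOf {n k : ℕ} (S : Set (Face n k)) : Set (Fin n → ℝ) := ⋃ F ∈ S, faceSupport F

/-! ## The geometric dual maps -/

/-- A choice of a decomposition `σ(b_i) = p_i c_i s_i` for every letter `b_i` of the type `b`: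
the position of the letter `c_i` in the word `σ(b_i)`. -/
abbrev Decomp {n k : ℕ} (σ : Substitution n) (b : FaceType n k) : Type :=
  ∀ i : Fin k, Fin (σ (b.letter i)).length

/-- The letters `c_1, …, c_k` of a decomposition. -/
def Decomp.letters {n k : ℕ} {σ : Substitution n} {b : FaceType n k} (D : Decomp σ b) :
    Fin k → Fin n :=
  fun i => (σ (b.letter i)).get (D i)

/-- `l(p) = l(p_1) + ⋯ + l(p_k)` for the prefixes of a decomposition. -/
def Decomp.prefixes {n k : ℕ} {σ : Substitution n} {b : FaceType n k} (D : Decomp σ b) :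
    Fin n → ℤ :=
  ∑ i, abel ((σ (b.letter i)).take (D i))

/-- The dual `E_k^*(σ)` of the `k`-dimensional extension of `σ`:
`(x, a)^* ↦ ∑ (M_σ⁻¹ (x - l(p)), b)^*` over `σ(b) = p a s`. The sum is taken over sorted `b`, so
that the letters `c_1, …, c_k` picked in `σ(b_1), …, σ(b_k)` are those of `a` up to a permutation,
whose sign is the coefficient `wedge x c (x, a)`. -/
noncomputable def dualExtension {n : ℕ} (σ : Substitution n) (k : ℕ) :
    Module.End ℤ (Chain n k) :=
  Finsupp.lift (Chain n k) ℤ (Face n k) fun F =>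
    ∑ b : FaceType n k, ∑ D : Decomp σ b,
      Finsupp.single ((incidence σ)⁻¹.mulVec (F.1 - D.prefixes), b) (wedge F.1 D.letters F)

/-- The complementary type. -/
def FaceType.compl {n k m : ℕ} (h : k + m = n) (a : FaceType n k) : FaceType n m :=
  ⟨a.1ᶜ, by have := a.2; rw [Finset.card_compl, Fintype.card_fin]; omega⟩

/-- The sign `(-1)^{a_1 + ⋯ + a_k}`, the letters being numbered from `1` to `n`. -/
def FaceType.sign {n k : ℕ} (a : FaceType n k) : ℤ := (-1) ^ (∑ i ∈ a.1, ((i : ℕ) + 1))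

/-- The vector `e_{a_1} + ⋯ + e_{a_k}`. -/
def FaceType.vec {n k : ℕ} (a : FaceType n k) : Fin n → ℤ := ∑ i ∈ a.1, Pi.single i 1

/-- The Poincaré map `φ_k : C_k^* → C_{n-k}`,
`(x, a)^* ↦ (-1)^{a_1 + ⋯ + a_k} (x + e_{a_1} + ⋯ + e_{a_k}, a^*)` with `a^*` the complementary
type. -/
noncomputable def poincare {n : ℕ} (k m : ℕ) (h : k + m = n) : Chain n k →ₗ[ℤ] Chain n m :=
  Finsupp.lift (Chain n m) ℤ (Face n k) fun F =>
    Finsupp.single (F.1 + F.2.vec, F.2.compl h) F.2.sign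

/-- The inverse of the Poincaré map. -/
noncomputable def poincareInv {n : ℕ} (k m : ℕ) (h : k + m = n) : Chain n m →ₗ[ℤ] Chain n k :=
  Finsupp.lift (Chain n k) ℤ (Face n m) fun F =>
    Finsupp.single (F.1 - (F.2.compl (by omega : m + k = n)).vec, F.2.compl (by omega))
      (F.2.compl (by omega : m + k = n)).sign

theorem FaceType.compl_compl {n k m : ℕ} (h : k + m = n) (h' : m + k = n) (a : FaceType n k) :
    (a.compl h).compl h' = a := by
  apply Subtype.ext; simp [FaceType.compl]

theorem FaceType.sign_mul_self {n k : ℕ} (a : FaceType n k) : a.sign * a.sign = 1 := by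
  rw [FaceType.sign, ← mul_pow]; norm_num

theorem poincareInv_comp {n : ℕ} (k m : ℕ) (h : k + m = n) :
    poincareInv k m h ∘ₗ poincare k m h = LinearMap.id := by
  apply Finsupp.lhom_ext
  rintro ⟨x, a⟩ c
  have := FaceType.sign_mul_self a
  simp only [poincare, poincareInv, LinearMap.comp_apply, LinearMap.id_apply, Finsupp.lift_apply]
  rw [Finsupp.sum_single_index (by simp), Finsupp.smul_single,
    Finsupp.sum_single_index (by simp)]
  simp only [FaceType.compl_compl, Finsupp.smul_single, smul_eq_mul, add_sub_cancel_right]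
  rw [mul_assoc, this, mul_one]

theorem poincare_comp_inv {n : ℕ} (k m : ℕ) (h : k + m = n) :
    poincare k m h ∘ₗ poincareInv k m h = LinearMap.id := by
  apply Finsupp.lhom_ext
  rintro ⟨x, a⟩ c
  have := FaceType.sign_mul_self (a.compl (by omega : m + k = n))
  simp only [poincare, poincareInv, LinearMap.comp_apply, LinearMap.id_apply, Finsupp.lift_apply]
  rw [Finsupp.sum_single_index (by simp), Finsupp.smul_single,
    Finsupp.sum_single_index (by simp)]
  simp only [FaceType.compl_compl, Finsupp.smul_single, smul_eq_mul, sub_add_cancel]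
  rw [mul_assoc, this, mul_one]

/-- The geometric dual map `E^m(σ)` on `m`-dimensional faces, where `m = n - k`, determined by
`E^m(σ) ∘ φ_k = φ_k ∘ E_k^*(σ)`. -/
noncomputable def geomDual {n : ℕ} (σ : Substitution n) (k m : ℕ) (h : k + m = n) :
    Module.End ℤ (Chain n m) :=
  poincare k m h ∘ₗ dualExtension σ k ∘ₗ poincareInv k m h

theorem geomDual_comp_poincare {n : ℕ} (σ : Substitution n) (k m : ℕ) (h : k + m = n) :
    geomDual σ k m h ∘ₗ poincare k m h = poincare k m h ∘ₗ dualExtension σ k := by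
  rw [geomDual, LinearMap.comp_assoc, LinearMap.comp_assoc, poincareInv_comp, LinearMap.comp_id]

/-- The map `E^2(σ)` on two-dimensional faces, for a substitution on five letters. -/
noncomputable abbrev E2 (σ : Substitution 5) : Module.End ℤ (Chain 5 2) :=
  geomDual σ 3 2 rfl

/-! ## Boundary, edge-connectedness, surrounding -/

/-- The boundary operator, where the `i`-th letter `c` of `a` is the one with `i` letters of `a`
not exceeding it:
`∂(x, a) = ∑_i (-1)^i ((x, a without a_i) - (x + e_{a_i}, a without a_i))`. -/
noncomputable def boundary {n k : ℕ} : Chain n (k + 1) →ₗ[ℤ] Chain n k :=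
  Finsupp.lift (Chain n k) ℤ (Face n (k + 1)) fun F =>
    ∑ c : {c // c ∈ F.2.1},
      (-1 : ℤ) ^ (F.2.1.filter (· ≤ c.1)).card •
        (Finsupp.single
            (F.1, ⟨F.2.1.erase c.1, by rw [Finset.card_erase_of_mem c.2, F.2.2]; rfl⟩) (1 : ℤ) -
          Finsupp.single
            (F.1 + Pi.single c.1 1,
              ⟨F.2.1.erase c.1, by rw [Finset.card_erase_of_mem c.2, F.2.2]; rfl⟩) (1 : ℤ))

/-- The supports of the two faces share an edge. -/
def SharesEdge {n k : ℕ} (F G : Face n k) : Prop :=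
  ∃ e : Face n 1, faceSupport e ⊆ faceSupport F ∩ faceSupport G

/-- A geometric element is edge-connected if any two of its faces are joined by a path of its
faces in which consecutive faces share an edge. -/
def IsEdgeConnected {n k : ℕ} (P : Chain n k) : Prop :=
  IsGeometric P ∧ ∀ F ∈ P.support, ∀ G ∈ P.support,
    Relation.ReflTransGen (fun A B => A ∈ P.support ∧ B ∈ P.support ∧ SharesEdge A B) F G

/-- `A` surrounds `P`: both are edge-connected geometric elements, `{P} ⊆ {A}`, and the supports
of the boundaries of `P` and `A` are disjoint. -/
def Surrounds {n k : ℕ} (A P : Chain n (k + 1)) : Prop :=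
  IsEdgeConnected A ∧ IsEdgeConnected P ∧ P.support ⊆ A.support ∧
    Disjoint (supportOf ((boundary P).support : Set (Face n k)))
      (supportOf ((boundary A).support : Set (Face n k)))

/-- That `A` surrounds `P` is preserved under all the iterations of the map `E`. -/
def SurroundsUnderIteration {n k : ℕ} (E : Module.End ℤ (Chain n (k + 1)))
    (A P : Chain n (k + 1)) : Prop :=
  ∀ j : ℕ, Surrounds ((E ^ j) A) ((E ^ j) P)

/-! ## The contracting space and the projection onto it -/

/-- The dominant eigenvalue `β` of `M_σ`. -/
noncomputable def dominantEigenvalue {n : ℕ} (σ : Substitution n) : ℝ :=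
  (spectralRadius ℂ ((incidence σ).map (Int.cast : ℤ → ℂ))).toReal

/-- `M_σ` as a linear endomorphism of `ℝ^n`. -/
noncomputable def incidenceEnd {n : ℕ} (σ : Substitution n) : Module.End ℝ (Fin n → ℝ) :=
  Matrix.toLin' ((incidence σ).map (Int.cast : ℤ → ℝ))

/-- The Pisot polynomial `f`, the minimal polynomial of `β` over `ℚ`, as a real polynomial. -/
noncomputable def pisotPoly {n : ℕ} (σ : Substitution n) : ℝ[X] :=
  (minpoly ℚ (dominantEigenvalue σ)).map (algebraMap ℚ ℝ)

/-- The expanding line `K_e`, the eigenspace of `β`. -/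
noncomputable def expandingSpace {n : ℕ} (σ : Substitution n) : Submodule ℝ (Fin n → ℝ) :=
  Module.End.eigenspace (incidenceEnd σ) (dominantEigenvalue σ)

/-- The contracting space `K_c`, belonging to the conjugates of `β` other than `β` itself: the
kernel of `(f / (X - β))(M_σ)`. -/
noncomputable def contractingSpace {n : ℕ} (σ : Substitution n) : Submodule ℝ (Fin n → ℝ) :=
  LinearMap.ker (aeval (incidenceEnd σ) (pisotPoly σ /ₘ (X - C (dominantEigenvalue σ))))

/-- The neutral space `K_n = f(M_σ) ℝ^n`. -/
noncomputable def neutralSpace {n : ℕ} (σ : Substitution n) : Submodule ℝ (Fin n → ℝ) :=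
  LinearMap.range (aeval (incidenceEnd σ) (pisotPoly σ))

/-- The image `π_c(S)` of a set `S ⊆ ℝ^n` under the projection onto `K_c` along `K_e ⊕ K_n`, as a
subset of the space `K_c`. -/
def projC {n : ℕ} (σ : Substitution n) (S : Set (Fin n → ℝ)) : Set (contractingSpace σ) :=
  {y | ∃ x ∈ S, x - (y : Fin n → ℝ) ∈ expandingSpace σ ⊔ neutralSpace σ}

/-- A geometric element projects well if the projections to `K_c` of its distinct faces have
disjoint interiors. -/
def ProjectsWell {n k : ℕ} (σ : Substitution n) (P : Chain n k) : Prop :=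
  IsGeometric P ∧ ∀ F ∈ P.support, ∀ G ∈ P.support, F ≠ G →
    Disjoint (interior (projC σ (faceSupport F))) (interior (projC σ (faceSupport G)))

/-- All faces of `P` are based at the origin. -/
def BasedAtZero {n k : ℕ} (P : Chain n k) : Prop := ∀ F ∈ P.support, F.1 = 0

/-- `Γ_U = ⋃_{j ≥ 0} {E^{m j}(U)}`. -/
def gammaSet {n k : ℕ} (E : Module.End ℤ (Chain n k)) (m : ℕ) (U : Chain n k) :
    Set (Face n k) :=
  ⋃ j : ℕ, (((E ^ (m * j)) U).support : Set (Face n k))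

/-- The geometric finiteness property of `σ` for `U`, the map `E` being `E^{d-1}(σ)`. -/
def GeometricFiniteness {n k : ℕ} (σ : Substitution n) (E : Module.End ℤ (Chain n k))
    (U : Chain n k) : Prop :=
  BasedAtZero U ∧ ProjectsWell σ U ∧
    ∃ m : ℕ, 1 ≤ m ∧ IsGeometric ((E ^ m) U) ∧ U.support ⊆ ((E ^ m) U).support ∧
      projC σ (supportOf (gammaSet E m U)) = Set.univ

/-- The sum `(0, a ∧ b) + (0, b ∧ c) + (0, c ∧ a)` of three pairwise touching faces; in terms of
sorted types its signs are those that orient the three faces coherently. -/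
noncomputable def touchingTriple (a b c : Fin 5) : Chain 5 2 :=
  wedge 0 ![a, b] + wedge 0 ![b, c] + wedge 0 ![c, a]

/-! The characteristic polynomial of `M` is `(X² - X + 1)(X³ - tX² - (t+1)X - 1)`; the cubic is the
Pisot polynomial, and `K_n` is the plane annihilated by `M² - M + 1`. Modulo the neutral lattice a
position becomes a class in `ℤ³` (`quot`), and `ell` is the linear form on classes that `M`
multiplies by `β`. Orient each of the ten types so that its projection has positive area
(`area_pos`). Then `E` sends a positively oriented face to a sum of positively oriented faces, all
with coefficient one (`E2_cellChain`), so that `E` becomes a map from cells to finite sets of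
children.

Uniformity in `t`: when the classes of two children are known, `t` and the row indices enter the
difference of the parents' classes through a single integer `r`. If `r` is large, the difference
cannot occur between admissible positions, for any `β > 1`. Hence statements inherited through
generations reduce to finite tables checked by `decide` (`pullCheck.sound`). The first use is that
distinct cells stay separated (`Spread`), so that no multiplicities or cancellations arise.

Part (1): by positivity of `ell`, a cell at the origin arises only from a cell at the origin, and
`E` permutes these by two 5-cycles (`zero_mem_children`).

Part (2): the positive orientations form a regular tournament on the letters. Two faces with the
same first letter overlap (`not_projectsWell`), so a well-projecting triple is, up to sign, one of
the five cyclic triangles. The boundary intertwines `E` with a map on edges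
(`boundary_E2_cellChain`). If boundary edges at levels `n` and `n + 15` touched, their ancestors
would form a near pair at levels `0` and `15`. But the boundary at level `15` vanishes on a window
around the initial boundary: the coefficients in the window evolve autonomously and depend on `t`
only through `min t 4`, so this is a computation (`iterate_stepList`). Connectedness follows from a
list of links inherited by children (`links_children`).

Covering: since boundaries fifteen steps apart are disjoint, every edge of an orbit cell is interior
to some generation, and has tiles on both sides. The union of the tiles is closed and is a
neighbourhood of each of its points except possibly lattice points. The plane minus a countable set
is connected, so the union is everything (`orbitTiles_eq_univ`). Changing the signs of the three
faces changes no supports, because their images are disjoint (`E2_pow_of_support_eq`). -/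

/-! ## Positively oriented faces and the combinatorial form of the dual map -/

/-- First letter of the positively oriented two-dimensional type number `p`. -/
def fstLetter : Fin 10 → Fin 5 := ![0, 2, 0, 4, 1, 3, 1, 4, 2, 3]

/-- Second letter of the positively oriented two-dimensional type number `p`. -/
def sndLetter : Fin 10 → Fin 5 := ![1, 0, 3, 0, 2, 1, 4, 2, 3, 4]

/-- The sign relating the positive orientation to the sorted one. -/
def orientSign : Fin 10 → ℤ := ![1, -1, 1, -1, 1, -1, 1, -1, 1, 1]

/-- The type number `p`. -/
def typeOf (p : Fin 10) : FaceType 5 2 :=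
  ⟨{fstLetter p, sndLetter p}, by revert p; decide⟩

/-- The type complementary to `typeOf p`. -/
def cotypeOf (p : Fin 10) : FaceType 5 3 :=
  ⟨{fstLetter p, sndLetter p}ᶜ, by revert p; decide⟩

/-- Cells: base point and number of a positively oriented type. -/
abbrev Cell : Type := (Fin 5 → ℤ) × Fin 10

/-- The positively oriented face of a cell. -/
noncomputable def cellChain (F : Cell) : Chain 5 2 :=
  Finsupp.single (F.1, typeOf F.2) (orientSign F.2)

/-- The action of the incidence matrix on `ℤ^5`. -/
def mulM (t : ℕ) (z : Fin 5 → ℤ) : Fin 5 → ℤ :=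
  ![(t + 1) * z 0 + t * z 3 + z 4, z 0, z 1, z 2, z 3]

/-- The action of the inverse of the incidence matrix on `ℤ^5`. -/
def mulN (t : ℕ) (x : Fin 5 → ℤ) : Fin 5 → ℤ :=
  ![x 1, x 2, x 3, x 4, x 0 - (t + 1) * x 1 - t * x 4]

/-- The translation belonging to a rule of kind `k` with index `i`. -/
def shift (k : Fin 4) (i : ℕ) : Fin 5 → ℤ :=
  ![![0, i, i, 0] k, ![0, 1, 0, 0] k, 0, 0, ![0, 0, 1, 0] k]

/-- The number of indices of a rule of kind `k`; kind `3` means that there is no rule. -/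
def ruleCount (t : ℕ) : Fin 4 → ℕ := ![1, t + 1, t, 0]

/-- The kind of the rule leading from faces of type `p` to faces of type `u`. -/
def faceRule (p u : Fin 10) : Fin 4 :=
  if (p, u) ∈ [((0 : Fin 10), (3 : Fin 10)), (1, 6), (2, 7), (3, 9), (4, 0), (5, 1), (6, 2), (7, 5),
    (8, 4), (9, 8)] then 0
  else if (p, u) ∈ [((4 : Fin 10), (6 : Fin 10)), (5, 7), (6, 9)] then 1
  else if (p, u) ∈ [((6 : Fin 10), (3 : Fin 10)), (7, 6), (9, 7)] then 2
  else 3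

theorem mulM_mulN (t : ℕ) (x : Fin 5 → ℤ) : mulM t (mulN t x) = x := by
  ext i; fin_cases i <;> simp [mulM, mulN]

theorem mulN_mulM (t : ℕ) (x : Fin 5 → ℤ) : mulN t (mulM t x) = x := by
  ext i; fin_cases i <;> simp [mulM, mulN]
  ring

theorem mulM_eq_iff (t : ℕ) (z x : Fin 5 → ℤ) : mulM t z = x ↔ z = mulN t x :=
  ⟨fun h => by rw [← h, mulN_mulM], fun h => by rw [h, mulM_mulN]⟩

theorem mulN_add (t : ℕ) (x y : Fin 5 → ℤ) : mulN t (x + y) = mulN t x + mulN t y := by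
  ext i; fin_cases i <;> simp [mulN]; ring

theorem incidence_sigma (t : ℕ) : incidence (sigma t) =
    !![(t : ℤ) + 1, 0, 0, t, 1; 1, 0, 0, 0, 0; 0, 1, 0, 0, 0; 0, 0, 1, 0, 0; 0, 0, 0, 1, 0] := by
  ext b a
  fin_cases a <;> fin_cases b <;>
    simp [incidence, abel, sigma, List.count_replicate]

theorem incidence_inv_mulVec (t : ℕ) (x : Fin 5 → ℤ) :
    (incidence (sigma t))⁻¹.mulVec x = mulN t x := by
  have h : incidence (sigma t) *
      !![0, 1, 0, 0, 0; 0, 0, 1, 0, 0; 0, 0, 0, 1, 0; 0, 0, 0, 0, 1;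
        1, -((t : ℤ) + 1), 0, 0, -(t : ℤ)] = 1 := by
    rw [incidence_sigma]
    ext i j
    fin_cases i <;> fin_cases j <;> simp [Matrix.mul_apply, Fin.sum_univ_succ]
  rw [Matrix.inv_eq_right_inv h]
  ext i
  fin_cases i <;> simp [Matrix.mulVec, dotProduct, Fin.sum_univ_succ, mulN]
  ring

/-! ## The positions of the letters in the images of the letters -/

/-- The letter at a position of `σ(a)` and the abelianization of the prefix. -/
def splitAt (σ : Substitution 5) (a : Fin 5) (d : Fin (σ a).length) : Fin 5 × (Fin 5 → ℤ) :=
  ((σ a).get d, abel ((σ a).take d))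

/-- The sum of a function over all decompositions of `σ(a)`. -/
def splitSum {A : Type*} [AddCommMonoid A] (σ : Substitution 5) (a : Fin 5)
    (ψ : Fin 5 × (Fin 5 → ℤ) → A) : A :=
  ∑ d : Fin (σ a).length, ψ (splitAt σ a d)

theorem sum_pi_fin_three {A : Type*} [AddCommMonoid A] {α : Fin 3 → Type*} [∀ i, Fintype (α i)]
    (f : (∀ i, α i) → A) :
    ∑ D, f D = ∑ x : α 0, ∑ y : α 1, ∑ z : α 2,
      f (Fin.cons x (Fin.cons y (Fin.cons z finZeroElim))) := by
  rw [← (Fin.consEquiv α).sum_comp, Fintype.sum_prod_type]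
  refine Finset.sum_congr rfl fun x _ => ?_
  rw [← (Fin.consEquiv fun i : Fin 2 => α i.succ).sum_comp, Fintype.sum_prod_type]
  refine Finset.sum_congr rfl fun y _ => ?_
  rw [← (Fin.consEquiv fun i : Fin 1 => α i.succ.succ).sum_comp, Fintype.sum_prod_type]
  refine Finset.sum_congr rfl fun z _ => ?_
  rw [Fintype.sum_unique]
  rfl

theorem sum_decomp {A : Type*} [AddCommMonoid A] (σ : Substitution 5) (l : Fin 3 → Fin 5)
    (Φ : Fin 5 × (Fin 5 → ℤ) → Fin 5 × (Fin 5 → ℤ) → Fin 5 × (Fin 5 → ℤ) → A) :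
    ∑ D : (∀ i, Fin (σ (l i)).length),
        Φ (splitAt σ (l 0) (D 0)) (splitAt σ (l 1) (D 1)) (splitAt σ (l 2) (D 2)) =
      splitSum σ (l 0) fun a => splitSum σ (l 1) fun b => splitSum σ (l 2) fun c => Φ a b c := by
  rw [sum_pi_fin_three]
  rfl

theorem get_replicate_append {α : Type*} (m : ℕ) (a b : α)
    (d : Fin (List.replicate m a ++ [b]).length) :
    (List.replicate m a ++ [b]).get d = if (d : ℕ) < m then a else b := by
  rw [List.get_eq_getElem, List.getElem_append]
  split_ifs with h h' h' <;> first | (simp; done) | (simp at h; omega)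

/-- The positions are counted backwards from the end of the block of equal letters. Prefixes enter
the dual map with a minus sign, so with this count the resulting translations are `shift k i`, free
of `t`. -/
theorem splitSum_zero {A : Type*} [AddCommMonoid A] (t : ℕ) (ψ : Fin 5 × (Fin 5 → ℤ) → A) :
    splitSum (sigma t) 0 ψ = (∑ i ∈ Finset.range (t + 1), ψ (0, ![(t : ℤ) - i, 0, 0, 0, 0])) +
      ψ (1, ![(t : ℤ) + 1, 0, 0, 0, 0]) := by
  have hl : (sigma t 0).length = t + 2 := by simp [sigma]
  have key : splitSum (sigma t) 0 ψ = ∑ d ∈ Finset.range (t + 2),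
      ψ (if d < t + 1 then 0 else 1, ![(d : ℤ), 0, 0, 0, 0]) := by
    rw [← hl, Finset.sum_range, splitSum]
    refine Finset.sum_congr rfl fun d _ => ?_
    have hd : (d : ℕ) < t + 2 := hl ▸ d.2
    congr 1
    ext i
    · exact congrArg Fin.val (get_replicate_append (t + 1) (0 : Fin 5) 1 d)
    · have h : (d : ℕ) ≤ t + 1 := by omega
      fin_cases i <;> simp [splitAt, sigma, abel, List.take_append, List.count_replicate, h]
  rw [key, Finset.sum_range_succ]
  congr 1
  · rw [← Finset.sum_range_reflect]
    refine Finset.sum_congr rfl fun i hi => ?_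
    have hi' := Finset.mem_range.1 hi
    rw [if_pos (by omega)]
    congr 3
    push_cast [show i ≤ t by omega]
    simp
  · simp

theorem splitSum_three {A : Type*} [AddCommMonoid A] (t : ℕ) (ψ : Fin 5 × (Fin 5 → ℤ) → A) :
    splitSum (sigma t) 3 ψ = (∑ i ∈ Finset.range t, ψ (0, ![(t : ℤ) - 1 - i, 0, 0, 0, 0])) +
      ψ (4, ![(t : ℤ), 0, 0, 0, 0]) := by
  have hl : (sigma t 3).length = t + 1 := by simp [sigma]
  have key : splitSum (sigma t) 3 ψ = ∑ d ∈ Finset.range (t + 1),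
      ψ (if d < t then 0 else 4, ![(d : ℤ), 0, 0, 0, 0]) := by
    rw [← hl, Finset.sum_range, splitSum]
    refine Finset.sum_congr rfl fun d _ => ?_
    have hd : (d : ℕ) < t + 1 := hl ▸ d.2
    congr 1
    ext i
    · exact congrArg Fin.val (get_replicate_append (t) (0 : Fin 5) 4 d)
    · have h : (d : ℕ) ≤ t := by omega
      fin_cases i <;> simp [splitAt, sigma, abel, List.take_append, List.count_replicate, h]
  rw [key, Finset.sum_range_succ]
  congr 1
  · rw [← Finset.sum_range_reflect]
    refine Finset.sum_congr rfl fun i hi => ?_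
    have hi' := Finset.mem_range.1 hi
    rw [if_pos (by omega)]
    congr 3
    push_cast [show i ≤ t - 1 by omega, show 1 ≤ t by omega]
    ring
  · simp

theorem splitSum_one {A : Type*} [AddCommMonoid A] (t : ℕ) (ψ : Fin 5 × (Fin 5 → ℤ) → A) :
    splitSum (sigma t) 1 ψ = ψ (2, 0) := by
  have : ∀ d : Fin (sigma t 1).length, splitAt (sigma t) 1 d = (2, 0) := by
    intro d
    change Fin 1 at d
    have : d = 0 := Subsingleton.elim _ _
    subst this
    ext i
    · rfl
    · fin_cases i <;> rfl
  simp only [splitSum, this]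
  exact Fin.sum_univ_one (fun _ => ψ (2, 0))

theorem splitSum_two {A : Type*} [AddCommMonoid A] (t : ℕ) (ψ : Fin 5 × (Fin 5 → ℤ) → A) :
    splitSum (sigma t) 2 ψ = ψ (3, 0) := by
  have : ∀ d : Fin (sigma t 2).length, splitAt (sigma t) 2 d = (3, 0) := by
    intro d
    change Fin 1 at d
    have : d = 0 := Subsingleton.elim _ _
    subst this
    ext i
    · rfl
    · fin_cases i <;> rfl
  simp only [splitSum, this]
  exact Fin.sum_univ_one (fun _ => ψ (3, 0))

theorem splitSum_four {A : Type*} [AddCommMonoid A] (t : ℕ) (ψ : Fin 5 × (Fin 5 → ℤ) → A) :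
    splitSum (sigma t) 4 ψ = ψ (0, 0) := by
  have : ∀ d : Fin (sigma t 4).length, splitAt (sigma t) 4 d = (0, 0) := by
    intro d
    change Fin 1 at d
    have : d = 0 := Subsingleton.elim _ _
    subst this
    ext i
    · rfl
    · fin_cases i <;> rfl
  simp only [splitSum, this]
  exact Fin.sum_univ_one (fun _ => ψ (0, 0))

/-- The coefficient of the type `a` in the wedge of three letters. -/
def wedgeCoeff (c₀ c₁ c₂ : Fin 5) (p : Fin 10) : ℤ :=
  if Function.Injective ![c₀, c₁, c₂] ∧ Finset.univ.image ![c₀, c₁, c₂] = (cotypeOf p).1 then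
    sortSign ![c₀, c₁, c₂] else 0

theorem wedge_apply_cotype (x : Fin 5 → ℤ) (c : Fin 3 → Fin 5) (p : Fin 10) :
    wedge x c (x, cotypeOf p) = wedgeCoeff (c 0) (c 1) (c 2) p := by
  have hc : ![c 0, c 1, c 2] = c := by ext i; fin_cases i <;> rfl
  unfold wedge wedgeCoeff
  rw [hc]
  by_cases h : Function.Injective c
  · rw [dif_pos h, Finsupp.single_apply]
    simp [h, Subtype.ext_iff]
  · rw [dif_neg h, if_neg (fun h' => h h'.1)]
    rfl

/-- The letters of `cotypeOf u` in increasing order. -/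
def coLetter : Fin 10 → Fin 3 → Fin 5 :=
  ![![2, 3, 4], ![1, 3, 4], ![1, 2, 4], ![1, 2, 3], ![0, 3, 4], ![0, 2, 4], ![0, 2, 3],
    ![0, 1, 3], ![0, 1, 4], ![0, 1, 2]]

theorem cotypeOf_letter (u : Fin 10) : (cotypeOf u).letter = coLetter u := by
  have h1 : ∀ u i, coLetter u i ∈ (cotypeOf u).1 := by decide
  have h2 : ∀ u i j, i < j → coLetter u i < coLetter u j := by decide
  exact (Finset.orderEmbOfFin_unique (cotypeOf u).2 (h1 u) (fun _ _ h => h2 u _ _ h)).symm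

theorem cotypeOf_bijective : Function.Bijective cotypeOf := by
  rw [Fintype.bijective_iff_injective_and_card]
  refine ⟨by decide +kernel, ?_⟩
  rw [Fintype.card_finset_len]
  rfl

theorem typeOf_bijective : Function.Bijective typeOf := by
  rw [Fintype.bijective_iff_injective_and_card]
  refine ⟨by decide +kernel, ?_⟩
  rw [Fintype.card_finset_len]
  rfl

/-- The contribution of a choice of three positions to the image of a face. -/
noncomputable def splitTerm (t : ℕ) (x : Fin 5 → ℤ) (p u : Fin 10)
    (a b c : Fin 5 × (Fin 5 → ℤ)) : Chain 5 2 :=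
  Finsupp.single (mulN t (x - (cotypeOf p).vec - (a.2 + b.2 + c.2)) + (cotypeOf u).vec, typeOf u)
    (orientSign p * (cotypeOf p).sign * (cotypeOf u).sign * wedgeCoeff a.1 b.1 c.1 p)

theorem poincare_single {n k m : ℕ} (h : k + m = n) (F : Face n k) (c : ℤ) :
    poincare k m h (Finsupp.single F c) =
      Finsupp.single (F.1 + F.2.vec, F.2.compl h) (c * F.2.sign) := by
  rw [poincare, Finsupp.lift_apply, Finsupp.sum_single_index (by simp), Finsupp.smul_single,
    smul_eq_mul]

theorem poincareInv_single {n k m : ℕ} (h : k + m = n) (F : Face n m) (c : ℤ) :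
    poincareInv k m h (Finsupp.single F c) =
      Finsupp.single (F.1 - (F.2.compl (by omega : m + k = n)).vec, F.2.compl (by omega))
        (c * (F.2.compl (by omega : m + k = n)).sign) := by
  rw [poincareInv, Finsupp.lift_apply, Finsupp.sum_single_index (by simp), Finsupp.smul_single,
    smul_eq_mul]

theorem dualExtension_single {n : ℕ} (σ : Substitution n) (k : ℕ) (F : Face n k) (c : ℤ) :
    dualExtension σ k (Finsupp.single F c) = ∑ b : FaceType n k, ∑ D : Decomp σ b,
      Finsupp.single ((incidence σ)⁻¹.mulVec (F.1 - D.prefixes), b)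
        (c * wedge F.1 D.letters F) := by
  rw [dualExtension, Finsupp.lift_apply, Finsupp.sum_single_index (by simp)]
  simp only [Finset.smul_sum, Finsupp.smul_single, smul_eq_mul]

theorem E2_cellChain_split (t : ℕ) (x : Fin 5 → ℤ) (p : Fin 10) :
    E2 (sigma t) (cellChain (x, p)) = ∑ u : Fin 10,
      splitSum (sigma t) (coLetter u 0) fun a =>
      splitSum (sigma t) (coLetter u 1) fun b =>
      splitSum (sigma t) (coLetter u 2) fun c => splitTerm t x p u a b c := by
  have hc : ∀ h, FaceType.compl (n := 5) (k := 2) (m := 3) h (typeOf p) = cotypeOf p :=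
    fun _ => rfl
  have hd : ∀ h u, FaceType.compl (n := 5) (k := 3) (m := 2) h (cotypeOf u) = typeOf u :=
    fun h u => FaceType.compl_compl (n := 5) (k := 2) (m := 3) (by omega) h (typeOf u)
  simp only [E2, geomDual, LinearMap.comp_apply, cellChain, poincareInv_single, hc,
    dualExtension_single, map_sum, poincare_single]
  rw [← cotypeOf_bijective.sum_comp]
  refine Finset.sum_congr rfl fun u _ => ?_
  rw [← cotypeOf_letter, ← sum_decomp]
  refine Finset.sum_congr rfl fun D _ => ?_
  rw [hd, incidence_inv_mulVec, wedge_apply_cotype, splitTerm]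
  congr 1
  · congr 3
    simp [Decomp.prefixes, Fin.sum_univ_three, splitAt]
  · simp only [splitAt, Decomp.letters]
    ring

/-- These are all the letter triples that can be picked from the images of an increasing triple of
letters. No nonzero coefficient is negative: sorting never costs a sign here. -/
theorem wedgeCoeff_values :
    wedgeCoeff 3 0 0 = ![0, 0, 0, 0, 0, 0, 0, 0, 0, 0] ∧
    wedgeCoeff 3 4 0 = ![0, 0, 0, 0, 1, 0, 0, 0, 0, 0] ∧
    wedgeCoeff 2 0 0 = ![0, 0, 0, 0, 0, 0, 0, 0, 0, 0] ∧
    wedgeCoeff 2 4 0 = ![0, 0, 0, 0, 0, 1, 0, 0, 0, 0] ∧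
    wedgeCoeff 2 3 0 = ![0, 0, 0, 0, 0, 0, 1, 0, 0, 0] ∧
    wedgeCoeff 2 3 4 = ![1, 0, 0, 0, 0, 0, 0, 0, 0, 0] ∧
    wedgeCoeff 0 0 0 = ![0, 0, 0, 0, 0, 0, 0, 0, 0, 0] ∧
    wedgeCoeff 0 4 0 = ![0, 0, 0, 0, 0, 0, 0, 0, 0, 0] ∧
    wedgeCoeff 1 0 0 = ![0, 0, 0, 0, 0, 0, 0, 0, 0, 0] ∧
    wedgeCoeff 1 4 0 = ![0, 0, 0, 0, 0, 0, 0, 0, 1, 0] ∧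
    wedgeCoeff 0 3 0 = ![0, 0, 0, 0, 0, 0, 0, 0, 0, 0] ∧
    wedgeCoeff 1 3 0 = ![0, 0, 0, 0, 0, 0, 0, 1, 0, 0] ∧
    wedgeCoeff 0 3 4 = ![0, 0, 0, 0, 1, 0, 0, 0, 0, 0] ∧
    wedgeCoeff 1 3 4 = ![0, 1, 0, 0, 0, 0, 0, 0, 0, 0] ∧
    wedgeCoeff 0 2 0 = ![0, 0, 0, 0, 0, 0, 0, 0, 0, 0] ∧
    wedgeCoeff 0 2 4 = ![0, 0, 0, 0, 0, 1, 0, 0, 0, 0] ∧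
    wedgeCoeff 1 2 0 = ![0, 0, 0, 0, 0, 0, 0, 0, 0, 1] ∧
    wedgeCoeff 1 2 4 = ![0, 0, 1, 0, 0, 0, 0, 0, 0, 0] ∧
    wedgeCoeff 0 2 3 = ![0, 0, 0, 0, 0, 0, 1, 0, 0, 0] ∧
    wedgeCoeff 1 2 3 = ![0, 0, 0, 1, 0, 0, 0, 0, 0, 0] := by
  decide +kernel

theorem cotypeOf_vec (u : Fin 10) : (cotypeOf u).vec = fun j =>
    ![![0, 0, 1, 1, 1], ![0, 1, 0, 1, 1], ![0, 1, 1, 0, 1], ![0, 1, 1, 1, 0], ![1, 0, 0, 1, 1],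
      ![1, 0, 1, 0, 1], ![1, 0, 1, 1, 0], ![1, 1, 0, 1, 0], ![1, 1, 0, 0, 1], ![1, 1, 1, 0, 0]]
      u j := by
  revert u; decide +kernel

theorem cotypeOf_sign (u : Fin 10) : (cotypeOf u).sign =
    ![1, -1, 1, -1, 1, -1, 1, -1, 1, 1] u := by
  revert u; decide +kernel

theorem splitTerm_eq_zero {t : ℕ} {x : Fin 5 → ℤ} {p u : Fin 10} {a b c : Fin 5 × (Fin 5 → ℤ)}
    (h : wedgeCoeff a.1 b.1 c.1 p = 0) : splitTerm t x p u a b c = 0 := by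
  rw [splitTerm, h, mul_zero, Finsupp.single_zero]

/-- Hypothesis `h` is the cancellation of all signs that makes `E` preserve the positive
orientation. -/
theorem splitTerm_eq {t : ℕ} {x g : Fin 5 → ℤ} {p u : Fin 10} {a b c : Fin 5 × (Fin 5 → ℤ)}
    (h : orientSign p * (cotypeOf p).sign * (cotypeOf u).sign * wedgeCoeff a.1 b.1 c.1 p =
      orientSign u)
    (hv : mulM t (cotypeOf u).vec - (cotypeOf p).vec - (a.2 + b.2 + c.2) = g) :
    splitTerm t x p u a b c = cellChain (mulN t (x + g), u) := by
  rw [splitTerm, h, cellChain, ← hv]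
  congr 2
  rw [show x + (mulM t (cotypeOf u).vec - (cotypeOf p).vec - (a.2 + b.2 + c.2)) =
    (x - (cotypeOf p).vec - (a.2 + b.2 + c.2)) + mulM t (cotypeOf u).vec by abel, mulN_add,
    mulN_mulM]

-- A pair of types is tied by at most one kind of rule, which contributes either one cell or a row
-- of `t + 1` or `t` cells. All other choices of positions repeat a letter or produce the wrong set
-- of letters.
set_option maxHeartbeats 4000000 in
theorem E2_cellChain (t : ℕ) (x : Fin 5 → ℤ) (p : Fin 10) :
    E2 (sigma t) (cellChain (x, p)) = ∑ u : Fin 10,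
      ∑ i ∈ Finset.range (ruleCount t (faceRule p u)),
        cellChain (mulN t (x + shift (faceRule p u) i), u) := by
  rw [E2_cellChain_split]
  refine Finset.sum_congr rfl fun u _ => ?_
  obtain ⟨h1, h2, h3, h4, h5, h6, h7, h8, h9, h10, h11, h12, h13, h14, h15,
    h16, h17, h18, h19, h20⟩ := wedgeCoeff_values
  fin_cases u <;> fin_cases p <;>
  simp [coLetter, splitSum_zero, splitSum_one, splitSum_two, splitSum_three, splitSum_four,
    faceRule, ruleCount, splitTerm_eq_zero, h1, h2, h3, h4, h5, h6, h7, h8,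
    h9, h10, h11, h12, h13, h14, h15, h16, h17, h18, h19, h20]
  all_goals first
    | refine splitTerm_eq ?_ ?_
    | refine Finset.sum_congr rfl fun i _ => splitTerm_eq ?_ ?_
  all_goals first
    | (simp [orientSign, cotypeOf_sign, h2, h4, h5, h6, h10, h12, h13, h14, h16, h17, h18, h19,
        h20]; done)
    | (rw [cotypeOf_vec, cotypeOf_vec]; ext j; fin_cases j <;> simp [mulM, shift])
  all_goals ring

/-! ## The quotient by the neutral lattice and admissible positions -/

/-- The quotient map of `ℤ^5` by the lattice of the neutral space. -/
def quot (x : Fin 5 → ℤ) : ℤ × ℤ × ℤ := (x 0 + x 3, x 0 + x 2 + x 4, x 1 + x 4)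

theorem quot_add (x y : Fin 5 → ℤ) : quot (x + y) = quot x + quot y := by
  simp only [quot, Pi.add_apply, Prod.mk_add_mk, Prod.mk.injEq]
  refine ⟨?_, ?_, ?_⟩ <;> ring

theorem quot_sub (x y : Fin 5 → ℤ) : quot (x - y) = quot x - quot y := by
  simp only [quot, Pi.sub_apply, Prod.mk_sub_mk, Prod.mk.injEq]
  refine ⟨?_, ?_, ?_⟩ <;> ring

/-- Since the neutral lattice, the kernel of `quot`, is invariant, `M` acts on classes; the induced
matrix is of companion form for the cubic. -/
theorem quot_mulM (t : ℕ) (z : Fin 5 → ℤ) : quot (mulM t z) =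
    (t * (quot z).1 + (quot z).2.1, (t + 1) * (quot z).1 + (quot z).2.2, (quot z).1) := by
  simp only [quot, mulM, Prod.mk.injEq, Matrix.cons_val]
  exact ⟨by ring, by ring, trivial⟩

/-- The linear form on the quotient that is multiplied by `β` under the incidence matrix. -/
def ell (β : ℝ) (d : ℤ × ℤ × ℤ) : ℝ := β ^ 2 * d.1 + β * d.2.1 + d.2.2

theorem ell_add (β : ℝ) (d d' : ℤ × ℤ × ℤ) : ell β (d + d') = ell β d + ell β d' := by
  simp only [ell, Prod.fst_add, Prod.snd_add]; push_cast; ring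

theorem ell_sub (β : ℝ) (d d' : ℤ × ℤ × ℤ) : ell β (d - d') = ell β d - ell β d' := by
  simp only [ell, Prod.fst_sub, Prod.snd_sub]; push_cast; ring

theorem ell_neg (β : ℝ) (d : ℤ × ℤ × ℤ) : ell β (-d) = -ell β d := by
  simp only [ell, Prod.fst_neg, Prod.snd_neg]; push_cast; ring

/-- `β` is a root larger than `1` of the Pisot polynomial. -/
structure IsDilation (t : ℕ) (β : ℝ) : Prop where
  one_lt : 1 < β
  root : β ^ 3 = t * β ^ 2 + (t + 1) * β + 1

theorem IsDilation.ell_mulM {t : ℕ} {β : ℝ} (h : IsDilation t β) (z : Fin 5 → ℤ) :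
    ell β (quot (mulM t z)) = β * ell β (quot z) := by
  rw [quot_mulM]
  simp only [ell]
  push_cast
  linear_combination -((quot z).1 : ℝ) * h.root

/-- A sufficient condition for `ell β d` to be non-negative. -/
def isUp (d : ℤ × ℤ × ℤ) : Bool := 0 ≤ d.1 && 0 ≤ d.1 + d.2.1 && 0 ≤ d.1 + d.2.1 + d.2.2

theorem isUp_iff (d : ℤ × ℤ × ℤ) :
    isUp d ↔ 0 ≤ d.1 ∧ 0 ≤ d.1 + d.2.1 ∧ 0 ≤ d.1 + d.2.1 + d.2.2 := by
  simp [isUp, and_assoc]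

/-- Abel summation: the coefficients `β² > β > 1` have positive successive differences, so
non-negative partial sums of the class suffice. The criterion does not mention `β`, which makes the
later finite checks valid for all `t` at once. -/
theorem ell_nonneg {β : ℝ} (hβ : 1 < β) {d : ℤ × ℤ × ℤ} (h : isUp d) : 0 ≤ ell β d := by
  obtain ⟨h1, h2, h3⟩ := (isUp_iff d).1 h
  have e : ell β d = β * (β - 1) * (d.1 : ℝ) + (β - 1) * ((d.1 + d.2.1 : ℤ) : ℝ) +
      ((d.1 + d.2.1 + d.2.2 : ℤ) : ℝ) := by
    simp only [ell]; push_cast; ring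
  have h1' : (0 : ℝ) ≤ (d.1 : ℝ) := by exact_mod_cast h1
  have h2' : (0 : ℝ) ≤ ((d.1 + d.2.1 : ℤ) : ℝ) := by exact_mod_cast h2
  have h3' : (0 : ℝ) ≤ ((d.1 + d.2.1 + d.2.2 : ℤ) : ℝ) := by exact_mod_cast h3
  have hb : 0 ≤ β - 1 := by linarith
  rw [e]
  positivity

theorem ell_pos {β : ℝ} (hβ : 1 < β) {d : ℤ × ℤ × ℤ} (h : isUp d) (hd : d ≠ 0) : 0 < ell β d := by
  obtain ⟨h1, h2, h3⟩ := (isUp_iff d).1 h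
  have e : ell β d = β * (β - 1) * (d.1 : ℝ) + (β - 1) * ((d.1 + d.2.1 : ℤ) : ℝ) +
      ((d.1 + d.2.1 + d.2.2 : ℤ) : ℝ) := by
    simp only [ell]; push_cast; ring
  have h1' : (0 : ℝ) ≤ (d.1 : ℝ) := by exact_mod_cast h1
  have h2' : (0 : ℝ) ≤ ((d.1 + d.2.1 : ℤ) : ℝ) := by exact_mod_cast h2
  have h3' : (0 : ℝ) ≤ ((d.1 + d.2.1 + d.2.2 : ℤ) : ℝ) := by exact_mod_cast h3
  have hb : 0 < β - 1 := by linarith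
  have hp1 : 0 ≤ β * (β - 1) * (d.1 : ℝ) := by positivity
  have hp2 : 0 ≤ (β - 1) * ((d.1 + d.2.1 : ℤ) : ℝ) := by positivity
  rw [e]
  by_contra hle
  apply hd
  have z1 : β * (β - 1) * (d.1 : ℝ) = 0 := by linarith
  have z2 : (β - 1) * ((d.1 + d.2.1 : ℤ) : ℝ) = 0 := by linarith
  have z3 : ((d.1 + d.2.1 + d.2.2 : ℤ) : ℝ) = 0 := by linarith
  have y1 : d.1 = 0 := by
    have : (d.1 : ℝ) = 0 := by
      rcases mul_eq_zero.1 z1 with h | h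
      · nlinarith
      · exact h
    exact_mod_cast this
  have y2 : d.1 + d.2.1 = 0 := by
    rcases mul_eq_zero.1 z2 with h | h
    · linarith
    · exact_mod_cast h
  have y3 : d.1 + d.2.1 + d.2.2 = 0 := by exact_mod_cast z3
  ext <;> simp <;> omega

/-- The position `x` of a cell or edge of type `p` is admissible for the bounds `w`. -/
def Admissible {ι : Type*} (β : ℝ) (w : ι → ℤ × ℤ × ℤ) (p : ι) (x : Fin 5 → ℤ) : Prop :=
  0 ≤ ell β (quot x) ∧ ell β (quot x) < ell β (w p)

/-- A difference of positions that cannot occur between admissible positions. -/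
def excluded {ι : Type*} (w : ι → ℤ × ℤ × ℤ) (p p' : ι) (d : ℤ × ℤ × ℤ) : Bool :=
  isUp (d - w p') || isUp (-d - w p)

/-- For admissible positions the value of `ell` on the difference lies strictly between `-ell β (w
p)` and `ell β (w p')`. -/
theorem Admissible.not_excluded {ι : Type*} {β : ℝ} (hβ : 1 < β) {w : ι → ℤ × ℤ × ℤ} {p p' : ι}
    {x x' : Fin 5 → ℤ} (h : Admissible β w p x) (h' : Admissible β w p' x') :
    excluded w p p' (quot x' - quot x) = false := by
  by_contra hc
  rw [Bool.not_eq_false, excluded, Bool.or_eq_true] at hc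
  rcases hc with hc | hc
  · have := ell_nonneg hβ hc
    rw [ell_sub, ell_sub] at this
    linarith [h.1, h'.2]
  · have := ell_nonneg hβ hc
    rw [ell_sub, ell_neg, ell_sub] at this
    linarith [h.2, h'.1]

/-! ## Pulling back pairs -/

/-- The third coordinate of the translations of kind `k`. -/
def kindLast (k : Fin 4) : ℤ := ![0, 1, 1, 0] k

/-- The surplus of the second coordinate of the translations of kind `k`. -/
def kindMid (k : Fin 4) : ℤ := ![0, 0, 1, 0] k

/-- The difference of the positions of the parents, from that of the children. -/
def pullDiff (d : ℤ × ℤ × ℤ) (k k' : Fin 4) (r : ℤ) : ℤ × ℤ × ℤ :=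
  (d.2.1 + r, d.1 + d.2.2 + r + kindMid k - kindMid k', d.1 + kindLast k - kindLast k')

/-- The restrictions on the parameter `r` in `pullDiff` that hold for all values of `t`. -/
def pullRange (d : ℤ × ℤ × ℤ) (k k' : Fin 4) (r : ℤ) : Bool :=
  (d.1 - kindLast k' < 0 || kindMid k' ≤ r) && (0 < d.1 + kindLast k || r ≤ -kindMid k)

/-- The inequality `i + kindMid k ≤ t * kindLast k` encodes the length of the row in a form common
to all kinds of rules; it is what the later bounds use in place of case distinctions. -/
theorem quot_parent {t : ℕ} {z x : Fin 5 → ℤ} {k : Fin 4} {i : ℕ} (hi : i < ruleCount t k)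
    (h : mulM t z = x + shift k i) : 0 ≤ (i : ℤ) ∧ i + kindMid k ≤ t * kindLast k ∧
      quot x = (t * (quot z).1 + (quot z).2.1 - i,
        (t + 1) * (quot z).1 + (quot z).2.2 - i - kindMid k, (quot z).1 - kindLast k) := by
  have hx : quot x = quot (mulM t z) - quot (shift k i) := by rw [h, quot_add]; abel
  rw [hx, quot_mulM]
  fin_cases k <;> simp only [ruleCount, quot, shift, kindMid, kindLast, Matrix.cons_val,
    Fin.zero_eta, Fin.mk_one, Fin.reduceFinMk, Prod.mk_sub_mk, Prod.mk.injEq] at hi ⊢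
  · obtain rfl : i = 0 := by omega
    simp
  · exact ⟨by positivity, by simp; omega, by simp, by simp, by simp⟩
  · refine ⟨by positivity, by simp; omega, by simp, by simp; ring, by simp⟩
  · simp at hi

theorem pullDiff_of_parents {t : ℕ} {z x z' x' : Fin 5 → ℤ} {k k' : Fin 4} {i i' : ℕ}
    (hi : i < ruleCount t k) (hi' : i' < ruleCount t k')
    (h : mulM t z = x + shift k i) (h' : mulM t z' = x' + shift k' i') :
    ∃ r : ℤ, pullRange (quot z' - quot z) k k' r ∧
      quot x' - quot x = pullDiff (quot z' - quot z) k k' r := by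
  obtain ⟨hj0, hj1, hj⟩ := quot_parent hi h
  obtain ⟨hj0', hj1', hj'⟩ := quot_parent hi' h'
  -- All dependence on `t` and on the two indices is gathered in this integer.
  refine ⟨t * (quot z' - quot z).1 + i - i', ?_, ?_⟩
  · rw [pullRange, Bool.and_eq_true, Bool.or_eq_true, Bool.or_eq_true, decide_eq_true_eq,
      decide_eq_true_eq, decide_eq_true_eq, decide_eq_true_eq]
    constructor
    · rw [or_iff_not_imp_left, not_lt]
      intro hd
      have : (t : ℤ) * kindLast k' ≤ t * (quot z' - quot z).1 := by gcongr; linarith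
      linarith
    · rw [or_iff_not_imp_left, not_lt]
      intro hd
      have : (t : ℤ) * (quot z' - quot z).1 ≤ t * (-kindLast k) := by gcongr; linarith
      linarith
  · rw [hj, hj', pullDiff]
    simp only [Prod.mk_sub_mk, Prod.fst_sub, Prod.snd_sub, Prod.mk.injEq]
    refine ⟨by ring, by ring, by ring⟩

/-- All pairs of parents of a pair of cells with difference `d` are excluded or satisfy `R`. -/
def pullCheck {n : ℕ} (rule : Fin n → Fin n → Fin 4) (w : Fin n → ℤ × ℤ × ℤ)
    (R : Fin n → Fin n → ℤ × ℤ × ℤ → Bool) (u u' : Fin n) (d : ℤ × ℤ × ℤ) : Prop :=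
  ∀ p, rule p u ≠ 3 → ∀ p', rule p' u' ≠ 3 →
    (∀ r ∈ [(-3 : ℤ), -2, -1, 0, 1, 2, 3], pullRange d (rule p u) (rule p' u') r →
      excluded w p p' (pullDiff d (rule p u) (rule p' u') r) ||
        R p p' (pullDiff d (rule p u) (rule p' u') r)) ∧
    (pullRange d (rule p u) (rule p' u') 4 →
      isUp (pullDiff d (rule p u) (rule p' u') 4 - w p')) ∧
    (pullRange d (rule p u) (rule p' u') (-4) →
      isUp (-pullDiff d (rule p u) (rule p' u') (-4) - w p))

instance {n : ℕ} (rule : Fin n → Fin n → Fin 4) (w : Fin n → ℤ × ℤ × ℤ)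
    (R : Fin n → Fin n → ℤ × ℤ × ℤ → Bool) (u u' : Fin n) (d : ℤ × ℤ × ℤ) :
    Decidable (pullCheck rule w R u u' d) := by
  unfold pullCheck; infer_instance

theorem ruleCount_pos {t : ℕ} {k : Fin 4} {i : ℕ} (hi : i < ruleCount t k) : k ≠ 3 := by
  rintro rfl
  simp [ruleCount] at hi

/-- In `pullDiff` the parameter `r` is added to the first two coordinates only. Hence `isUp` at `r =
4` persists for larger `r`, and its negative counterpart at `r = -4` for smaller `r`; seven values
remain for direct inspection. The range conditions pass to `±4` because `kindMid` is at most one. -/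
theorem pullCheck.sound {n : ℕ} {rule : Fin n → Fin n → Fin 4} {w : Fin n → ℤ × ℤ × ℤ}
    {R : Fin n → Fin n → ℤ × ℤ × ℤ → Bool} {t : ℕ} {β : ℝ} (hβ : 1 < β) {u u' p p' : Fin n}
    {z x z' x' : Fin 5 → ℤ} {i i' : ℕ} (hc : pullCheck rule w R u u' (quot z' - quot z))
    (hi : i < ruleCount t (rule p u)) (hi' : i' < ruleCount t (rule p' u'))
    (h : mulM t z = x + shift (rule p u) i) (h' : mulM t z' = x' + shift (rule p' u') i')
    (ha : Admissible β w p x) (ha' : Admissible β w p' x') :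
    R p p' (quot x' - quot x) := by
  have hex := ha.not_excluded hβ ha'
  obtain ⟨r, hr, hd⟩ := pullDiff_of_parents hi hi' h h'
  obtain ⟨h1, h2, h3⟩ := hc p (ruleCount_pos hi) p' (ruleCount_pos hi')
  have hex' := hex
  rw [excluded, Bool.or_eq_false_iff] at hex'
  obtain ⟨he1, he2⟩ := hex'
  have hr' := hr
  rw [pullRange, Bool.and_eq_true, Bool.or_eq_true, Bool.or_eq_true, decide_eq_true_eq,
    decide_eq_true_eq, decide_eq_true_eq, decide_eq_true_eq] at hr'
  have hk : ∀ k : Fin 4, 0 ≤ kindMid k ∧ kindMid k ≤ 1 := by decide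
  rcases lt_or_ge r 4 with hr4 | hr4
  · rcases lt_or_ge (-4) r with hr4' | hr4'
    · have := h1 r (by simp; omega) hr
      rw [← hd, hex, Bool.false_or] at this
      exact this
    · exfalso
      have h3' := h3 (by
        rw [pullRange, Bool.and_eq_true, Bool.or_eq_true, Bool.or_eq_true, decide_eq_true_eq,
          decide_eq_true_eq, decide_eq_true_eq, decide_eq_true_eq]
        have := hk (rule p u)
        have := hk (rule p' u')
        omega)
      rw [← Bool.not_eq_true] at he2
      apply he2
      rw [isUp_iff] at h3' ⊢
      rw [hd]
      simp only [pullDiff, Prod.fst_sub, Prod.snd_sub, Prod.fst_neg, Prod.snd_neg] at h3' ⊢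
      omega
  · exfalso
    have h2' := h2 (by
      rw [pullRange, Bool.and_eq_true, Bool.or_eq_true, Bool.or_eq_true, decide_eq_true_eq,
        decide_eq_true_eq, decide_eq_true_eq, decide_eq_true_eq]
      have := hk (rule p u)
      have := hk (rule p' u')
      omega)
    rw [← Bool.not_eq_true] at he1
    apply he1
    rw [isUp_iff] at h2' ⊢
    rw [hd]
    simp only [pullDiff, Prod.fst_sub, Prod.snd_sub] at h2' ⊢
    omega

/-! ### Admissibility is inherited by children. -/

/-- The bounds for the positions of the faces. -/
def faceBound : Fin 10 → ℤ × ℤ × ℤ :=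
  ![(0, 1, 1), (0, 0, 1), (0, 1, 1), (1, 0, 1), (1, 0, 0), (0, 1, 0), (1, 1, 0), (1, 0, 0),
    (0, 1, 1), (1, 1, 0)]

/-- A rule on `Fin n` is compatible with the bounds `w`. -/
def boundCheck {n : ℕ} (rule : Fin n → Fin n → Fin 4) (w : Fin n → ℤ × ℤ × ℤ) : Prop :=
  ∀ p u, rule p u ≠ 3 → kindLast (rule p u) ≤ (w u).1 ∧ 0 ≤ (w u).1 ∧
    isUp ((w u).2.1 - (w p).1 + kindMid (rule p u), (w u).1 + (w u).2.2 - (w p).2.1,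
      (w u).1 - (w p).2.2 - kindLast (rule p u))

instance {n : ℕ} (rule : Fin n → Fin n → Fin 4) (w : Fin n → ℤ × ℤ × ℤ) :
    Decidable (boundCheck rule w) := by
  unfold boundCheck; infer_instance

theorem quot_shift (k : Fin 4) (i : ℕ) : isUp (quot (shift k i)) := by
  rw [isUp_iff]
  fin_cases k <;> simp [quot, shift] <;> omega

/-- Lower bound: the translations have non-negative `ell`. Upper bound: `M` applied to the bound of
the child dominates the bound of the parent plus the translation. It suffices to test this at the
largest index, where `t` drops out; that test is `boundCheck`. -/
theorem Admissible.child {n : ℕ} {rule : Fin n → Fin n → Fin 4} {w : Fin n → ℤ × ℤ × ℤ}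
    (hc : boundCheck rule w) {t : ℕ} {β : ℝ} (hβ : IsDilation t β) {p u : Fin n}
    {x z : Fin 5 → ℤ} {i : ℕ} (hi : i < ruleCount t (rule p u))
    (h : mulM t z = x + shift (rule p u) i) (ha : Admissible β w p x) :
    Admissible β w u z := by
  have hl := hβ.ell_mulM z
  have hb : 0 < β := by linarith [hβ.one_lt]
  constructor
  · rw [h, quot_add, ell_add] at hl
    have := ell_nonneg hβ.one_lt (quot_shift (rule p u) i)
    have h2 : 0 ≤ β * ell β (quot z) := by linarith [ha.1]
    exact nonneg_of_mul_nonneg_right h2 hb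
  · obtain ⟨hj0, hj1, hj⟩ := quot_parent hi h
    obtain ⟨h1, h2, h3⟩ := hc p u (ruleCount_pos hi)
    have hs : (t : ℤ) * kindLast (rule p u) ≤ t * (w u).1 := by gcongr
    have hup : isUp ((t * (w u).1 + (w u).2.1, (t + 1) * (w u).1 + (w u).2.2, (w u).1) -
        (w p + ((i : ℤ), i + kindMid (rule p u), kindLast (rule p u)))) := by
      rw [isUp_iff] at h3 ⊢
      simp only [Prod.fst_sub, Prod.snd_sub, Prod.fst_add, Prod.snd_add] at h3 ⊢
      rw [add_mul]
      refine ⟨?_, ?_, ?_⟩ <;> linarith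
    have hM : ell β (t * (w u).1 + (w u).2.1, (t + 1) * (w u).1 + (w u).2.2, (w u).1) =
        β * ell β (w u) := by
      simp only [ell]; push_cast; linear_combination -((w u).1 : ℝ) * hβ.root
    have h4 := ell_nonneg hβ.one_lt hup
    rw [ell_sub, hM, ell_add] at h4
    have h5 : ell β (quot x) =
        β * ell β (quot z) - ell β ((i : ℤ), i + kindMid (rule p u), kindLast (rule p u)) := by
      rw [hj]
      simp only [ell]; push_cast; linear_combination -((quot z).1 : ℝ) * hβ.root
    have h6 : β * ell β (quot z) < β * ell β (w u) := by linarith [ha.2]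
    exact lt_of_mul_lt_mul_left h6 hb.le

/-! ## The cells generated by a set of cells -/

/-- The cells in the image of a cell. -/
def children (t : ℕ) (F : Cell) : Finset Cell :=
  Finset.univ.biUnion fun u => (Finset.range (ruleCount t (faceRule F.2 u))).image fun i =>
    (mulN t (F.1 + shift (faceRule F.2 u) i), u)

theorem mem_children {t : ℕ} {F G : Cell} : G ∈ children t F ↔
    ∃ i < ruleCount t (faceRule F.2 G.2), mulM t G.1 = F.1 + shift (faceRule F.2 G.2) i := by
  simp only [children, Finset.mem_biUnion, Finset.mem_univ, true_and, Finset.mem_image,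
    Finset.mem_range, mulM_eq_iff]
  constructor
  · rintro ⟨u, i, hi, rfl⟩
    exact ⟨i, hi, rfl⟩
  · rintro ⟨i, hi, h⟩
    exact ⟨G.2, i, hi, Prod.ext h.symm rfl⟩

/-- The sum of the positively oriented faces of a set of cells. -/
noncomputable def chainOf (S : Finset Cell) : Chain 5 2 := ∑ F ∈ S, cellChain F

/-- The index can be read off the class, so siblings of the same type differ even modulo the neutral
lattice. -/
theorem shift_injOn {t : ℕ} {k : Fin 4} {i j : ℕ} (hi : i < ruleCount t k)
    (hj : j < ruleCount t k) (h : quot (shift k i) = quot (shift k j)) : i = j := by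
  fin_cases k <;> simp [ruleCount, quot, shift] at hi hj h <;> omega

theorem E2_cellChain_eq_chainOf (t : ℕ) (F : Cell) :
    E2 (sigma t) (cellChain F) = chainOf (children t F) := by
  rw [E2_cellChain, chainOf, children, Finset.sum_biUnion]
  · refine Finset.sum_congr rfl fun u _ => ?_
    rw [Finset.sum_image]
    intro i hi j hj hij
    simp only [Finset.coe_range, Set.mem_Iio, Prod.mk.injEq, and_true] at hi hj hij
    have := congrArg (mulM t) hij
    rw [mulM_mulN, mulM_mulN, add_right_inj] at this
    exact shift_injOn hi hj (by rw [this])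
  · intro u _ u' _ hne
    simp only [Function.onFun, Finset.disjoint_left, Finset.mem_image, not_exists, not_and]
    rintro _ ⟨i, _, rfl⟩ j _ h
    exact hne (Prod.ext_iff.1 h).2.symm

/-- The cells in the `n`-th image of a set of cells. -/
def descend (t : ℕ) : ℕ → Finset Cell → Finset Cell
  | 0, A => A
  | n + 1, A => (descend t n A).biUnion (children t)

theorem descend_add (t m n : ℕ) (A : Finset Cell) :
    descend t (m + n) A = descend t n (descend t m A) := by
  induction n with
  | zero => rfl
  | succ n ih => rw [← add_assoc, descend, descend, ih]

theorem descend_mono (t n : ℕ) {A B : Finset Cell} (h : A ⊆ B) : descend t n A ⊆ descend t n B := by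
  induction n with
  | zero => exact h
  | succ n ih => exact Finset.biUnion_subset_biUnion_of_subset_left _ ih

theorem mem_descend_iff {t n : ℕ} {A : Finset Cell} {G : Cell} :
    G ∈ descend t n A ↔ ∃ F ∈ A, G ∈ descend t n {F} := by
  induction n generalizing G with
  | zero => simp [descend]
  | succ n ih =>
    simp only [descend, Finset.mem_biUnion]
    constructor
    · rintro ⟨H, hH, hG⟩
      obtain ⟨F, hF, hH⟩ := ih.1 hH
      exact ⟨F, hF, H, hH, hG⟩
    · rintro ⟨F, hF, H, hH, hG⟩
      exact ⟨H, ih.2 ⟨F, hF, hH⟩, hG⟩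

/-! ### Separation of cells is inherited by children. -/

/-- The differences of positions for pairs of types that do not occur in spread sets of cells. -/
def nearList : List (Fin 10 × Fin 10 × ℤ × ℤ × ℤ) := [
    (0, 1, 0, -1, 0), (0, 2, 0, 0, 0), (0, 5, 0, 0, -1), (0, 5, 0, 0, 0), (0, 8, 0, -1, 0),
    (0, 8, 0, 0, 0), (0, 9, 0, 0, 0), (1, 2, 0, 1, 0), (1, 3, 0, 0, 0), (1, 5, 0, 1, -1),
    (1, 6, 1, 1, -1), (1, 8, 0, 0, 0), (1, 8, 0, 1, 0), (1, 9, 0, 1, 0), (2, 3, 1, 0, 0),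
    (2, 4, 1, 0, -1), (2, 5, 0, 0, -1), (2, 6, 1, 0, -1), (2, 7, 1, -1, -1), (2, 8, 0, 0, 0),
    (2, 8, 1, 0, 0), (3, 4, 0, 0, -1), (3, 4, 0, 0, 0), (3, 5, -1, 0, 0), (3, 6, 0, 0, -1),
    (3, 7, 0, -1, -1), (3, 7, 0, 0, 0), (3, 8, 0, 0, 0), (3, 9, -1, 0, 0), (4, 6, 0, 0, -1),
    (4, 6, 0, 0, 0), (4, 7, 0, -1, 0), (4, 7, 0, 0, 0), (4, 8, 0, 0, 1), (4, 9, 0, 0, 0),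
    (4, 9, 0, 1, 1), (5, 6, 1, 0, -1), (5, 6, 1, 0, 0), (5, 7, 1, -1, 0), (5, 8, 0, 0, 1),
    (5, 9, 0, 0, 0), (5, 9, 1, 0, 0), (6, 7, 0, -1, 0), (6, 7, 0, 0, 1), (6, 8, -1, -1, 1),
    (6, 8, 0, 0, 1), (6, 9, -1, 0, 1), (6, 9, 0, 0, 0), (6, 9, 0, 1, 1), (7, 9, 0, 1, 0),
    (7, 9, 0, 2, 1), (8, 9, 0, 1, 0)]

/-- Pairs of different cells that do not occur together. -/
def nearNe (p p' : Fin 10) (d : ℤ × ℤ × ℤ) : Bool :=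
  (p, p', d) ∈ nearList || (p', p, -d) ∈ nearList

/-- The list is closed under passing to parents, up to differences excluded by admissibility. Read
contrapositively, parents that are not near have children that are not near. Both orders are tested
because `nearNe` symmetrizes the list. -/
theorem nearNe_pull : ∀ q ∈ nearList, pullCheck faceRule faceBound nearNe q.1 q.2.1 q.2.2 ∧
    pullCheck faceRule faceBound nearNe q.2.1 q.1 (-q.2.2) := by
  decide +kernel

/-- The closed list absorbs every way in which two children can coincide in type and class: their
parents are near, or already coincide. -/
theorem near_pull : ∀ p, pullCheck faceRule faceBound
    (fun a b d => nearNe a b d || (decide (a = b) && decide (d = 0))) p p 0 := by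
  decide +kernel

theorem nearNe_irrefl : ∀ p, nearNe p p 0 = false := by
  decide +kernel

theorem faceBound_check : boundCheck faceRule faceBound := by
  decide +kernel

/-- Two cells are separated if they may occur together. -/
def Separated (F G : Cell) : Prop :=
  nearNe F.2 G.2 (quot G.1 - quot F.1) = false ∧ ¬(F.2 = G.2 ∧ quot G.1 - quot F.1 = 0)

theorem nearNe_of_children {t : ℕ} {β : ℝ} (hβ : IsDilation t β) {F F' G G' : Cell}
    (hF : Admissible β faceBound F.2 F.1) (hF' : Admissible β faceBound F'.2 F'.1)
    (hG : G ∈ children t F) (hG' : G' ∈ children t F')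
    (h : nearNe G.2 G'.2 (quot G'.1 - quot G.1)) : nearNe F.2 F'.2 (quot F'.1 - quot F.1) := by
  obtain ⟨i, hi, hm⟩ := mem_children.1 hG
  obtain ⟨i', hi', hm'⟩ := mem_children.1 hG'
  have hc : pullCheck faceRule faceBound nearNe G.2 G'.2 (quot G'.1 - quot G.1) := by
    rw [nearNe, Bool.or_eq_true, decide_eq_true_eq, decide_eq_true_eq] at h
    rcases h with h | h
    · exact (nearNe_pull _ h).1
    · have := (nearNe_pull _ h).2
      rwa [neg_neg] at this
  exact hc.sound hβ.one_lt hi hi' hm hm' hF hF'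

theorem Separated.children {t : ℕ} {β : ℝ} (hβ : IsDilation t β) {F F' G G' : Cell}
    (hF : Admissible β faceBound F.2 F.1) (hF' : Admissible β faceBound F'.2 F'.1)
    (hs : Separated F F') (hG : G ∈ children t F) (hG' : G' ∈ children t F') :
    Separated G G' := by
  refine ⟨?_, ?_⟩
  · rw [← Bool.not_eq_true]
    intro h
    have := nearNe_of_children hβ hF hF' hG hG' h
    rw [hs.1] at this
    exact absurd this (by decide)
  · rintro ⟨h1, h2⟩
    obtain ⟨i, hi, hm⟩ := mem_children.1 hG
    obtain ⟨i', hi', hm'⟩ := mem_children.1 hG'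
    have hc : pullCheck faceRule faceBound
        (fun a b d => nearNe a b d || (decide (a = b) && decide (d = 0))) G.2 G'.2
        (quot G'.1 - quot G.1) := by
      rw [h2, ← h1]
      exact near_pull _
    have := hc.sound hβ.one_lt hi hi' hm hm' hF hF'
    rw [hs.1, Bool.false_or, Bool.and_eq_true, decide_eq_true_eq, decide_eq_true_eq] at this
    exact hs.2 this

/-- A near pair of siblings would make the parent near to itself, against `nearNe_irrefl`; equal
types and classes force equal row indices. -/
theorem separated_siblings {t : ℕ} {β : ℝ} (hβ : IsDilation t β) {F G G' : Cell}
    (hF : Admissible β faceBound F.2 F.1) (hG : G ∈ _root_.children t F)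
    (hG' : G' ∈ _root_.children t F) (hne : G ≠ G') : Separated G G' := by
  refine ⟨?_, ?_⟩
  · rw [← Bool.not_eq_true]
    intro h
    have := nearNe_of_children hβ hF hF hG hG' h
    rw [sub_self, nearNe_irrefl] at this
    exact absurd this (by decide)
  · rintro ⟨h1, h2⟩
    obtain ⟨i, hi, hm⟩ := mem_children.1 hG
    obtain ⟨i', hi', hm'⟩ := mem_children.1 hG'
    rw [← h1] at hi' hm'
    have hq : quot (mulM t G'.1) = quot (mulM t G.1) := by
      rw [quot_mulM, quot_mulM, sub_eq_zero.1 h2]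
    rw [hm, hm', quot_add, quot_add, add_right_inj] at hq
    have := shift_injOn hi' hi hq
    rw [this, ← hm] at hm'
    have := congrArg (mulN t) hm'
    rw [mulN_mulM, mulN_mulM] at this
    exact hne (Prod.ext this.symm h1)

/-- All cells are admissible and distinct cells are separated. -/
structure Spread (β : ℝ) (A : Finset Cell) : Prop where
  admissible : ∀ F ∈ A, Admissible β faceBound F.2 F.1
  separated : ∀ F ∈ A, ∀ G ∈ A, F ≠ G → Separated F G

theorem not_separated_self (F : Cell) : ¬Separated F F :=
  fun h => h.2 ⟨rfl, sub_self _⟩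

theorem Spread.pairwiseDisjoint {t : ℕ} {β : ℝ} (hβ : IsDilation t β) {A : Finset Cell}
    (h : Spread β A) : (A : Set Cell).PairwiseDisjoint (children t) := by
  intro F hF F' hF' hne
  rw [Function.onFun, Finset.disjoint_left]
  intro G hG hG'
  exact not_separated_self G ((h.separated F hF F' hF' hne).children hβ (h.admissible F hF)
    (h.admissible F' hF') hG hG')

theorem admissible_children {t : ℕ} {β : ℝ} (hβ : IsDilation t β) {F G : Cell}
    (hF : Admissible β faceBound F.2 F.1) (hG : G ∈ children t F) :
    Admissible β faceBound G.2 G.1 := by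
  obtain ⟨i, hi, hm⟩ := mem_children.1 hG
  exact hF.child faceBound_check hβ hi hm

theorem Spread.biUnion_children {t : ℕ} {β : ℝ} (hβ : IsDilation t β) {A : Finset Cell}
    (h : Spread β A) : Spread β (A.biUnion (children t)) := by
  refine ⟨fun G hG => ?_, fun G hG G' hG' hne => ?_⟩
  · obtain ⟨F, hF, hG⟩ := Finset.mem_biUnion.1 hG
    exact admissible_children hβ (h.admissible F hF) hG
  · obtain ⟨F, hF, hG⟩ := Finset.mem_biUnion.1 hG
    obtain ⟨F', hF', hG'⟩ := Finset.mem_biUnion.1 hG'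
    by_cases e : F = F'
    · subst e
      exact separated_siblings hβ (h.admissible F hF) hG hG' hne
    · exact (h.separated F hF F' hF' e).children hβ (h.admissible F hF) (h.admissible F' hF')
        hG hG'

theorem Spread.descend {t : ℕ} {β : ℝ} (hβ : IsDilation t β) {A : Finset Cell}
    (h : Spread β A) (n : ℕ) : Spread β (descend t n A) := by
  induction n with
  | zero => exact h
  | succ n ih => exact ih.biUnion_children hβ

/-- Separated parents have disjoint sets of children, so no coefficient exceeds one and iterating
`E` amounts to iterating `children`. -/
theorem Spread.E2_pow {t : ℕ} {β : ℝ} (hβ : IsDilation t β) {A : Finset Cell}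
    (h : Spread β A) (n : ℕ) :
    (E2 (sigma t) ^ n) (chainOf A) = chainOf (_root_.descend t n A) := by
  induction n with
  | zero => rfl
  | succ n ih =>
    rw [pow_succ', Module.End.mul_apply, ih, chainOf, map_sum]
    simp only [E2_cellChain_eq_chainOf]
    rw [_root_.descend, chainOf, Finset.sum_biUnion ((h.descend hβ n).pairwiseDisjoint hβ)]
    rfl

theorem Spread.disjoint_descend {t : ℕ} {β : ℝ} (hβ : IsDilation t β) {A : Finset Cell}
    (h : Spread β A) {F F' : Cell} (hF : F ∈ A) (hF' : F' ∈ A) (hne : F ≠ F') (n : ℕ) :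
    Disjoint (_root_.descend t n {F}) (_root_.descend t n {F'}) := by
  have key : ∀ n, ∀ G ∈ _root_.descend t n {F}, ∀ G' ∈ _root_.descend t n {F'},
      Admissible β faceBound G.2 G.1 ∧ Admissible β faceBound G'.2 G'.1 ∧ Separated G G' := by
    intro n
    induction n with
    | zero =>
      intro G hG G' hG'
      rw [_root_.descend, Finset.mem_singleton] at hG hG'
      subst hG hG'
      exact ⟨h.admissible _ hF, h.admissible _ hF', h.separated _ hF _ hF' hne⟩
    | succ n ih =>
      intro G hG G' hG'
      obtain ⟨H, hH, hG⟩ := Finset.mem_biUnion.1 hG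
      obtain ⟨H', hH', hG'⟩ := Finset.mem_biUnion.1 hG'
      obtain ⟨h1, h2, h3⟩ := ih H hH H' hH'
      exact ⟨admissible_children hβ h1 hG, admissible_children hβ h2 hG',
        h3.children hβ h1 h2 hG hG'⟩
  rw [Finset.disjoint_left]
  intro G hG hG'
  exact not_separated_self G (key n G hG G hG').2.2

/-! ## The faces of a chain of cells -/

/-- The face of a cell. -/
def toFace (F : Cell) : Face 5 2 := (F.1, typeOf F.2)

theorem toFace_bijective : Function.Bijective toFace :=
  Function.Bijective.prodMap Function.bijective_id typeOf_bijective

theorem orientSign_eq (p : Fin 10) : orientSign p = 1 ∨ orientSign p = -1 := by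
  revert p; decide

theorem chainOf_apply (S : Finset Cell) (F : Cell) :
    chainOf S (toFace F) = if F ∈ S then orientSign F.2 else 0 := by
  rw [chainOf, Finsupp.finsetSum_apply]
  have : ∀ G ∈ S, cellChain G (toFace F) = if F = G then orientSign F.2 else 0 := by
    intro G _
    rw [cellChain, show (G.1, typeOf G.2) = toFace G from rfl, Finsupp.single_apply]
    by_cases h : F = G
    · rw [if_pos h, if_pos (congrArg toFace h.symm), h]
    · rw [if_neg h, if_neg fun h' => h (toFace_bijective.1 h').symm]
  rw [Finset.sum_congr rfl this, Finset.sum_ite_eq]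

theorem mem_support_chainOf {S : Finset Cell} {F : Cell} :
    toFace F ∈ (chainOf S).support ↔ F ∈ S := by
  rw [Finsupp.mem_support_iff, chainOf_apply]
  by_cases h : F ∈ S
  · rcases orientSign_eq F.2 with h' | h' <;> simp [h, h']
  · simp [h]

theorem mem_support_chainOf_iff {S : Finset Cell} {f : Face 5 2} :
    f ∈ (chainOf S).support ↔ ∃ F ∈ S, toFace F = f := by
  obtain ⟨F, rfl⟩ := toFace_bijective.2 f
  rw [mem_support_chainOf]
  exact ⟨fun h => ⟨F, h, rfl⟩, fun ⟨G, hG, h⟩ => toFace_bijective.1 h ▸ hG⟩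

theorem isGeometric_chainOf (S : Finset Cell) : IsGeometric (chainOf S) := by
  intro f hf
  obtain ⟨F, hF, rfl⟩ := mem_support_chainOf_iff.1 hf
  rw [chainOf_apply, if_pos hF]
  exact orientSign_eq F.2

/-! ## Cells at the origin -/

/-- The permutation of the types of the faces based at the origin. -/
def rotate : Fin 10 → Fin 10 := ![3, 6, 7, 9, 0, 1, 2, 5, 4, 8]

theorem rotate_iterate_five (p : Fin 10) : rotate^[5] p = p := by
  revert p; decide

theorem rotate_injective : Function.Injective rotate := by decide

theorem faceRule_eq_zero : ∀ p u, faceRule p u = 0 ↔ u = rotate p := by decide +kernel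

/-- At position zero the `ell`-values of the parent and of the translation are non-negative with sum
zero, so both vanish. A translation with vanishing `ell` has class zero, which only the rules of
kind `0` achieve. -/
theorem zero_mem_children {t : ℕ} {β : ℝ} (hβ : IsDilation t β) {F : Cell} {u : Fin 10}
    (hF : Admissible β faceBound F.2 F.1) :
    ((0, u) : Cell) ∈ children t F ↔ F.1 = 0 ∧ u = rotate F.2 := by
  rw [mem_children, ← faceRule_eq_zero]
  have hz : mulM t 0 = 0 := by ext i; fin_cases i <;> simp [mulM]
  constructor
  · rintro ⟨i, hi, h⟩
    rw [hz] at h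
    have h1 : ell β (quot F.1) + ell β (quot (shift (faceRule F.2 u) i)) = 0 := by
      rw [← ell_add, ← quot_add, ← h]
      simp [ell, quot]
    have h2 : ell β (quot (shift (faceRule F.2 u) i)) ≤ 0 := by linarith [hF.1]
    have h3 : quot (shift (faceRule F.2 u) i) = 0 := by
      by_contra h3
      linarith [ell_pos hβ.one_lt (quot_shift _ _) h3]
    have h4 : faceRule F.2 u = 0 := by
      generalize faceRule F.2 u = k at *
      fin_cases k <;> simp [ruleCount, quot, shift] at hi h3 ⊢
    refine ⟨?_, h4⟩
    rw [h4] at h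
    simp only [h4, ruleCount, Matrix.cons_val_zero, Nat.lt_one_iff] at hi
    rw [show shift 0 i = 0 by ext j; fin_cases j <;> simp [shift], add_zero] at h
    exact h.symm
  · rintro ⟨h, h'⟩
    rw [h', h]
    refine ⟨0, by simp [ruleCount], ?_⟩
    rw [hz]
    ext j; fin_cases j <;> simp [shift]

theorem zero_mem_descend {t : ℕ} {β : ℝ} (hβ : IsDilation t β) {A : Finset Cell}
    (h : ∀ F ∈ A, Admissible β faceBound F.2 F.1) (n : ℕ) (p : Fin 10) :
    ((0, rotate^[n] p) : Cell) ∈ descend t n A ↔ ((0, p) : Cell) ∈ A := by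
  have adm : ∀ n, ∀ F ∈ descend t n A, Admissible β faceBound F.2 F.1 := by
    intro n
    induction n with
    | zero => exact h
    | succ n ih =>
      intro G hG
      obtain ⟨F, hF, hG⟩ := Finset.mem_biUnion.1 hG
      exact admissible_children hβ (ih F hF) hG
  induction n with
  | zero => rfl
  | succ n ih =>
    refine Iff.trans ?_ ih
    rw [descend, Finset.mem_biUnion, Function.iterate_succ_apply']
    constructor
    · rintro ⟨⟨x, q⟩, hF, hG⟩
      obtain ⟨h1, h2⟩ := (zero_mem_children hβ (adm n _ hF)).1 hG
      obtain rfl : rotate^[n] p = q := rotate_injective h2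
      obtain rfl : x = 0 := h1
      exact hF
    · intro hF
      exact ⟨_, hF, (zero_mem_children hβ (adm n _ hF)).2 ⟨rfl, rfl⟩⟩

theorem admissible_zero {β : ℝ} (hβ : 1 < β) (p : Fin 10) : Admissible β faceBound p 0 := by
  have h0 : ell β (quot 0) = 0 := by simp [ell, quot]
  have hw : ∀ p, isUp (faceBound p) ∧ faceBound p ≠ 0 := by decide
  exact ⟨h0.ge, h0 ▸ ell_pos hβ (hw p).1 (hw p).2⟩

theorem subset_descend_five {t : ℕ} {β : ℝ} (hβ : IsDilation t β) {A : Finset Cell}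
    (h : ∀ F ∈ A, F.1 = 0) : A ⊆ descend t 5 A := by
  rintro ⟨x, p⟩ hF
  obtain rfl : x = 0 := h _ hF
  have := (zero_mem_descend hβ (A := A) (fun ⟨y, q⟩ hG => ?_) 5 p).2 hF
  · rwa [rotate_iterate_five] at this
  · obtain rfl : y = 0 := h _ hG
    exact admissible_zero hβ.one_lt q

theorem descend_subset {t : ℕ} {β : ℝ} (hβ : IsDilation t β) {A : Finset Cell}
    (h : ∀ F ∈ A, F.1 = 0) (n k : ℕ) : descend t n A ⊆ descend t (n + 5 * k) A := by
  induction k with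
  | zero => exact subset_rfl
  | succ k ih =>
    refine ih.trans ?_
    -- The five extra steps are taken first: it is the initial set at the origin that is known to
    -- lie in its own fifth image.
    rw [show n + 5 * (k + 1) = 5 + (n + 5 * k) by ring, descend_add t 5]
    exact descend_mono t _ (subset_descend_five hβ h)

theorem spread_singleton {β : ℝ} (hβ : 1 < β) (p : Fin 10) : Spread β {((0, p) : Cell)} := by
  refine ⟨fun F hF => ?_, fun F hF G hG hne => ?_⟩
  · rw [Finset.mem_singleton] at hF
    subst hF
    exact admissible_zero hβ p
  · rw [Finset.mem_singleton] at hF hG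
    exact absurd (hF.trans hG.symm) hne

/-- Elements based at the origin with arbitrary coefficients. -/
theorem E2_pow_combination {t : ℕ} {β : ℝ} (hβ : IsDilation t β) (ε : Fin 10 → ℤ) (n : ℕ) :
    (E2 (sigma t) ^ n) (∑ p, ε p • cellChain (0, p)) =
      ∑ p, ε p • chainOf (descend t n {((0, p) : Cell)}) := by
  rw [map_sum]
  refine Finset.sum_congr rfl fun p _ => ?_
  rw [map_zsmul, ← (spread_singleton hβ.one_lt p).E2_pow hβ n, chainOf, Finset.sum_singleton]

theorem eq_combination {U : Chain 5 2} (h : BasedAtZero U) :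
    U = ∑ p, (orientSign p * U (toFace (0, p))) • cellChain (0, p) := by
  ext f
  obtain ⟨⟨x, q⟩, rfl⟩ := toFace_bijective.2 f
  rw [Finsupp.finsetSum_apply]
  have hs : ∀ p, orientSign p * orientSign p = 1 := by decide
  by_cases hx : x = 0
  · subst hx
    rw [Finset.sum_eq_single q]
    · rw [Finsupp.smul_apply, cellChain, show ((0 : Fin 5 → ℤ), typeOf q) = toFace (0, q) from rfl,
        Finsupp.single_eq_same, smul_eq_mul, mul_right_comm, hs, one_mul]
    · intro p _ hp
      rw [Finsupp.smul_apply, cellChain, Finsupp.single_eq_of_ne, smul_zero]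
      intro h'
      exact hp (Prod.ext_iff.1 (toFace_bijective.1 (h' : toFace (0, q) = toFace (0, p)))).2.symm
    · simp
  · rw [Finset.sum_eq_zero]
    · by_contra hne
      exact hx (h _ (Finsupp.mem_support_iff.2 hne))
    · intro p _
      rw [Finsupp.smul_apply, cellChain, Finsupp.single_eq_of_ne, smul_zero]
      intro h'
      exact hx (Prod.ext_iff.1 (toFace_bijective.1 (h' : toFace (x, q) = toFace (0, p)))).1

/-- Only the face `(0, q)` itself contributes to the coefficient at `(0, q)` after five steps, since
`rotate` has order five. The coefficient is therefore unchanged, whatever the signs of the other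
faces. -/
theorem support_subset_E2_pow_five {t : ℕ} {β : ℝ} (hβ : IsDilation t β) {U : Chain 5 2}
    (h : BasedAtZero U) : U.support ⊆ ((E2 (sigma t) ^ 5) U).support := by
  intro f hf
  obtain ⟨⟨x, q⟩, rfl⟩ := toFace_bijective.2 f
  obtain rfl : x = 0 := h _ hf
  have e := eq_combination h
  have key : ((E2 (sigma t) ^ 5) U) (toFace (0, q)) = U (toFace (0, q)) := by
    conv_lhs => rw [e, E2_pow_combination hβ]
    rw [Finsupp.finsetSum_apply, Finset.sum_eq_single q]
    · have hm := (zero_mem_descend hβ (spread_singleton hβ.one_lt q).admissible 5 q).2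
        (Finset.mem_singleton_self _)
      rw [rotate_iterate_five] at hm
      have hs : ∀ p, orientSign p * orientSign p = 1 := by decide
      rw [Finsupp.smul_apply, chainOf_apply, if_pos hm, smul_eq_mul, mul_right_comm, hs, one_mul]
    · intro p _ hp
      have hm := (zero_mem_descend hβ (spread_singleton hβ.one_lt p).admissible 5 q).not.2
        (by simpa using Ne.symm hp)
      rw [rotate_iterate_five] at hm
      rw [Finsupp.smul_apply, chainOf_apply, if_neg hm, smul_zero]
    · simp
  rw [Finsupp.mem_support_iff, key]
  exact Finsupp.mem_support_iff.1 hf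

/-! ## The boundary and the induced map on edges -/

/-- Edges: base point and direction. -/
abbrev Edge : Type := (Fin 5 → ℤ) × Fin 5

/-- The one-dimensional face of an edge. -/
def edgeFace (e : Edge) : Face 5 1 := (e.1, ⟨{e.2}, Finset.card_singleton _⟩)

/-- An edge as a chain. -/
noncomputable def edgeChain (e : Edge) : Chain 5 1 := Finsupp.single (edgeFace e) 1

theorem edgeFace_bijective : Function.Bijective edgeFace := by
  constructor
  · rintro ⟨x, a⟩ ⟨y, b⟩ h
    simpa [edgeFace] using h
  · rintro ⟨x, ⟨s, hs⟩⟩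
    obtain ⟨a, rfl⟩ := Finset.card_eq_one.1 hs
    exact ⟨(x, a), rfl⟩

/-- The kind of the rule leading from edges of direction `p` to edges of direction `u`. -/
def edgeRule (p u : Fin 5) : Fin 4 :=
  ![![3, 3, 3, 3, 0], ![0, 3, 3, 3, 1], ![3, 0, 3, 3, 3], ![3, 3, 0, 3, 3], ![3, 3, 3, 0, 2]] p u

/-- The sign of the rules of kind `k` for edges. -/
def edgeSign (k : Fin 4) : ℤ := ![1, -1, -1, 0] k

/-- The sum of the edges produced by a rule of kind `k`. -/
noncomputable def edgeTerm (t : ℕ) (k : Fin 4) (x : Fin 5 → ℤ) (c : Fin 5) : Chain 5 1 :=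
  ∑ i ∈ Finset.range (ruleCount t k), edgeChain (mulN t (x + shift k i), c)

/-- The image of an edge. -/
noncomputable def edgeImage (t : ℕ) (e : Edge) : Chain 5 1 :=
  ∑ u, edgeSign (edgeRule e.2 u) • edgeTerm t (edgeRule e.2 u) e.1 u

/-- The map induced on edges. -/
noncomputable def edgeMap (t : ℕ) : Chain 5 1 →ₗ[ℤ] Chain 5 1 :=
  Finsupp.lift (Chain 5 1) ℤ (Face 5 1) fun f => edgeImage t (f.1, f.2.letter 0)

theorem edgeMap_edgeChain (t : ℕ) (e : Edge) : edgeMap t (edgeChain e) = edgeImage t e := by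
  rw [edgeMap, edgeChain, Finsupp.lift_apply, Finsupp.sum_single_index (by simp), one_smul]
  congr 1
  ext1
  · rfl
  · simp [FaceType.letter, edgeFace]

/-- The basis vectors. -/
abbrev basisVec (a : Fin 5) : Fin 5 → ℤ := Pi.single a 1

theorem boundary_cellChain (x : Fin 5 → ℤ) (p : Fin 10) : boundary (cellChain (x, p)) =
    edgeChain (x, fstLetter p) + edgeChain (x + basisVec (fstLetter p), sndLetter p) -
      edgeChain (x + basisVec (sndLetter p), fstLetter p) - edgeChain (x, sndLetter p) := by
  have hne : ∀ p, fstLetter p ≠ sndLetter p := by decide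
  have hu : (Finset.univ : Finset {c // c ∈ (typeOf p).1}) =
      {⟨fstLetter p, by simp [typeOf]⟩, ⟨sndLetter p, by simp [typeOf]⟩} := by
    ext ⟨c, hc⟩
    simp only [Finset.mem_univ, Finset.mem_insert, Finset.mem_singleton, Subtype.ext_iff,
      true_iff]
    simpa [typeOf] using hc
  have h1 : ∀ p, orientSign p * (-1) ^ ((typeOf p).1.filter (· ≤ fstLetter p)).card = -1 := by
    decide
  have h2 : ∀ p, orientSign p * (-1) ^ ((typeOf p).1.filter (· ≤ sndLetter p)).card = 1 := by
    decide
  have h3 : ∀ p, (typeOf p).1.erase (fstLetter p) = {sndLetter p} := by decide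
  have h4 : ∀ p, (typeOf p).1.erase (sndLetter p) = {fstLetter p} := by decide
  rw [boundary, cellChain, Finsupp.lift_apply, Finsupp.sum_single_index (by simp)]
  simp only
  rw [hu, Finset.sum_pair (by simpa [Subtype.ext_iff] using hne p), smul_add, smul_smul, smul_smul,
    h1, h2]
  simp only [h3, h4, edgeChain, edgeFace]
  module

theorem edgeTerm_zero (t : ℕ) (x : Fin 5 → ℤ) (c : Fin 5) :
    edgeTerm t 0 x c = edgeChain (mulN t x, c) := by
  have : shift 0 0 = 0 := by ext j; fin_cases j <;> rfl
  simp [edgeTerm, ruleCount, this]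

theorem edgeTerm_three (t : ℕ) (x : Fin 5 → ℤ) (c : Fin 5) : edgeTerm t 3 x c = 0 := by
  simp [edgeTerm, ruleCount]

theorem shift_succ {k : Fin 4} (hk : k = 1 ∨ k = 2) (i : ℕ) :
    shift k (i + 1) = basisVec 0 + shift k i := by
  rcases hk with rfl | rfl <;> ext j <;> fin_cases j <;> simp [shift] <;> ring

/-- Translation by the first basis vector moves a row by one index: the row loses its first edge and
gains one just beyond its end, at distance `M e₁` from `x` because the row has length `t + 1`. -/
theorem edgeTerm_one (t : ℕ) (x : Fin 5 → ℤ) (c : Fin 5) : edgeTerm t 1 (x + basisVec 0) c =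
    edgeTerm t 1 x c - edgeChain (mulN t (x + basisVec 1), c) +
      edgeChain (mulN t (x + mulM t (basisVec 0)), c) := by
  have h1 : shift 1 0 = basisVec 1 := by ext j; fin_cases j <;> rfl
  have h2 : shift 1 (t + 1) = mulM t (basisVec 0) := by
    ext j; fin_cases j <;> simp [shift, mulM]
  have h3 := Finset.sum_range_succ (fun i => edgeChain (mulN t (x + shift 1 i), c)) (t + 1)
  rw [Finset.sum_range_succ'] at h3
  simp only [shift_succ (Or.inl rfl), ← add_assoc, h1] at h3
  simp only [edgeTerm, show ruleCount t 1 = t + 1 from rfl]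
  rw [← h2, shift_succ (Or.inl rfl), ← add_assoc, sub_add_eq_add_sub, eq_sub_iff_add_eq]
  exact h3

theorem edgeTerm_two (t : ℕ) (x : Fin 5 → ℤ) (c : Fin 5) : edgeTerm t 2 (x + basisVec 0) c =
    edgeTerm t 2 x c - edgeChain (mulN t (x + basisVec 4), c) +
      edgeChain (mulN t (x + mulM t (basisVec 3)), c) := by
  have h1 : shift 2 0 = basisVec 4 := by ext j; fin_cases j <;> rfl
  have h2 : shift 2 t = mulM t (basisVec 3) := by
    ext j; fin_cases j <;> simp [shift, mulM]
  have h3 := Finset.sum_range_succ (fun i => edgeChain (mulN t (x + shift 2 i), c)) t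
  rw [Finset.sum_range_succ'] at h3
  simp only [shift_succ (Or.inr rfl), ← add_assoc, h1] at h3
  simp only [edgeTerm, show ruleCount t 2 = t from rfl]
  rw [← h2, sub_add_eq_add_sub, eq_sub_iff_add_eq]
  exact h3

/-- After these translations the two rows agree except for one surplus edge of the longer row. That
edge is the first one on the left and the last one on the right, and the two positions coincide. -/
theorem edgeTerm_one_sub_two (t : ℕ) (x : Fin 5 → ℤ) (c : Fin 5) :
    edgeTerm t 1 (x + mulM t (basisVec 3)) c - edgeTerm t 2 (x + mulM t (basisVec 0)) c =
      edgeTerm t 1 (x + basisVec 4) c - edgeTerm t 2 (x + basisVec 1) c := by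
  have e1 : ∀ i, x + mulM t (basisVec 3) + shift 1 (i + 1) =
      x + mulM t (basisVec 0) + shift 2 i := by
    intro i; ext j; fin_cases j <;> simp [shift, mulM]; ring
  have e2 : ∀ i, x + basisVec 4 + shift 1 i = x + basisVec 1 + shift 2 i := by
    intro i; ext j; fin_cases j <;> simp [shift]
  have e3 : x + mulM t (basisVec 3) + shift 1 0 = x + basisVec 1 + shift 2 t := by
    rw [add_assoc, add_assoc]
    congr 1
    ext j; fin_cases j <;> simp [shift, mulM]
  simp only [edgeTerm, show ruleCount t 1 = t + 1 from rfl, show ruleCount t 2 = t from rfl]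
  rw [Finset.sum_range_succ', Finset.sum_range_succ]
  simp only [e1, e2, e3]
  abel

theorem boundary_sum_cellChain (t : ℕ) (k : Fin 4) (x : Fin 5 → ℤ) (u : Fin 10) :
    boundary (∑ i ∈ Finset.range (ruleCount t k), cellChain (mulN t (x + shift k i), u)) =
      edgeTerm t k x (fstLetter u) +
        edgeTerm t k (x + mulM t (basisVec (fstLetter u))) (sndLetter u) -
        edgeTerm t k (x + mulM t (basisVec (sndLetter u))) (fstLetter u) -
        edgeTerm t k x (sndLetter u) := by
  rw [map_sum]
  simp only [edgeTerm, ← Finset.sum_add_distrib, ← Finset.sum_sub_distrib]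
  refine Finset.sum_congr rfl fun i _ => ?_
  rw [boundary_cellChain]
  have h : ∀ a, mulN t (x + mulM t (basisVec a) + shift k i) =
      mulN t (x + shift k i) + basisVec a := by
    intro a
    rw [add_right_comm, mulN_add, mulN_mulM]
  rw [h, h]

theorem mulM_basisVec (t : ℕ) : mulM t (basisVec 1) = basisVec 2 ∧
    mulM t (basisVec 2) = basisVec 3 ∧ mulM t (basisVec 4) = basisVec 0 := by
  refine ⟨?_, ?_, ?_⟩ <;> ext j <;> fin_cases j <;> simp [mulM]

theorem faceRule_table (p : Fin 10) : faceRule p =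
    ![![3, 3, 3, 0, 3, 3, 3, 3, 3, 3], ![3, 3, 3, 3, 3, 3, 0, 3, 3, 3],
      ![3, 3, 3, 3, 3, 3, 3, 0, 3, 3], ![3, 3, 3, 3, 3, 3, 3, 3, 3, 0],
      ![0, 3, 3, 3, 3, 3, 1, 3, 3, 3], ![3, 0, 3, 3, 3, 3, 3, 1, 3, 3],
      ![3, 3, 0, 2, 3, 3, 3, 3, 3, 1], ![3, 3, 3, 3, 3, 0, 2, 3, 3, 3],
      ![3, 3, 3, 3, 0, 3, 3, 3, 3, 3], ![3, 3, 3, 3, 3, 3, 3, 2, 0, 3]] p := by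
  revert p; decide +kernel

theorem sum_fin_ten {A : Type*} [AddCommMonoid A] (f : Fin 10 → A) :
    ∑ u, f u = f 0 + f 1 + f 2 + f 3 + f 4 + f 5 + f 6 + f 7 + f 8 + f 9 := by
  rw [Fin.sum_univ_castSucc, Fin.sum_univ_castSucc, Fin.sum_univ_eight]
  rfl

/-- Over an abstract group the telescoping relations become rewriting rules, and the compatibility
of boundary and `E` is left as a linear identity for each of the ten types. -/
theorem boundary_identity {A : Type*} [AddCommGroup A] (t : ℕ)
    (T : Fin 4 → (Fin 5 → ℤ) → Fin 5 → A) (E : (Fin 5 → ℤ) → Fin 5 → A)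
    (h0 : ∀ x c, T 0 x c = E x c) (h3 : ∀ x c, T 3 x c = 0)
    (h1 : ∀ x c, T 1 (x + basisVec 0) c =
      T 1 x c - E (x + basisVec 1) c + E (x + mulM t (basisVec 0)) c)
    (h2 : ∀ x c, T 2 (x + basisVec 0) c =
      T 2 x c - E (x + basisVec 4) c + E (x + mulM t (basisVec 3)) c)
    (h12 : ∀ x c, T 1 (x + mulM t (basisVec 3)) c - T 2 (x + mulM t (basisVec 0)) c =
      T 1 (x + basisVec 4) c - T 2 (x + basisVec 1) c)
    (I : (Fin 5 → ℤ) → Fin 5 → A)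
    (hI : ∀ y, I y 0 = E y 4 ∧ I y 1 = E y 0 - T 1 y 4 ∧ I y 2 = E y 1 ∧ I y 3 = E y 2 ∧
      I y 4 = E y 3 - T 2 y 4) (x : Fin 5 → ℤ) (p : Fin 10) :
    ∑ u : Fin 10, (T (faceRule p u) x (fstLetter u) +
        T (faceRule p u) (x + mulM t (basisVec (fstLetter u))) (sndLetter u) -
        T (faceRule p u) (x + mulM t (basisVec (sndLetter u))) (fstLetter u) -
        T (faceRule p u) x (sndLetter u)) =
      I x (fstLetter p) + I (x + basisVec (fstLetter p)) (sndLetter p) -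
        I (x + basisVec (sndLetter p)) (fstLetter p) - I x (sndLetter p) := by
  obtain ⟨m1, m2, m4⟩ := mulM_basisVec t
  -- This relation settles the type that has rules of both kinds `1` and `2`.
  have hs := h12 x 4
  rw [sub_eq_iff_eq_add] at hs
  simp only [faceRule_table, sum_fin_ten]
  fin_cases p <;>
    simp only [fstLetter, sndLetter, Fin.zero_eta, Fin.mk_one, Fin.reduceFinMk, Matrix.cons_val,
      h0, h3, hI, m1, m2, m4, h1, h2, add_zero, sub_zero, zero_add]
  all_goals first | abel1 | (rw [hs]; abel1)

theorem boundary_E2_cellChain (t : ℕ) (F : Cell) :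
    boundary (E2 (sigma t) (cellChain F)) = edgeMap t (boundary (cellChain F)) := by
  obtain ⟨x, p⟩ := F
  rw [E2_cellChain, map_sum, Finset.sum_congr rfl fun u _ => boundary_sum_cellChain t _ x u,
    boundary_cellChain, map_sub, map_sub, map_add]
  simp only [edgeMap_edgeChain]
  refine boundary_identity t (edgeTerm t) (fun x c => edgeChain (mulN t x, c)) (edgeTerm_zero t)
    (edgeTerm_three t) (edgeTerm_one t) (edgeTerm_two t) (edgeTerm_one_sub_two t)
    (fun y c => edgeImage t (y, c)) (fun y => ?_) x p
  refine ⟨?_, ?_, ?_, ?_, ?_⟩ <;>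
    simp [edgeImage, Fin.sum_univ_succ, edgeRule, edgeSign, edgeTerm_zero, edgeTerm_three] <;>
    abel

/-! ### Boundary coefficients: recursion, ancestors and nearness. -/

/-- The bounds for the positions of the edges in the boundaries. -/
def edgeBound : Fin 5 → ℤ × ℤ × ℤ := ![(1, 1, 2), (1, 1, 1), (1, 1, 1), (1, 2, 1), (2, 1, 1)]

theorem edgeMap_apply (t : ℕ) (P : Chain 5 1) (z : Fin 5 → ℤ) (u : Fin 5) :
    edgeMap t P (edgeFace (z, u)) = ∑ p, edgeSign (edgeRule p u) *
      ∑ i ∈ Finset.range (ruleCount t (edgeRule p u)),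
        P (edgeFace (mulM t z - shift (edgeRule p u) i, p)) := by
  induction P using Finsupp.induction_linear with
  | zero => simp
  | add P Q hP hQ =>
    rw [map_add, Finsupp.add_apply, hP, hQ, ← Finset.sum_add_distrib]
    refine Finset.sum_congr rfl fun p _ => ?_
    simp only [Finsupp.add_apply, Finset.sum_add_distrib, mul_add]
  | single f c =>
    obtain ⟨⟨y, q⟩, rfl⟩ := edgeFace_bijective.2 f
    have h1 : Finsupp.single (edgeFace (y, q)) c = c • edgeChain (y, q) := by
      rw [edgeChain, Finsupp.smul_single, smul_eq_mul, mul_one]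
    have happ : ∀ e e' : Edge, edgeChain e (edgeFace e') = if e = e' then 1 else 0 := by
      intro e e'
      rw [edgeChain, Finsupp.single_apply]
      simp only [edgeFace_bijective.1.eq_iff]
    rw [h1, map_smul, edgeMap_edgeChain, edgeImage]
    simp only [Finsupp.smul_apply, edgeTerm, Finsupp.finsetSum_apply, happ, Prod.mk.injEq,
      smul_eq_mul]
    rw [Finset.sum_eq_single u (fun u' _ hu => by simp [hu]) (by simp),
      Finset.sum_eq_single q (fun p _ hp => by simp [Ne.symm hp]) (by simp), mul_left_comm,
      Finset.mul_sum]
    congr 1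
    refine Finset.sum_congr rfl fun i _ => ?_
    have hiff : mulN t (y + shift (edgeRule q u) i) = z ↔
        y = mulM t z - shift (edgeRule q u) i := by
      rw [eq_comm, ← mulM_eq_iff, eq_sub_iff_add_eq, eq_comm]
    simp only [and_true, hiff]

/-- Coefficients of a sequence of chains of edges with each the image of the preceding one. -/
def EdgeRecursion (t : ℕ) (c : ℕ → Edge → ℤ) : Prop :=
  ∀ n z u, c (n + 1) (z, u) = ∑ p, edgeSign (edgeRule p u) *
    ∑ i ∈ Finset.range (ruleCount t (edgeRule p u)),
      c n (mulM t z - shift (edgeRule p u) i, p)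

theorem Spread.edgeRecursion {t : ℕ} {β : ℝ} (hβ : IsDilation t β) {A : Finset Cell}
    (h : Spread β A) :
    EdgeRecursion t fun n e => boundary (chainOf (_root_.descend t n A)) (edgeFace e) := by
  intro n z u
  have h1 : boundary (chainOf (_root_.descend t (n + 1) A)) =
      edgeMap t (boundary (chainOf (_root_.descend t n A))) := by
    rw [← h.E2_pow hβ (n + 1), pow_succ', Module.End.mul_apply, h.E2_pow hβ n, chainOf]
    simp only [map_sum, boundary_E2_cellChain]
  simp only [h1, edgeMap_apply]

theorem EdgeRecursion.exists_parent {t : ℕ} {c : ℕ → Edge → ℤ} (h : EdgeRecursion t c) {n : ℕ}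
    {e : Edge} (he : c (n + 1) e ≠ 0) : ∃ f : Edge, c n f ≠ 0 ∧
      ∃ i < ruleCount t (edgeRule f.2 e.2), mulM t e.1 = f.1 + shift (edgeRule f.2 e.2) i := by
  obtain ⟨z, u⟩ := e
  rw [h] at he
  obtain ⟨p, _, hp⟩ := Finset.exists_ne_zero_of_sum_ne_zero he
  obtain ⟨i, hi, hi'⟩ := Finset.exists_ne_zero_of_sum_ne_zero (right_ne_zero_of_mul hp)
  exact ⟨_, hi', i, Finset.mem_range.1 hi, (sub_add_cancel _ _).symm⟩

theorem edgeBound_check : boundCheck edgeRule edgeBound := by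
  decide +kernel

theorem EdgeRecursion.admissible {t : ℕ} {β : ℝ} (hβ : IsDilation t β) {c : ℕ → Edge → ℤ}
    (h : EdgeRecursion t c) (h0 : ∀ e, c 0 e ≠ 0 → Admissible β edgeBound e.2 e.1) :
    ∀ n e, c n e ≠ 0 → Admissible β edgeBound e.2 e.1 := by
  intro n
  induction n with
  | zero => exact h0
  | succ n ih =>
    intro e he
    obtain ⟨f, hf, i, hi, hm⟩ := h.exists_parent he
    exact (ih f hf).child edgeBound_check hβ hi hm

/-- The differences of positions for pairs of directions of edges that descend to touching ones. -/
def edgeNearList : List (Fin 5 × Fin 5 × ℤ × ℤ × ℤ) := [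
    (0, 0, -1, -1, -1), (0, 0, -1, -1, 0), (0, 0, 0, 0, 0), (0, 1, -1, -1, -1), (0, 1, 0, 0, -1),
    (0, 1, 0, 0, 0), (0, 1, 1, 1, -1), (0, 1, 1, 1, 0), (0, 2, 0, -1, -1), (0, 2, 0, -1, 0),
    (0, 2, 0, 0, 0), (0, 2, 1, 0, 0), (0, 2, 1, 1, 0), (0, 3, -1, -1, -1), (0, 3, -1, 0, 0),
    (0, 3, 0, 0, 0), (0, 3, 0, 1, 0), (0, 3, 1, 1, 0), (0, 4, 0, -1, -1), (0, 4, 0, 0, 0),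
    (0, 4, 1, 0, -1), (0, 4, 1, 1, 0), (0, 4, 2, 1, 0), (1, 1, -1, -1, 0), (1, 1, 0, 0, -1),
    (1, 1, 0, 0, 0), (1, 2, 0, -1, 0), (1, 2, 0, -1, 1), (1, 2, 0, 0, 0), (1, 2, 0, 0, 1),
    (1, 2, 1, 0, 1), (1, 3, -1, -1, 0), (1, 3, -1, 0, 0), (1, 3, -1, 0, 1), (1, 3, 0, 0, 0),
    (1, 3, 0, 0, 1), (1, 3, 0, 1, 1), (1, 3, 1, 1, 1), (1, 4, 0, -1, -1), (1, 4, 0, -1, 0),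
    (1, 4, 0, 0, 0), (1, 4, 0, 0, 1), (1, 4, 1, 0, 0), (1, 4, 1, 1, 1), (1, 4, 2, 1, 0),
    (2, 2, 0, -1, 0), (2, 2, 0, 0, 0), (2, 3, -1, 0, 0), (2, 3, -1, 1, 0), (2, 3, 0, 0, 0),
    (2, 3, 0, 1, 0), (2, 3, 0, 2, 1), (2, 4, 0, -1, -1), (2, 4, 0, 0, -1), (2, 4, 0, 0, 0),
    (2, 4, 0, 1, 0), (2, 4, 1, 1, 0), (2, 4, 1, 2, 1), (3, 3, -1, 0, 0), (3, 3, 0, 0, 0),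
    (3, 4, 0, -2, -1), (3, 4, 0, -1, -1), (3, 4, 0, 0, 0), (3, 4, 1, -1, -1), (3, 4, 1, 0, 0),
    (3, 4, 2, 1, 0), (4, 4, -1, -2, -1), (4, 4, -1, -1, 0), (4, 4, 0, -1, -1), (4, 4, 0, 0, 0)]

/-- Pairs of edges that may have touching descendants. -/
def edgeNear (u u' : Fin 5) (d : ℤ × ℤ × ℤ) : Bool :=
  (u, u', d) ∈ edgeNearList || (u', u, -d) ∈ edgeNearList

/-- The list is closed under passing to parents, up to excluded differences, and contains the
non-excluded differences of touching edges (`edge_touching`). Touching is thus traced back to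
earlier generations. -/
theorem edgeNear_pull : ∀ q ∈ edgeNearList,
    pullCheck edgeRule edgeBound edgeNear q.1 q.2.1 q.2.2 ∧
      pullCheck edgeRule edgeBound edgeNear q.2.1 q.1 (-q.2.2) := by
  decide +kernel

/-- A nonzero coefficient has some parent with nonzero coefficient. The parents of the two edges can
be chosen independently, since nearness holds for every admissible choice. -/
theorem EdgeRecursion.pull_edgeNear {t : ℕ} {β : ℝ} (hβ : IsDilation t β) {c : ℕ → Edge → ℤ}
    (h : EdgeRecursion t c) (ha : ∀ n e, c n e ≠ 0 → Admissible β edgeBound e.2 e.1) (k n : ℕ)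
    {e e' : Edge} (he : c n e ≠ 0) (he' : c (n + k) e' ≠ 0)
    (hn : edgeNear e.2 e'.2 (quot e'.1 - quot e.1)) :
    ∃ f f' : Edge, c 0 f ≠ 0 ∧ c k f' ≠ 0 ∧ edgeNear f.2 f'.2 (quot f'.1 - quot f.1) := by
  induction n generalizing e e' with
  | zero => exact ⟨e, e', he, by simpa using he', hn⟩
  | succ n ih =>
    rw [add_right_comm] at he'
    obtain ⟨f, hf, i, hi, hm⟩ := h.exists_parent he
    obtain ⟨f', hf', i', hi', hm'⟩ := h.exists_parent he'
    refine ih hf hf' ?_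
    have hc : pullCheck edgeRule edgeBound edgeNear e.2 e'.2 (quot e'.1 - quot e.1) := by
      rw [edgeNear, Bool.or_eq_true, decide_eq_true_eq, decide_eq_true_eq] at hn
      rcases hn with hn | hn
      · exact (edgeNear_pull _ hn).1
      · have := (edgeNear_pull _ hn).2
        rwa [neg_neg] at this
    exact hc.sound hβ.one_lt hi hi' hm hm' (ha _ _ hf) (ha _ _ hf')

/-! ## The window around the initial boundary -/

/-- Classes of the edges that are near to the boundaries of the touching triples. -/
def windowList : List (Fin 5 × ℤ × ℤ × ℤ) := [
    (0, -1, 0, 2), (0, -1, 1, 1), (0, 0, 0, 0), (0, 0, 0, 1), (0, 0, 1, 0), (0, 0, 1, 1),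
    (0, 0, 1, 2), (0, 0, 2, 1), (0, 0, 2, 2), (0, 1, 0, 0), (0, 1, 0, 1), (0, 1, 1, 0),
    (0, 1, 1, 1), (0, 1, 2, 0), (0, 2, 1, 0), (1, 0, 0, 0), (1, 0, 0, 1), (1, 0, 1, -1),
    (1, 0, 1, 0), (1, 0, 1, 1), (1, 0, 1, 2), (1, 0, 2, 0), (1, 0, 2, 1), (1, 1, 0, -1),
    (1, 1, 0, 0), (1, 1, 0, 1), (1, 1, 1, -1), (1, 1, 1, 0), (1, 1, 2, -1), (1, 2, 1, -1),
    (2, 0, 0, 0), (2, 0, 0, 1), (2, 0, 0, 2), (2, 0, 1, 0), (2, 0, 1, 1), (2, 0, 1, 2),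
    (2, 0, 2, 1), (2, 1, -1, -1), (2, 1, -1, 0), (2, 1, -1, 1), (2, 1, 0, 0), (2, 1, 0, 1),
    (2, 1, 1, 0), (2, 2, 0, 0), (3, -1, 1, 1), (3, -1, 1, 2), (3, -1, 2, 1), (3, 0, 0, 0),
    (3, 0, 0, 1), (3, 0, 1, 0), (3, 0, 1, 1), (3, 0, 1, 2), (3, 0, 2, 0), (3, 0, 2, 1),
    (3, 0, 2, 2), (3, 0, 3, 1), (3, 0, 3, 2), (3, 1, 0, 0), (3, 1, 0, 1), (3, 1, 1, 0),
    (3, 1, 1, 1), (3, 1, 2, 0), (3, 2, 1, 0), (4, 0, 0, 0), (4, 0, 0, 1), (4, 0, 1, 0),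
    (4, 0, 1, 1), (4, 0, 1, 2), (4, 0, 2, 1), (4, 1, -1, -1), (4, 1, -1, 0), (4, 1, 0, -1),
    (4, 1, 0, 0), (4, 1, 0, 1), (4, 1, 1, -1), (4, 1, 1, 0), (4, 1, 1, 1), (4, 1, 2, 0),
    (4, 1, 2, 1), (4, 1, 2, 2), (4, 1, 3, 1), (4, 1, 3, 2), (4, 2, 0, -1), (4, 2, 0, 0),
    (4, 2, 1, 0)]

/-- The edges of direction `u` and class `d` belong to the window. -/
def inWindow (u : Fin 5) (d : ℤ × ℤ × ℤ) : Bool := (u, d) ∈ windowList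

/-- A class that is not admissible for the direction `u`. -/
def inadmissible (u : Fin 5) (d : ℤ × ℤ × ℤ) : Bool :=
  isUp (d - edgeBound u) || (isUp (-d) && decide (d ≠ 0))

theorem Admissible.not_inadmissible {β : ℝ} (hβ : 1 < β) {u : Fin 5} {x : Fin 5 → ℤ}
    (h : Admissible β edgeBound u x) : inadmissible u (quot x) = false := by
  rw [← Bool.not_eq_true, inadmissible, Bool.or_eq_true, Bool.and_eq_true, decide_eq_true_eq]
  rintro (hc | ⟨hc, hc'⟩)
  · have := ell_nonneg hβ hc
    rw [ell_sub] at this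
    linarith [h.2]
  · have := ell_pos hβ hc (neg_ne_zero.2 hc')
    rw [ell_neg] at this
    linarith [h.1]

/-- The class of the parent of an edge of class `d`. -/
def parentClass (d : ℤ × ℤ × ℤ) (k : Fin 4) (r : ℤ) : ℤ × ℤ × ℤ :=
  (d.2.1 + r, d.1 + d.2.2 + r - kindMid k, d.1 - kindLast k)

/-- The restrictions on the parameter `r` in `parentClass` that hold for all values of `t`. -/
def parentRange (d : ℤ × ℤ × ℤ) (k : Fin 4) (r : ℤ) : Bool :=
  (d.1 - kindLast k < 0 || kindMid k ≤ r) && (0 < d.1 || r ≤ 0)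

/-- The window is closed under admissible parents. As in `pullCheck`, the values `±3` stand for all
larger `|r|`, by monotonicity in `r`. -/
theorem windowList_parents : ∀ q ∈ windowList, ∀ p, edgeRule p q.1 ≠ 3 →
    (∀ r ∈ [(-2 : ℤ), -1, 0, 1, 2], parentRange q.2 (edgeRule p q.1) r →
      inadmissible p (parentClass q.2 (edgeRule p q.1) r) ||
        inWindow p (parentClass q.2 (edgeRule p q.1) r)) ∧
    (parentRange q.2 (edgeRule p q.1) 3 →
      isUp (parentClass q.2 (edgeRule p q.1) 3 - edgeBound p)) ∧
    (parentRange q.2 (edgeRule p q.1) (-3) →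
      isUp (-parentClass q.2 (edgeRule p q.1) (-3)) ∧
        parentClass q.2 (edgeRule p q.1) (-3) ≠ 0) := by
  decide +kernel

/-- Consequently the coefficients in the window at one level are determined by those in the window
one level earlier, through five values of `r`. -/
theorem window_parent {t : ℕ} {β : ℝ} (hβ : 1 < β) {z x : Fin 5 → ℤ} {p u : Fin 5} {i : ℕ}
    (hw : inWindow u (quot z)) (hi : i < ruleCount t (edgeRule p u))
    (h : mulM t z = x + shift (edgeRule p u) i) (ha : Admissible β edgeBound p x) :
    inWindow p (quot x) ∧ -2 ≤ t * (quot z).1 - i ∧ t * (quot z).1 - i ≤ 2 := by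
  obtain ⟨hi0, hi1, hx⟩ := quot_parent hi h
  have hex := ha.not_inadmissible hβ
  rw [inWindow, decide_eq_true_eq] at hw
  obtain ⟨h1, h2, h3⟩ := windowList_parents _ hw p (ruleCount_pos hi)
  simp only at h1 h2 h3
  set k := edgeRule p u
  obtain ⟨r, hr⟩ : ∃ r : ℤ, r = t * (quot z).1 - i := ⟨_, rfl⟩
  have hrange : parentRange (quot z) k r := by
    rw [parentRange, Bool.and_eq_true, Bool.or_eq_true, Bool.or_eq_true, decide_eq_true_eq,
      decide_eq_true_eq, decide_eq_true_eq, decide_eq_true_eq]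
    constructor
    · rw [or_iff_not_imp_left, not_lt]
      intro hd
      have : (t : ℤ) * kindLast k ≤ t * (quot z).1 := by gcongr; linarith
      linarith
    · rw [or_iff_not_imp_left, not_lt]
      intro hd
      have : (t : ℤ) * (quot z).1 ≤ t * 0 := by gcongr
      linarith
  have hx' : quot x = parentClass (quot z) k r := by
    rw [hx, parentClass, hr]
    simp only [Prod.mk.injEq]
    refine ⟨by ring, by ring, trivial⟩
  rw [← hr]
  rw [hx'] at hex ⊢
  have hr' := hrange
  rw [parentRange, Bool.and_eq_true, Bool.or_eq_true, Bool.or_eq_true, decide_eq_true_eq,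
    decide_eq_true_eq, decide_eq_true_eq, decide_eq_true_eq] at hr'
  have hk : 0 ≤ kindMid k ∧ kindMid k ≤ 1 := by generalize k = k; revert k; decide
  by_cases hr2 : -2 ≤ r ∧ r ≤ 2
  · have := h1 r (by simp; omega) hrange
    rw [hex, Bool.false_or] at this
    exact ⟨this, hr2⟩
  exfalso
  rw [inadmissible, Bool.or_eq_false_iff, ← Bool.not_eq_true, ← Bool.not_eq_true] at hex
  rcases le_or_gt 3 r with hr3 | hr3
  · have h2' := h2 (by
      rw [parentRange, Bool.and_eq_true, Bool.or_eq_true, Bool.or_eq_true, decide_eq_true_eq,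
        decide_eq_true_eq, decide_eq_true_eq, decide_eq_true_eq]
      omega)
    refine hex.1 ?_
    rw [isUp_iff] at h2' ⊢
    simp only [parentClass, Prod.fst_sub, Prod.snd_sub] at h2' ⊢
    omega
  · obtain ⟨h3', h3''⟩ := h3 (by
      rw [parentRange, Bool.and_eq_true, Bool.or_eq_true, Bool.or_eq_true, decide_eq_true_eq,
        decide_eq_true_eq, decide_eq_true_eq, decide_eq_true_eq]
      omega)
    refine hex.2 ?_
    rw [Bool.and_eq_true, decide_eq_true_eq]
    rw [isUp_iff] at h3' ⊢
    simp only [parentClass, Prod.fst_neg, Prod.snd_neg, ne_eq, Prod.mk_eq_zero] at h3' h3'' ⊢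
    omega

/-! ## Evolution of the coefficients in the window -/

/-- An edge with explicit coordinates. -/
abbrev EdgeCode : Type := Fin 5 × ℤ × ℤ × ℤ × ℤ × ℤ

/-- The vector with the given coordinates. -/
def codeVec (y : ℤ × ℤ × ℤ × ℤ × ℤ) : Fin 5 → ℤ := ![y.1, y.2.1, y.2.2.1, y.2.2.2.1, y.2.2.2.2]

/-- The edge with the given coordinates. -/
def codeEdge (q : EdgeCode) : Edge := (codeVec q.2, q.1)

/-- The class of the vector with the given coordinates. -/
def codeQuot (y : ℤ × ℤ × ℤ × ℤ × ℤ) : ℤ × ℤ × ℤ :=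
  (y.1 + y.2.2.2.1, y.1 + y.2.2.1 + y.2.2.2.2, y.2.1 + y.2.2.2.2)

/-- The coefficient of an edge in a list of edges with coefficients. -/
def coeffOf (L : List (EdgeCode × ℤ)) (e : Edge) : ℤ :=
  (L.map fun q => if codeEdge q.1 = e then q.2 else 0).sum

/-- Adding a multiple of an edge. -/
def addEntry (k : EdgeCode) (c : ℤ) : List (EdgeCode × ℤ) → List (EdgeCode × ℤ)
  | [] => [(k, c)]
  | q :: L => if q.1 = k then (if q.2 + c = 0 then L else (k, q.2 + c) :: L)
      else q :: addEntry k c L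

/-- Collecting the multiples of equal edges. -/
def collect (L : List (EdgeCode × ℤ)) : List (EdgeCode × ℤ) :=
  L.foldr (fun q acc => addEntry q.1 q.2 acc) []

/-- The child of an edge for the rule of kind `k` with parameter `r`. -/
def childCode (k : Fin 4) (r : ℤ) (x : ℤ × ℤ × ℤ × ℤ × ℤ) : ℤ × ℤ × ℤ × ℤ × ℤ :=
  (x.2.1 + (kindLast k - kindMid k), x.2.2.1, x.2.2.2.1, x.2.2.2.2 + kindMid k,
    x.1 - (x.2.1 + (kindLast k - kindMid k)) - r)

/-- The parameter `r` is possible for a child of class with first coordinate `d`. -/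
def okParam (t : ℕ) (k : Fin 4) (d r : ℤ) : Bool :=
  0 ≤ t * d - r && t * d - r < ruleCount t k

/-- The relevant values of the parameter. -/
def params : List ℤ := [-2, -1, 0, 1, 2]

/-- The children in the window of a multiple of an edge. -/
def stepEntry (t : ℕ) (q : EdgeCode × ℤ) : List (EdgeCode × ℤ) :=
  (List.finRange 5).flatMap fun u => params.flatMap fun r =>
    if okParam t (edgeRule q.1.1 u)
        (codeQuot (childCode (edgeRule q.1.1 u) r q.1.2)).1 r &&
        inWindow u (codeQuot (childCode (edgeRule q.1.1 u) r q.1.2)) then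
      [((u, childCode (edgeRule q.1.1 u) r q.1.2), edgeSign (edgeRule q.1.1 u) * q.2)]
    else []

/-- One step of the evolution. -/
def stepList (t : ℕ) (L : List (EdgeCode × ℤ)) : List (EdgeCode × ℤ) :=
  collect (L.flatMap (stepEntry t))

theorem codeQuot_eq (y : ℤ × ℤ × ℤ × ℤ × ℤ) : codeQuot y = quot (codeVec y) := rfl

theorem coeffOf_nil (e : Edge) : coeffOf [] e = 0 := rfl

theorem coeffOf_cons (q : EdgeCode × ℤ) (L : List (EdgeCode × ℤ)) (e : Edge) :
    coeffOf (q :: L) e = (if codeEdge q.1 = e then q.2 else 0) + coeffOf L e := by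
  simp [coeffOf]

theorem coeffOf_append (L L' : List (EdgeCode × ℤ)) (e : Edge) :
    coeffOf (L ++ L') e = coeffOf L e + coeffOf L' e := by
  simp [coeffOf]

theorem coeffOf_flatMap {α : Type*} (l : List α) (f : α → List (EdgeCode × ℤ)) (e : Edge) :
    coeffOf (l.flatMap f) e = (l.map fun a => coeffOf (f a) e).sum := by
  induction l with
  | nil => rfl
  | cons a l ih => rw [List.flatMap_cons, coeffOf_append, ih, List.map_cons, List.sum_cons]

theorem coeffOf_addEntry (k : EdgeCode) (c : ℤ) (L : List (EdgeCode × ℤ)) (e : Edge) :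
    coeffOf (addEntry k c L) e = (if codeEdge k = e then c else 0) + coeffOf L e := by
  induction L with
  | nil => rw [addEntry, coeffOf_cons]
  | cons q L ih =>
    rw [addEntry]
    by_cases h1 : q.1 = k
    · rw [if_pos h1]
      by_cases h2 : q.2 + c = 0
      · rw [if_pos h2, coeffOf_cons, h1]
        split_ifs <;> linarith
      · rw [if_neg h2, coeffOf_cons, coeffOf_cons, h1]
        split_ifs <;> ring
    · rw [if_neg h1, coeffOf_cons, coeffOf_cons, ih]
      ring

theorem coeffOf_ite (p : Prop) [Decidable p] (q : EdgeCode × ℤ) (e : Edge) :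
    coeffOf (if p then [q] else []) e = if p ∧ codeEdge q.1 = e then q.2 else 0 := by
  by_cases h : p <;> simp [h, coeffOf]

theorem coeffOf_collect (L : List (EdgeCode × ℤ)) (e : Edge) :
    coeffOf (collect L) e = coeffOf L e := by
  induction L with
  | nil => rfl
  | cons q L ih =>
    change coeffOf (addEntry q.1 q.2 (collect L)) e = _
    rw [coeffOf_addEntry, ih, coeffOf_cons]

/-- The position of the parent of `z` for the rule of kind `k` with parameter `r`. -/
def parentVec (k : Fin 4) (r : ℤ) (z : Fin 5 → ℤ) : Fin 5 → ℤ :=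
  ![z 0 + z 4 + r, z 0 - (kindLast k - kindMid k), z 1, z 2, z 3 - kindMid k]

theorem codeVec_childCode (k : Fin 4) (r : ℤ) (x : ℤ × ℤ × ℤ × ℤ × ℤ) (z : Fin 5 → ℤ) :
    codeVec (childCode k r x) = z ↔ codeVec x = parentVec k r z := by
  obtain ⟨x0, x1, x2, x3, x4⟩ := x
  simp only [codeVec, childCode, parentVec, funext_iff, Fin.forall_fin_succ, IsEmpty.forall_iff]
  simp
  omega

/-- The parameter `t` occurs in `M z` only as `t (z₁ + z₄)`, that is `t` times the first coordinate
of the class. Absorbing it into `r` leaves a parent formula free of `t`. -/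
theorem mulM_sub_shift {t : ℕ} {k : Fin 4} {i : ℕ} (hi : i < ruleCount t k) (z : Fin 5 → ℤ) :
    mulM t z - shift k i = parentVec k (t * (quot z).1 - i) z := by
  fin_cases k
  · obtain rfl : i = 0 := by simpa [ruleCount] using hi
    ext j; fin_cases j <;> simp [mulM, shift, parentVec, quot, kindLast, kindMid]; ring
  · ext j; fin_cases j <;> simp [mulM, shift, parentVec, quot, kindLast, kindMid]; ring
  · ext j; fin_cases j <;> simp [mulM, shift, parentVec, quot, kindLast, kindMid]; ring
  · simp [ruleCount] at hi

/-- For `|r| ≤ 2` and `t ≥ 4` the test fails when `d < 0` or `d ≥ 2`, and for `d = 0` or `d = 1` its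
outcome depends only on `r` and the kind. So all large `t` behave like `t = 4`. -/
theorem okParam_min (t : ℕ) (k : Fin 4) (d r : ℤ) (hr : r ∈ params) :
    okParam (min t 4) k d r = okParam t k d r := by
  rcases le_or_gt t 4 with ht | ht
  · rw [min_eq_left ht]
  rw [min_eq_right ht.le]
  have hr' : -2 ≤ r ∧ r ≤ 2 := by simp [params] at hr; omega
  have ht' : (5 : ℤ) ≤ t := by exact_mod_cast ht
  rw [Bool.eq_iff_iff, okParam, okParam]
  simp only [Bool.and_eq_true, decide_eq_true_eq]
  rcases lt_trichotomy d 0 with hd | rfl | hd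
  · have h1 : (t : ℤ) * d ≤ -t := by nlinarith
    push_cast
    constructor <;> rintro ⟨h2, h3⟩ <;> exfalso <;> linarith [hr'.1]
  · fin_cases k <;> simp [ruleCount] <;> omega
  · rcases eq_or_lt_of_le (show 1 ≤ d by omega) with rfl | hd'
    · fin_cases k <;> simp [ruleCount] <;> omega
    · have h1 : (t : ℤ) * 2 ≤ t * d := by gcongr; omega
      have hc : ∀ t' : ℕ, (ruleCount t' k : ℤ) ≤ t' + 1 := by
        intro t'
        fin_cases k <;> (simp [ruleCount]; try omega)
      have h4 := hc 4
      have h5 := hc t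
      push_cast at h4 h5 ⊢
      constructor <;> rintro ⟨h2, h3⟩ <;> exfalso <;> linarith [hr'.2]

theorem coeffOf_stepEntry (t : ℕ) (q : EdgeCode × ℤ) (z : Fin 5 → ℤ) (u : Fin 5)
    (hw : inWindow u (quot z)) : coeffOf (stepEntry t q) (z, u) =
    edgeSign (edgeRule q.1.1 u) * (params.map fun r =>
      if okParam t (edgeRule q.1.1 u) (quot z).1 r then
        (if codeVec q.1.2 = parentVec (edgeRule q.1.1 u) r z then q.2 else 0) else 0).sum := by
  rw [stepEntry, coeffOf_flatMap, ← List.ofFn_id, List.map_ofFn, List.sum_ofFn,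
    Finset.sum_eq_single u]
  · rw [Function.comp_apply, id, coeffOf_flatMap, ← List.sum_map_mul_left]
    congr 1
    refine List.map_congr_left fun r _ => ?_
    rw [coeffOf_ite]
    simp only [codeQuot_eq, ← codeVec_childCode, codeEdge, Prod.mk.injEq, and_true]
    by_cases hz : codeVec (childCode (edgeRule q.1.1 u) r q.1.2) = z
    · simp only [hz, hw, Bool.and_true, and_true, if_true, mul_ite, mul_zero]
    · simp only [hz, and_false, if_false, ite_self, mul_zero]
  · intro u' _ hu
    rw [Function.comp_apply, id, coeffOf_flatMap]
    refine List.sum_eq_zero fun a ha => ?_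
    obtain ⟨r, _, rfl⟩ := List.mem_map.1 ha
    simp [coeffOf_ite, codeEdge, hu]
  · simp

theorem coeffOf_stepEntry_of_not_inWindow (t : ℕ) (q : EdgeCode × ℤ) (z : Fin 5 → ℤ) (u : Fin 5)
    (hw : inWindow u (quot z) = false) : coeffOf (stepEntry t q) (z, u) = 0 := by
  rw [stepEntry, coeffOf_flatMap]
  refine List.sum_eq_zero fun a ha => ?_
  obtain ⟨u', _, rfl⟩ := List.mem_map.1 ha
  rw [coeffOf_flatMap]
  refine List.sum_eq_zero fun a ha => ?_
  obtain ⟨r, _, rfl⟩ := List.mem_map.1 ha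
  rw [coeffOf_ite, if_neg]
  rintro ⟨h1, h2⟩
  obtain ⟨h3, rfl⟩ := Prod.mk.inj h2
  rw [Bool.and_eq_true, codeQuot_eq, h3, hw] at h1
  exact absurd h1.2 (by decide)

/-- The list gives the coefficients of the edges in the window. -/
def Represents (c : Edge → ℤ) (L : List (EdgeCode × ℤ)) : Prop :=
  ∀ z u, coeffOf L (z, u) = if inWindow u (quot z) then c (z, u) else 0

/-- The sum over the row is reindexed by `r = t * d - i`; terms with `r` outside `params` vanish by
assumption. -/
theorem sum_range_okParam {t : ℕ} {k : Fin 4} (d : ℤ) (h : ℤ → ℤ)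
    (h0 : ∀ i < ruleCount t k, h (t * d - i) ≠ 0 → -2 ≤ t * d - i ∧ t * d - i ≤ 2) :
    ∑ i ∈ Finset.range (ruleCount t k), h (t * d - i) =
      (params.map fun r => if okParam t k d r then h r else 0).sum := by
  have h1 : ∀ i ∈ Finset.range (ruleCount t k), h (t * d - i) =
      (params.map fun r => if r = t * d - i then h r else 0).sum := by
    intro i hi
    by_cases hne : h (t * d - i) = 0
    · rw [hne]
      symm
      refine List.sum_eq_zero fun a ha => ?_
      obtain ⟨r, _, rfl⟩ := List.mem_map.1 ha
      split_ifs with hr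
      · rw [hr, hne]
      · rfl
    · have := h0 i (Finset.mem_range.1 hi) hne
      generalize (t : ℤ) * d - i = r at *
      obtain ⟨h1, h2⟩ := this
      interval_cases r <;> simp [params]
  rw [Finset.sum_congr rfl h1]
  have h2 : ∀ r, ∑ i ∈ Finset.range (ruleCount t k), (if r = t * d - i then h r else 0) =
      if okParam t k d r then h r else 0 := by
    intro r
    have hiff : okParam t k d r ↔ 0 ≤ t * d - r ∧ t * d - r < ruleCount t k := by
      rw [okParam, Bool.and_eq_true, decide_eq_true_eq, decide_eq_true_eq]
    by_cases hok : okParam t k d r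
    · rw [if_pos hok]
      have hr := hiff.1 hok
      rw [Finset.sum_eq_single (t * d - r).toNat]
      · rw [if_pos]; omega
      · intro i _ hi; rw [if_neg]; omega
      · intro hi; exact absurd (Finset.mem_range.2 (by omega)) hi
    · rw [if_neg hok]
      rw [hiff] at hok
      refine Finset.sum_eq_zero fun i hi => ?_
      have := Finset.mem_range.1 hi
      rw [if_neg]; omega
  simp only [params, List.map_cons, List.map_nil, List.sum_cons, List.sum_nil, add_zero,
    Finset.sum_add_distrib, h2]

theorem coeffOf_stepList (t : ℕ) (L : List (EdgeCode × ℤ)) (z : Fin 5 → ℤ) (u : Fin 5)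
    (hw : inWindow u (quot z)) : coeffOf (stepList t L) (z, u) =
    ∑ p, edgeSign (edgeRule p u) * (params.map fun r =>
      if okParam t (edgeRule p u) (quot z).1 r then
        coeffOf L (parentVec (edgeRule p u) r z, p) else 0).sum := by
  rw [stepList, coeffOf_collect]
  induction L with
  | nil => simp [coeffOf_nil, params]
  | cons q L ih =>
    rw [List.flatMap_cons, coeffOf_append, ih, coeffOf_stepEntry _ _ _ _ hw]
    have h1 : ∀ p r, (if okParam t (edgeRule p u) (quot z).1 r then
        coeffOf (q :: L) (parentVec (edgeRule p u) r z, p) else 0) =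
        (if okParam t (edgeRule p u) (quot z).1 r then
          (if codeEdge q.1 = (parentVec (edgeRule p u) r z, p) then q.2 else 0) else 0) +
        (if okParam t (edgeRule p u) (quot z).1 r then
          coeffOf L (parentVec (edgeRule p u) r z, p) else 0) := by
      intro p r
      split_ifs <;> simp [coeffOf_cons, *]
    simp only [h1, List.sum_map_add, mul_add, Finset.sum_add_distrib]
    congr 1
    rw [Finset.sum_eq_single q.1.1]
    · simp [codeEdge]
    · intro p _ hp
      rw [mul_eq_zero]
      right
      refine List.sum_eq_zero fun a ha => ?_
      obtain ⟨r, _, rfl⟩ := List.mem_map.1 ha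
      simp [codeEdge, Ne.symm hp]
    · simp

/-- At an edge of the window the recursion reads only coefficients in the window: a nonzero one
outside would contradict `window_parent`. Then `okParam_min` replaces `t` by `min t 4`. -/
theorem Represents.step {t : ℕ} {β : ℝ} (hβ : 1 < β) {c : ℕ → Edge → ℤ}
    (h : EdgeRecursion t c) (ha : ∀ n e, c n e ≠ 0 → Admissible β edgeBound e.2 e.1) {n : ℕ}
    {L : List (EdgeCode × ℤ)} (hL : Represents (c n) L) :
    Represents (c (n + 1)) (stepList (min t 4) L) := by
  intro z u
  by_cases hw : inWindow u (quot z)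
  swap
  · rw [if_neg hw, stepList, coeffOf_collect, coeffOf_flatMap]
    refine List.sum_eq_zero fun a ha => ?_
    obtain ⟨q, _, rfl⟩ := List.mem_map.1 ha
    exact coeffOf_stepEntry_of_not_inWindow _ _ _ _ (by simpa using hw)
  rw [if_pos hw, h, coeffOf_stepList _ _ _ _ hw]
  refine Finset.sum_congr rfl fun p _ => ?_
  have key : ∀ i < ruleCount t (edgeRule p u),
      c n (parentVec (edgeRule p u) (t * (quot z).1 - i) z, p) ≠ 0 →
      inWindow p (quot (parentVec (edgeRule p u) (t * (quot z).1 - i) z)) ∧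
        -2 ≤ t * (quot z).1 - i ∧ t * (quot z).1 - i ≤ 2 := by
    intro i hi hne
    have hadm := ha n _ hne
    rw [← mulM_sub_shift hi] at hadm ⊢
    exact window_parent hβ hw hi (sub_add_cancel _ _).symm hadm
  have hsum : ∑ i ∈ Finset.range (ruleCount t (edgeRule p u)),
      c n (mulM t z - shift (edgeRule p u) i, p) =
      (params.map fun r => if okParam t (edgeRule p u) (quot z).1 r then
        c n (parentVec (edgeRule p u) r z, p) else 0).sum := by
    rw [← sum_range_okParam (quot z).1 (fun r => c n (parentVec (edgeRule p u) r z, p))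
      fun i hi hne => (key i hi hne).2]
    exact Finset.sum_congr rfl fun i hi => by rw [mulM_sub_shift (Finset.mem_range.1 hi)]
  rw [hsum]
  refine congrArg _ (congrArg _ (List.map_congr_left fun r hr => ?_))
  rw [okParam_min t _ _ r hr]
  split_ifs with hok
  · rw [okParam, Bool.and_eq_true, decide_eq_true_eq, decide_eq_true_eq] at hok
    have hi := key (t * (quot z).1 - r).toNat (by omega)
    rw [show (t : ℤ) * (quot z).1 - ((t * (quot z).1 - r).toNat : ℤ) = r by omega] at hi
    rw [hL]
    split_ifs with hw'
    · rfl
    · by_contra hne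
      exact hw' (hi (Ne.symm hne)).1
  · rfl

/-! ## Boundaries of the touching triples -/

/-- The types of the touching triples. -/
def tripleType : Fin 5 → Fin 3 → Fin 10 := ![![0, 6, 3], ![3, 2, 9], ![9, 7, 8], ![8, 5, 4],
  ![4, 1, 0]]

/-- The cells of the touching triples at the origin. -/
def tripleCells (m : Fin 5) : Finset Cell := Finset.univ.image fun j => (0, tripleType m j)

/-- Coordinates of the basis vectors. -/
def basisCode : Fin 5 → ℤ × ℤ × ℤ × ℤ × ℤ :=
  ![(1, 0, 0, 0, 0), (0, 1, 0, 0, 0), (0, 0, 1, 0, 0), (0, 0, 0, 1, 0), (0, 0, 0, 0, 1)]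

/-- The boundary of a touching triple. -/
def startList (m : Fin 5) : List (EdgeCode × ℤ) :=
  collect ((List.finRange 3).flatMap fun j =>
    [((fstLetter (tripleType m j), 0), 1),
      ((sndLetter (tripleType m j), basisCode (fstLetter (tripleType m j))), 1),
      ((fstLetter (tripleType m j), basisCode (sndLetter (tripleType m j))), -1),
      ((sndLetter (tripleType m j), 0), -1)])

theorem codeVec_basisCode (a : Fin 5) : codeVec (basisCode a) = basisVec a := by
  revert a; decide

theorem spread_tripleCells {β : ℝ} (hβ : 1 < β) (m : Fin 5) : Spread β (tripleCells m) := by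
  have hc : ∀ m j j', tripleType m j = tripleType m j' ∨
      nearNe (tripleType m j) (tripleType m j') 0 = false := by decide +kernel
  refine ⟨fun F hF => ?_, fun F hF G hG hne => ?_⟩
  · obtain ⟨j, _, rfl⟩ := Finset.mem_image.1 hF
    exact admissible_zero hβ _
  · obtain ⟨j, _, rfl⟩ := Finset.mem_image.1 hF
    obtain ⟨j', _, rfl⟩ := Finset.mem_image.1 hG
    have hne' : tripleType m j ≠ tripleType m j' := fun h => hne (by rw [h])
    refine ⟨?_, fun h => hne' h.1⟩
    rw [sub_self]
    exact (hc m j j').resolve_left hne'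

theorem tripleType_injective (m : Fin 5) : Function.Injective (tripleType m) := by
  revert m; decide

theorem chainOf_tripleCells (m : Fin 5) :
    chainOf (tripleCells m) = ∑ j, cellChain (0, tripleType m j) := by
  rw [chainOf, tripleCells, Finset.sum_image]
  intro j _ j' _ h
  exact tripleType_injective m (Prod.mk.inj h).2

theorem coeffOf_startList (m : Fin 5) (e : Edge) :
    coeffOf (startList m) e = boundary (chainOf (tripleCells m)) (edgeFace e) := by
  have happ : ∀ e e' : Edge, edgeChain e (edgeFace e') = if e = e' then 1 else 0 := by
    intro e e'
    rw [edgeChain, Finsupp.single_apply]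
    simp only [edgeFace_bijective.1.eq_iff]
  have h0 : codeVec 0 = 0 := by decide
  rw [chainOf_tripleCells, map_sum, Finsupp.finsetSum_apply, startList, coeffOf_collect,
    coeffOf_flatMap, ← List.ofFn_id, List.map_ofFn, List.sum_ofFn]
  refine Finset.sum_congr rfl fun j _ => ?_
  rw [boundary_cellChain]
  simp only [Function.comp_apply, id, coeffOf_cons, coeffOf_nil, codeEdge, codeVec_basisCode, h0,
    Finsupp.sub_apply, Finsupp.add_apply, happ, zero_add]
  split_ifs <;> ring

theorem startList_window : ∀ m, ∀ q ∈ startList m, inWindow q.1.1 (codeQuot q.1.2) := by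
  decide +kernel

theorem startList_bound : ∀ m, ∀ q ∈ startList m, isUp (codeQuot q.1.2) ∧
    isUp (edgeBound q.1.1 - codeQuot q.1.2) ∧ edgeBound q.1.1 - codeQuot q.1.2 ≠ 0 := by
  decide +kernel

/-- The window is large enough: every admissible edge near to the initial boundary belongs to it. -/
theorem startList_near : ∀ m, ∀ q ∈ startList m, ∀ n ∈ edgeNearList,
    (n.1 = q.1.1 → inadmissible n.2.1 (codeQuot q.1.2 + n.2.2) ||
      inWindow n.2.1 (codeQuot q.1.2 + n.2.2)) ∧
    (n.2.1 = q.1.1 → inadmissible n.1 (codeQuot q.1.2 - n.2.2) ||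
      inWindow n.1 (codeQuot q.1.2 - n.2.2)) := by
  decide +kernel

/-- Here the exponent fifteen enters: after that many steps the boundary has left the window, for
every triple and for `t = 0, …, 4`, the possible values of `min t 4`. -/
theorem iterate_stepList (m t : Fin 5) : (stepList t)^[15] (startList m) = [] := by
  revert m t; decide +kernel

theorem edge_touching : ∀ u v, ∀ σ ∈ [(0 : ℤ), 1], ∀ τ ∈ [(0 : ℤ), 1],
    excluded edgeBound u v (quot (σ • basisVec u - τ • basisVec v)) ||
      edgeNear u v (quot (σ • basisVec u - τ • basisVec v)) := by
  decide +kernel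

theorem exists_of_coeffOf_ne_zero {L : List (EdgeCode × ℤ)} {e : Edge} (h : coeffOf L e ≠ 0) :
    ∃ q ∈ L, codeEdge q.1 = e := by
  induction L with
  | nil => exact absurd rfl h
  | cons q L ih =>
    rw [coeffOf_cons] at h
    by_cases hq : codeEdge q.1 = e
    · exact ⟨q, List.mem_cons_self, hq⟩
    · rw [if_neg hq, zero_add] at h
      obtain ⟨q', hq', h'⟩ := ih h
      exact ⟨q', List.mem_cons_of_mem _ hq', h'⟩

/-- The coefficients of the boundaries of the images of a touching triple. -/
noncomputable def tripleCoeff (t : ℕ) (m : Fin 5) (n : ℕ) (e : Edge) : ℤ :=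
  boundary (chainOf (descend t n (tripleCells m))) (edgeFace e)

theorem tripleCoeff_recursion {t : ℕ} {β : ℝ} (hβ : IsDilation t β) (m : Fin 5) :
    EdgeRecursion t (tripleCoeff t m) :=
  (spread_tripleCells hβ.one_lt m).edgeRecursion hβ

theorem tripleCoeff_start {t : ℕ} {m : Fin 5} {e : Edge}
    (he : tripleCoeff t m 0 e ≠ 0) : ∃ q ∈ startList m, codeEdge q.1 = e :=
  exists_of_coeffOf_ne_zero (by rwa [coeffOf_startList])

theorem tripleCoeff_admissible {t : ℕ} {β : ℝ} (hβ : IsDilation t β) (m : Fin 5) : ∀ n e,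
    tripleCoeff t m n e ≠ 0 → Admissible β edgeBound e.2 e.1 := by
  refine (tripleCoeff_recursion hβ m).admissible hβ fun e he => ?_
  obtain ⟨q, hq, rfl⟩ := tripleCoeff_start he
  obtain ⟨h1, h2, h3⟩ := startList_bound m q hq
  refine ⟨ell_nonneg hβ.one_lt h1, ?_⟩
  have := ell_pos hβ.one_lt h2 h3
  rw [ell_sub] at this
  exact sub_pos.1 this

theorem tripleCoeff_window {t : ℕ} {β : ℝ} (hβ : IsDilation t β) (m : Fin 5) (z : Fin 5 → ℤ) (u : Fin 5)
    (hw : inWindow u (quot z)) : tripleCoeff t m 15 (z, u) = 0 := by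
  have key : ∀ n, Represents (tripleCoeff t m n) ((stepList (min t 4))^[n] (startList m)) := by
    intro n
    induction n with
    | zero =>
      intro z u
      change coeffOf (startList m) (z, u) = _
      split_ifs with h
      · rw [coeffOf_startList]; rfl
      · by_contra hne
        obtain ⟨q, hq, he⟩ := exists_of_coeffOf_ne_zero hne
        obtain ⟨h1, h2⟩ := Prod.mk.inj he
        have := startList_window m q hq
        rw [codeQuot_eq, h1, h2] at this
        exact h this
    | succ n ih =>
      rw [Function.iterate_succ_apply']
      exact ih.step hβ.one_lt (tripleCoeff_recursion hβ m) (tripleCoeff_admissible hβ m)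
  have h := key 15 z u
  have h' := iterate_stepList m ⟨min t 4, by omega⟩
  simp only at h'
  rw [h', if_pos hw] at h
  exact h.symm

/-- Going back `n` generations gives a near pair at levels `0` and `15`. The edge at level `15` then
lies in the window, where all coefficients vanish. -/
theorem tripleCoeff_not_near {t : ℕ} {β : ℝ} (hβ : IsDilation t β) (m : Fin 5) (n : ℕ) {e f : Edge}
    (he : tripleCoeff t m n e ≠ 0) (hf : tripleCoeff t m (n + 15) f ≠ 0) :
    edgeNear e.2 f.2 (quot f.1 - quot e.1) = false := by
  rw [← Bool.not_eq_true]
  intro hn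
  obtain ⟨e', ⟨y, v⟩, he', hf', hn'⟩ := (tripleCoeff_recursion hβ m).pull_edgeNear hβ
    (tripleCoeff_admissible hβ m) 15 n he hf hn
  obtain ⟨q, hq, rfl⟩ := tripleCoeff_start he'
  have hadm := (tripleCoeff_admissible hβ m 15 _ hf').not_inadmissible hβ.one_lt
  simp only at hadm hn'
  refine hf' (tripleCoeff_window hβ m y v ?_)
  obtain ⟨d, hd⟩ : ∃ d, d = quot y - quot (codeEdge q.1).1 := ⟨_, rfl⟩
  have hy : quot y = codeQuot q.1.2 + d := by rw [hd, codeQuot_eq]; simp [codeEdge]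
  rw [← hd, edgeNear, Bool.or_eq_true, decide_eq_true_eq, decide_eq_true_eq] at hn'
  rcases hn' with hn' | hn'
  · have := (startList_near m q hq _ hn').1 rfl
    simpa only [← hy, hadm, Bool.false_or] using this
  · have := (startList_near m q hq _ hn').2 rfl
    simpa only [sub_neg_eq_add, ← hy, hadm, Bool.false_or] using this

/-! ### Touching edges and disjointness of boundaries. -/

theorem mem_faceSupport_edgeFace {e : Edge} {y : Fin 5 → ℝ} :
    y ∈ faceSupport (edgeFace e) ↔ ∃ s ∈ Set.Icc (0 : ℝ) 1,
      y = (fun j => (e.1 j : ℝ)) + s • (Pi.single e.2 1 : Fin 5 → ℝ) := by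
  constructor
  · rintro ⟨s, hs, rfl⟩
    exact ⟨s e.2, hs _, by simp [edgeFace]⟩
  · rintro ⟨s, hs, rfl⟩
    exact ⟨fun _ => s, fun _ => hs, by simp [edgeFace]⟩

theorem eq_zero_or_one_of_cast {a : ℤ} {s : ℝ} (hs : s ∈ Set.Icc (0 : ℝ) 1) (h : (a : ℝ) = s) :
    a ∈ [(0 : ℤ), 1] := by
  have h0 : (0 : ℝ) ≤ a := h ▸ hs.1
  have h1 : (a : ℝ) ≤ 1 := h ▸ hs.2
  have h0' : 0 ≤ a := by exact_mod_cast h0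
  have h1' : a ≤ 1 := by exact_mod_cast h1
  simp only [List.mem_cons, List.not_mem_nil, or_false]
  omega

/-- Parallel edges that meet are offset by `-1`, `0` or `1` along their direction. For different
directions, the coordinate along each edge is constant and integral on the other edge, so both
parameters of the meeting point are `0` or `1`. -/
theorem edges_touching {e f : Edge}
    (h : ¬Disjoint (faceSupport (edgeFace e)) (faceSupport (edgeFace f))) :
    ∃ σ ∈ [(0 : ℤ), 1], ∃ τ ∈ [(0 : ℤ), 1],
      f.1 - e.1 = σ • basisVec e.2 - τ • basisVec f.2 := by
  rw [Set.not_disjoint_iff] at h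
  obtain ⟨y, hy, hy'⟩ := h
  obtain ⟨x, u⟩ := e
  obtain ⟨x', v⟩ := f
  obtain ⟨s, hs, rfl⟩ := mem_faceSupport_edgeFace.1 hy
  obtain ⟨s', hs', h⟩ := mem_faceSupport_edgeFace.1 hy'
  have hc : ∀ j, (x j : ℝ) + s * (Pi.single u 1 : Fin 5 → ℝ) j =
      x' j + s' * (Pi.single v 1 : Fin 5 → ℝ) j := fun j => by
    have := congrFun h j
    simpa using this
  by_cases huv : u = v
  · subst huv
    have hu := hc u
    simp only [Pi.single_eq_same, mul_one] at hu
    have hoff : ∀ j, j ≠ u → x' j - x j = 0 := by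
      intro j hj
      have := hc j
      rw [Pi.single_eq_of_ne hj, mul_zero, mul_zero, add_zero, add_zero] at this
      have : x j = x' j := by exact_mod_cast this
      omega
    have hr : ((x' u - x u : ℤ) : ℝ) = s - s' := by push_cast; linarith
    have h1 : ((x' u - x u : ℤ) : ℝ) ≤ 1 := by linarith [hs.2, hs'.1]
    have h2 : (-1 : ℝ) ≤ ((x' u - x u : ℤ) : ℝ) := by linarith [hs.1, hs'.2]
    have h1' : x' u - x u ≤ 1 := by exact_mod_cast h1
    have h2' : -1 ≤ x' u - x u := by exact_mod_cast h2
    have hv : ∀ σ τ : ℤ, x' u - x u = σ - τ →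
        x' - x = σ • basisVec u - τ • basisVec u := by
      intro σ τ hστ
      ext j
      by_cases hj : j = u
      · subst hj; simp [hστ]
      · simp [hj, hoff j hj]
    obtain h3 | h3 | h3 : x' u - x u = -1 ∨ x' u - x u = 0 ∨ x' u - x u = 1 := by omega
    · exact ⟨0, by simp, 1, by simp, hv 0 1 (by omega)⟩
    · exact ⟨0, by simp, 0, by simp, hv 0 0 (by omega)⟩
    · exact ⟨1, by simp, 0, by simp, hv 1 0 (by omega)⟩
  · have hu := hc u
    rw [Pi.single_eq_same, Pi.single_eq_of_ne huv, mul_one, mul_zero, add_zero] at hu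
    have hv := hc v
    rw [Pi.single_eq_same, Pi.single_eq_of_ne (Ne.symm huv), mul_one, mul_zero, add_zero] at hv
    refine ⟨x' u - x u, eq_zero_or_one_of_cast hs (by push_cast; linarith), x v - x' v,
      eq_zero_or_one_of_cast hs' (by push_cast; linarith), ?_⟩
    ext j
    by_cases hj : j = u
    · subst hj; simp [huv]
    · by_cases hj' : j = v
      · subst hj'; simp [hj]
      · have := hc j
        rw [Pi.single_eq_of_ne hj, Pi.single_eq_of_ne hj', mul_zero, mul_zero, add_zero,
          add_zero] at this
        have : x j = x' j := by exact_mod_cast this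
        simp [hj, hj', this]

theorem disjoint_boundaries {t : ℕ} {β : ℝ} (hβ : IsDilation t β) (m : Fin 5) (n : ℕ) :
    Disjoint (supportOf ((boundary (chainOf (descend t n (tripleCells m)))).support :
        Set (Face 5 1)))
      (supportOf ((boundary (chainOf (descend t (n + 15) (tripleCells m)))).support :
        Set (Face 5 1))) := by
  simp only [supportOf, Set.disjoint_iUnion_left, Set.disjoint_iUnion_right]
  intro f hf e he
  obtain ⟨e, rfl⟩ := edgeFace_bijective.2 e
  obtain ⟨f, rfl⟩ := edgeFace_bijective.2 f
  rw [Finset.mem_coe, Finsupp.mem_support_iff] at he hf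
  by_contra hd
  obtain ⟨σ, hσ, τ, hτ, h⟩ := edges_touching hd
  have h1 := edge_touching e.2 f.2 σ hσ τ hτ
  rw [← h, quot_sub, tripleCoeff_not_near hβ m n he hf,
    (tripleCoeff_admissible hβ m _ _ he).not_excluded hβ.one_lt
      (tripleCoeff_admissible hβ m _ _ hf)] at h1
  exact absurd h1 (by decide)

/-! ## Connectedness of the images of the touching triples -/

/-- Adjacent pairs of cells: the types and the difference of the positions. -/
abbrev Link : Type := Fin 10 × Fin 10 × ℤ × ℤ × ℤ × ℤ × ℤ

/-- Adjacent pairs for all values of `t`. -/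
def commonLinks : List Link := [
    (0, 6, 1, 0, 0, 0, -1), (1, 7, 1, 0, 0, 0, -1), (2, 9, 1, 0, 0, 0, -1),
    (9, 3, -1, 0, 0, 1, 0), (8, 9, 0, 0, 1, 0, -1)]

/-- Adjacent pairs for `t = 0`. -/
def zeroLinks : List Link := [
    (4, 8, 0, 1, 0, -1, 0), (6, 4, 0, 0, -1, 0, 0), (9, 6, 0, -1, 0, 0, 0),
    (6, 5, 0, 0, 0, -1, 1), (2, 1, 0, 0, -1, 1, 0), (7, 6, 0, -1, 1, 0, 0), (5, 9, 0, 1, 0, 0, 0),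
    (7, 8, 0, 0, 0, -1, 1), (5, 4, 0, 0, -1, 1, 0)]

/-- Adjacent pairs for `t ≥ 1`. -/
def posLinks : List Link := [
    (6, 6, 0, 0, 0, 0, 1), (9, 9, 0, 0, 0, 0, 1), (7, 7, 0, 0, 0, 0, 1), (4, 7, 0, 1, 0, 0, 0),
    (5, 6, 0, 0, 0, 1, -1), (8, 7, 0, 0, 0, 1, -1), (1, 3, 0, 0, 1, 0, 0), (6, 9, 0, 1, 0, 0, 0),
    (4, 6, 0, 0, 1, 0, 0)]

/-- The adjacent pairs with different positions that are used to connect the images. -/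
def links : ℕ → List Link
  | 0 => commonLinks ++ zeroLinks
  | _ + 1 => commonLinks ++ posLinks

instance (q : Link) (L : List Link) : Decidable (q ∈ L) := inferInstance

/-- The types have a common letter. -/
def ShareLetter (p q : Fin 10) : Prop := ∃ a, a ∈ (typeOf p).1 ∧ a ∈ (typeOf q).1

instance (p q : Fin 10) : Decidable (ShareLetter p q) := by unfold ShareLetter; infer_instance

/-- The second cell is obtained from the first by a link, or has the same position. -/
def Linked (t : ℕ) (F G : Cell) : Prop :=
  (∃ q ∈ links t, F.2 = q.1 ∧ G.2 = q.2.1 ∧ G.1 = F.1 + codeVec q.2.2) ∨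
    (F.1 = G.1 ∧ ShareLetter F.2 G.2)

/-- Adjacency of cells. -/
def Adjacent (t : ℕ) (F G : Cell) : Prop := Linked t F G ∨ Linked t G F

theorem Adjacent.symm {t : ℕ} {F G : Cell} (h : Adjacent t F G) : Adjacent t G F := Or.symm h

/-- The chosen children have row index `0`, so their translations do not involve `t`. For `b = 1`
the new link is moreover a vector on which `M` does not depend on `t`, so a check with `mulM 0`
covers every `t ≥ 1`. -/
theorem links_children : ∀ b : Fin 2, ∀ q ∈ links b, ∃ u u',
    faceRule q.1 u ≠ 3 ∧ faceRule q.2.1 u' ≠ 3 ∧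
    (b = 0 → faceRule q.1 u ≠ 2 ∧ faceRule q.2.1 u' ≠ 2) ∧
    ((codeVec q.2.2 + shift (faceRule q.2.1 u') 0 - shift (faceRule q.1 u) 0 = 0 ∧
        ShareLetter u u') ∨
      ∃ q' ∈ links b, (b = 0 ∨ codeVec q'.2.2 0 + codeVec q'.2.2 3 = 0) ∧
        ((q'.1 = u ∧ q'.2.1 = u' ∧ mulM 0 (codeVec q'.2.2) =
            codeVec q.2.2 + shift (faceRule q.2.1 u') 0 - shift (faceRule q.1 u) 0) ∨
          (q'.1 = u' ∧ q'.2.1 = u ∧ mulM 0 (codeVec q'.2.2) =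
            -(codeVec q.2.2 + shift (faceRule q.2.1 u') 0 - shift (faceRule q.1 u) 0)))) := by
  decide +kernel

theorem shareLetter_rotate : ∀ p q, ShareLetter p q → ShareLetter (rotate p) (rotate q) := by
  decide +kernel

theorem mulM_eq_of_sum_eq_zero {z : Fin 5 → ℤ} (h : z 0 + z 3 = 0) (t : ℕ) :
    mulM t z = mulM 0 z := by
  ext j; fin_cases j <;> simp [mulM]
  linear_combination (t : ℤ) * h

theorem ruleCount_pos_of {t : ℕ} {k : Fin 4} (h3 : k ≠ 3) (h2 : t = 0 → k ≠ 2) :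
    0 < ruleCount t k := by
  fin_cases k <;> simp [ruleCount] at *
  omega

theorem mem_children_mk {t : ℕ} {F : Cell} {u : Fin 10} {i : ℕ}
    (hi : i < ruleCount t (faceRule F.2 u)) :
    ((mulN t (F.1 + shift (faceRule F.2 u) i), u) : Cell) ∈ children t F :=
  mem_children.2 ⟨i, hi, mulM_mulN _ _⟩

theorem shift_zero_zero : shift 0 0 = 0 := by
  ext j; fin_cases j <;> rfl

theorem mem_children_rotate (t : ℕ) (F : Cell) :
    ((mulN t F.1, rotate F.2) : Cell) ∈ children t F := by
  have h := (faceRule_eq_zero F.2 _).2 rfl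
  have := mem_children_mk (t := t) (F := F) (u := rotate F.2) (i := 0) (by
    rw [h]; exact Nat.one_pos)
  rwa [h, shift_zero_zero, add_zero] at this

theorem Linked.children {t : ℕ} {F G : Cell} (h : Linked t F G) :
    ∃ F' ∈ children t F, ∃ G' ∈ children t G, Adjacent t F' G' := by
  rcases h with ⟨q, hq, h1, h2, h3⟩ | ⟨h1, h2⟩
  -- Only `t = 0` needs its own table, because the rules of kind `2` are empty there.
  · obtain ⟨b, hb, hb0⟩ : ∃ b : Fin 2, links t = links b ∧ (t = 0 ↔ b = 0) := by
      cases t with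
      | zero => exact ⟨0, rfl, by simp⟩
      | succ t => exact ⟨1, rfl, by simp⟩
    rw [hb] at hq
    obtain ⟨u, u', hu, hu', hb2, hcase⟩ := links_children b q hq
    rw [← h1] at hu hb2 hcase
    rw [← h2] at hu' hb2 hcase
    refine ⟨_, mem_children_mk (ruleCount_pos_of hu fun h => (hb2 (hb0.1 h)).1),
      _, mem_children_mk (ruleCount_pos_of hu' fun h => (hb2 (hb0.1 h)).2), ?_⟩
    set k := faceRule F.2 u
    set k' := faceRule G.2 u'
    obtain ⟨D, hD⟩ : ∃ D, D = codeVec q.2.2 + shift k' 0 - shift k 0 := ⟨_, rfl⟩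
    have hpos : mulN t (G.1 + shift k' 0) = mulN t (F.1 + shift k 0) + mulN t D := by
      rw [← mulN_add, hD, h3]
      congr 1
      abel
    rw [← hD] at hcase
    rcases hcase with ⟨h0, hs⟩ | ⟨q', hq', hz, hc⟩
    · refine Or.inl (Or.inr ⟨?_, hs⟩)
      have hN0 : mulN t 0 = 0 := by ext j; fin_cases j <;> simp [mulN]
      rw [hpos, h0, hN0, add_zero]
    · have hM : mulM t (codeVec q'.2.2) = mulM 0 (codeVec q'.2.2) := by
        rcases hz with hz | hz
        · rw [hb0.2 hz]
        · exact mulM_eq_of_sum_eq_zero hz t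
      rw [← hb] at hq'
      rcases hc with ⟨hc1, hc2, hc3⟩ | ⟨hc1, hc2, hc3⟩
      · refine Or.inl (Or.inl ⟨q', hq', hc1.symm, hc2.symm, ?_⟩)
        rw [← hM, mulM_eq_iff] at hc3
        rw [hc3]
        exact hpos
      · refine Or.inr (Or.inl ⟨q', hq', hc1.symm, hc2.symm, ?_⟩)
        rw [← hM, mulM_eq_iff] at hc3
        simp only [hc3, hpos]
        rw [add_assoc, ← mulN_add, add_neg_cancel, show mulN t 0 = 0 by
          ext j; fin_cases j <;> simp [mulN], add_zero]
  · exact ⟨_, mem_children_rotate t F, _, mem_children_rotate t G,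
      Or.inl (Or.inr ⟨by rw [h1], shareLetter_rotate _ _ h2⟩)⟩

theorem Adjacent.children {t : ℕ} {F G : Cell} (h : Adjacent t F G) :
    ∃ F' ∈ children t F, ∃ G' ∈ children t G, Adjacent t F' G' := by
  rcases h with h | h
  · exact h.children
  · obtain ⟨G', hG, F', hF, h'⟩ := h.children
    exact ⟨F', hF, G', hG, h'.symm⟩

/-- Connection by adjacent cells of a set. -/
def LinkJoined (t : ℕ) (S : Finset Cell) : Cell → Cell → Prop :=
  Relation.ReflTransGen fun A B => A ∈ S ∧ B ∈ S ∧ Adjacent t A B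

theorem LinkJoined.symm {t : ℕ} {S : Finset Cell} {F G : Cell} (h : LinkJoined t S F G) :
    LinkJoined t S G F :=
  (@Relation.ReflTransGen.stdSymm _ _ ⟨fun _ _ h => ⟨h.2.1, h.1, h.2.2.symm⟩⟩).symm _ _ h

theorem LinkJoined.mono {t : ℕ} {S T : Finset Cell} (hST : S ⊆ T) {F G : Cell}
    (h : LinkJoined t S F G) : LinkJoined t T F G :=
  Relation.ReflTransGen.mono (fun _ _ h => ⟨hST h.1, hST h.2.1, h.2.2⟩) _ _ h

theorem joined_of_adjacent {t : ℕ} {S : Finset Cell} {F G : Cell} (hF : F ∈ S) (hG : G ∈ S)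
    (h : Adjacent t F G) : LinkJoined t S F G :=
  Relation.ReflTransGen.single ⟨hF, hG, h⟩

theorem adjacent_of_link {t : ℕ} {p q : Fin 10} {x y : Fin 5 → ℤ} {c : ℤ × ℤ × ℤ × ℤ × ℤ}
    (h : (p, q, c) ∈ links t) (hx : mulM t (codeVec c) = y - x) :
    Adjacent t (mulN t x, p) (mulN t y, q) := by
  refine Or.inl (Or.inl ⟨_, h, rfl, rfl, ?_⟩)
  rw [(mulM_eq_iff _ _ _).1 hx, ← mulN_add, add_sub_cancel]

theorem mem_links_of_common {q : Link} (h : q ∈ commonLinks) (t : ℕ) : q ∈ links t := by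
  cases t <;> exact List.mem_append_left _ h

theorem mem_links_of_pos {q : Link} (h : q ∈ posLinks) {t : ℕ} (ht : t ≠ 0) : q ∈ links t := by
  cases t with
  | zero => exact absurd rfl ht
  | succ t => exact List.mem_append_right _ h

theorem shift_succ_sub {k : Fin 4} (hk : k = 1 ∨ k = 2) (i t : ℕ) :
    mulM t (codeVec (0, 0, 0, 0, 1)) = shift k (i + 1) - shift k i := by
  rw [shift_succ hk, add_sub_cancel_right]
  ext j; fin_cases j <;> simp [mulM, codeVec]

theorem joined_row {t : ℕ} {F G : Cell} {u : Fin 10} {k : Fin 4} (hk : faceRule F.2 u = k)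
    (hk' : k = 1 ∨ k = 2) (hl : ((u, u, 0, 0, 0, 0, 1) : Link) ∈ posLinks) {m : ℕ}
    (hm : ruleCount t k = m + 1) (ht : 0 < m → t ≠ 0)
    (hlast : LinkJoined t (children t F) (mulN t (F.1 + shift k m), u) G) (i : ℕ) (hi : i ≤ m) :
    LinkJoined t (children t F) (mulN t (F.1 + shift k i), u) G := by
  induction hi using Nat.decreasingInduction with
  | self => exact hlast
  | of_succ i hi ih =>
    have mem : ∀ i ≤ m, ((mulN t (F.1 + shift k i), u) : Cell) ∈ children t F := by
      intro i hi
      rw [← hk]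
      exact mem_children_mk (by rw [hk]; omega)
    refine (joined_of_adjacent (mem i hi.le) (mem (i + 1) hi) ?_).trans ih
    refine adjacent_of_link (mem_links_of_pos hl (ht (by omega))) ?_
    rw [add_sub_add_left_eq_sub]
    exact shift_succ_sub hk' i t

theorem mem_links_of_faceRule_one : ∀ p u, faceRule p u = 1 →
    ((rotate p, u, 1, 0, 0, 0, -1) : Link) ∈ commonLinks ∧ ((u, u, 0, 0, 0, 0, 1) : Link) ∈ posLinks := by
  decide +kernel

theorem mem_links_of_faceRule_two : ∀ p u, faceRule p u = 2 → (p = 6 ∧ u = 3) ∨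
    ((rotate p, u, 0, 0, 0, 1, -1) : Link) ∈ posLinks ∧ ((u, u, 0, 0, 0, 0, 1) : Link) ∈ posLinks := by
  decide +kernel

/-- Consecutive cells of a row are linked, and the last cell of the row is linked to the child at
index `0` of kind `0`, which serves as a hub. The exception is the row from type `6` to type `3`,
which is attached cell by cell to a row of kind `1`. -/
theorem joined_children {t : ℕ} {F G : Cell} (hG : G ∈ children t F) :
    LinkJoined t (children t F) G (mulN t F.1, rotate F.2) := by
  have hone : ∀ u i, faceRule F.2 u = 1 → i ≤ t →
      LinkJoined t (children t F) (mulN t (F.1 + shift 1 i), u) (mulN t F.1, rotate F.2) := by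
    intro u i hk hi
    obtain ⟨h1, h2⟩ := mem_links_of_faceRule_one _ _ hk
    refine joined_row hk (Or.inl rfl) h2 (m := t) rfl (fun h => h.ne') ?_ i hi
    have hmem := mem_children_mk (t := t) (F := F) (u := u) (i := t) (by
      rw [hk]; exact Nat.lt_succ_self t)
    rw [hk] at hmem
    refine (joined_of_adjacent (mem_children_rotate t F) hmem ?_).symm
    refine adjacent_of_link (mem_links_of_common h1 t) ?_
    rw [add_sub_cancel_left]
    ext j; fin_cases j <;> simp [mulM, codeVec, shift]
  obtain ⟨i, hi, hm⟩ := mem_children.1 hG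
  obtain ⟨z, u⟩ := G
  rw [mulM_eq_iff] at hm
  simp only at hi hm
  subst hm
  obtain ⟨k, hk⟩ : ∃ k, faceRule F.2 u = k := ⟨_, rfl⟩
  rw [hk] at hi hG ⊢
  obtain rfl | rfl | rfl | rfl : k = 0 ∨ k = 1 ∨ k = 2 ∨ k = 3 :=
    (by decide : ∀ k : Fin 4, k = 0 ∨ k = 1 ∨ k = 2 ∨ k = 3) k
  · obtain rfl : i = 0 := by simpa [ruleCount] using hi
    rw [shift_zero_zero, add_zero, (faceRule_eq_zero _ _).1 hk]
    exact Relation.ReflTransGen.refl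
  · exact hone u i hk (Nat.lt_succ_iff.1 hi)
  · have hi' : i < t := hi
    rcases mem_links_of_faceRule_two _ _ hk with ⟨hp, rfl⟩ | ⟨h1, h2⟩
    -- Index `i` of the row of type `3` is linked to index `i + 1` of the row of type `9`; the
    -- latter row is longer by one, so this index exists.
    · have h9 : faceRule F.2 9 = 1 := by rw [hp]; decide
      have hmem := mem_children_mk (t := t) (F := F) (u := 9) (i := i + 1) (by
        rw [h9]; exact Nat.succ_lt_succ hi')
      rw [h9] at hmem
      refine (joined_of_adjacent hmem hG ?_).symm.trans (hone 9 (i + 1) h9 hi')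
      refine adjacent_of_link (c := (-1, 0, 0, 1, 0)) (mem_links_of_common (by decide) t) ?_
      ext j; fin_cases j <;> simp [mulM, codeVec, shift]
    · refine joined_row hk (Or.inr rfl) h2 (m := t - 1) (Nat.sub_add_cancel (by omega)).symm
        (fun _ => by omega) ?_ i (by omega)
      have hmem := mem_children_mk (t := t) (F := F) (u := u) (i := t - 1) (by
        rw [hk]; change t - 1 < t; omega)
      rw [hk] at hmem
      refine (joined_of_adjacent (mem_children_rotate t F) hmem ?_).symm
      refine adjacent_of_link (mem_links_of_pos h1 (by omega)) ?_
      have : ((t - 1 : ℕ) : ℤ) = t - 1 := by push_cast [show 1 ≤ t by omega]; rfl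
      rw [add_sub_cancel_left]
      ext j; fin_cases j <;> simp [mulM, codeVec, shift, this]
      ring
  · simp [ruleCount] at hi

/-- Any two cells of the set are connected by adjacent cells. -/
def Linkwise (t : ℕ) (S : Finset Cell) : Prop := ∀ F ∈ S, ∀ G ∈ S, LinkJoined t S F G

/-- The hubs represent their families: a path of parents lifts to a path of hubs, each step passing
through an adjacent pair of children. -/
theorem Linkwise.biUnion_children {t : ℕ} {S : Finset Cell} (h : Linkwise t S) :
    Linkwise t (S.biUnion (children t)) := by
  have hsub : ∀ F ∈ S, children t F ⊆ S.biUnion (children t) :=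
    fun F hF => Finset.subset_biUnion_of_mem _ hF
  have key : ∀ F G, LinkJoined t S F G → F ∈ S → LinkJoined t (S.biUnion (children t))
      (mulN t F.1, rotate F.2) (mulN t G.1, rotate G.2) := by
    intro F G hFG hF
    induction hFG with
    | refl => exact Relation.ReflTransGen.refl
    | tail _ hAB ih =>
      obtain ⟨hA, hB, hadj⟩ := hAB
      obtain ⟨A', hA', B', hB', hadj'⟩ := hadj.children
      exact ih.trans ((((joined_children hA').mono (hsub _ hA)).symm.trans
        (joined_of_adjacent (hsub _ hA hA') (hsub _ hB hB') hadj')).trans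
          ((joined_children hB').mono (hsub _ hB)))
  intro F' hF' G' hG'
  obtain ⟨F, hF, hFF'⟩ := Finset.mem_biUnion.1 hF'
  obtain ⟨G, hG, hGG'⟩ := Finset.mem_biUnion.1 hG'
  exact (((joined_children hFF').mono (hsub _ hF)).trans (key F G (h F hF G hG) hF)).trans
    ((joined_children hGG').mono (hsub _ hG)).symm

theorem linkwise_descend (t : ℕ) (m : Fin 5) (n : ℕ) :
    Linkwise t (descend t n (tripleCells m)) := by
  induction n with
  | zero =>
    have hc : ∀ m j j', ShareLetter (tripleType m j) (tripleType m j') := by decide +kernel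
    intro F hF G hG
    refine joined_of_adjacent hF hG (Or.inl (Or.inr ?_))
    obtain ⟨j, _, rfl⟩ := Finset.mem_image.1 hF
    obtain ⟨j', _, rfl⟩ := Finset.mem_image.1 hG
    exact ⟨rfl, hc m j j'⟩
  | succ n ih => exact ih.biUnion_children

/-! ### From adjacency of cells to common edges of faces. -/

/-- The difference of positions for which cells of types `p` and `q` have a common edge. -/
def EdgeCheck (p q : Fin 10) (d : Fin 5 → ℤ) : Prop :=
  ∃ a b b', (typeOf p).1 = {a, b} ∧ (typeOf q).1 = {a, b'} ∧ a ≠ b ∧ a ≠ b' ∧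
    ∃ σ ∈ [(0 : ℤ), 1], ∃ τ ∈ [(0 : ℤ), 1], d = σ • basisVec b - τ • basisVec b'

instance (p q : Fin 10) (d : Fin 5 → ℤ) : Decidable (EdgeCheck p q d) := by
  unfold EdgeCheck; infer_instance

theorem edgeCheck_links : ∀ b : Fin 2, ∀ q ∈ links b, EdgeCheck q.1 q.2.1 (codeVec q.2.2) := by
  decide +kernel

theorem edgeCheck_zero : ∀ p q, ShareLetter p q → EdgeCheck p q 0 := by
  decide +kernel

theorem faceSupport_edge_subset {x : Fin 5 → ℤ} {p : Fin 10} {a b : Fin 5}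
    (hp : (typeOf p).1 = {a, b}) (hab : a ≠ b) {σ : ℤ} (hσ : σ ∈ [(0 : ℤ), 1]) :
    faceSupport (edgeFace (x + σ • basisVec b, a)) ⊆ faceSupport (toFace (x, p)) := by
  intro y hy
  obtain ⟨s, hs, rfl⟩ := mem_faceSupport_edgeFace.1 hy
  refine ⟨fun i => if i = a then s else σ, fun i => ?_, ?_⟩
  · dsimp only
    split_ifs
    · exact hs
    · simp only [List.mem_cons, List.not_mem_nil, or_false] at hσ
      rcases hσ with rfl | rfl <;> simp
  · change _ = _ + ∑ i ∈ (typeOf p).1, _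
    rw [hp, Finset.sum_pair hab]
    ext j
    by_cases h1 : j = a
    · subst h1; simp [hab, hab.symm, toFace]
    · by_cases h2 : j = b
      · subst h2; simp [hab.symm, toFace]
      · simp [h1, h2, hab.symm, toFace]

theorem EdgeCheck.sharesEdge {F G : Cell} (h : EdgeCheck F.2 G.2 (G.1 - F.1)) :
    SharesEdge (toFace F) (toFace G) := by
  obtain ⟨a, b, b', hp, hq, hab, hab', σ, hσ, τ, hτ, hd⟩ := h
  refine ⟨edgeFace (F.1 + σ • basisVec b, a), Set.subset_inter
    (faceSupport_edge_subset hp hab hσ) ?_⟩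
  rw [show F.1 + σ • basisVec b = G.1 + τ • basisVec b' by
    rw [sub_eq_iff_eq_add] at hd; rw [hd]; abel]
  exact faceSupport_edge_subset hq hab' hτ

theorem SharesEdge.symm {n k : ℕ} {F G : Face n k} (h : SharesEdge F G) : SharesEdge G F := by
  obtain ⟨e, he⟩ := h
  exact ⟨e, by rwa [Set.inter_comm]⟩

theorem Adjacent.sharesEdge {t : ℕ} {F G : Cell} (h : Adjacent t F G) :
    SharesEdge (toFace F) (toFace G) := by
  have key : ∀ F G : Cell, Linked t F G → SharesEdge (toFace F) (toFace G) := by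
    rintro F G (⟨q, hq, h1, h2, h3⟩ | ⟨h1, h2⟩)
    · apply EdgeCheck.sharesEdge
      rw [h1, h2, h3, add_sub_cancel_left]
      cases t with
      | zero => exact edgeCheck_links 0 q hq
      | succ t => exact edgeCheck_links 1 q hq
    · apply EdgeCheck.sharesEdge
      rw [h1, sub_self]
      exact edgeCheck_zero _ _ h2
  rcases h with h | h
  · exact key F G h
  · exact (key G F h).symm

theorem isEdgeConnected_descend (t : ℕ) (m : Fin 5) (n : ℕ) :
    IsEdgeConnected (chainOf (descend t n (tripleCells m))) := by
  refine ⟨isGeometric_chainOf _, fun f hf g hg => ?_⟩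
  obtain ⟨F, hF, rfl⟩ := mem_support_chainOf_iff.1 hf
  obtain ⟨G, hG, rfl⟩ := mem_support_chainOf_iff.1 hg
  refine Relation.ReflTransGen.lift toFace (fun A B hAB => ?_) _ _ (linkwise_descend t m n F hF G hG)
  exact ⟨mem_support_chainOf.2 hAB.1, mem_support_chainOf.2 hAB.2.1, hAB.2.2.sharesEdge⟩

theorem surrounds_descend {t : ℕ} {β : ℝ} (hβ : IsDilation t β) (m : Fin 5) (n : ℕ) :
    Surrounds (chainOf (descend t (n + 15) (tripleCells m)))
      (chainOf (descend t n (tripleCells m))) := by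
  refine ⟨isEdgeConnected_descend t m _, isEdgeConnected_descend t m n, fun f hf => ?_,
    disjoint_boundaries hβ m n⟩
  obtain ⟨F, hF, rfl⟩ := mem_support_chainOf_iff.1 hf
  refine mem_support_chainOf.2 (descend_subset hβ (fun G hG => ?_) n 3 hF)
  obtain ⟨j, _, rfl⟩ := Finset.mem_image.1 hG
  rfl

/-! ## The dominant eigenvalue and the Pisot polynomial -/

theorem exists_isDilation (t : ℕ) : ∃ β, IsDilation t β := by
  have hcont : ContinuousOn (fun x : ℝ => x ^ 3 - t * x ^ 2 - (t + 1) * x - 1)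
      (Set.Icc 1 (t + 2)) := by fun_prop
  have ht : (0 : ℝ) ≤ t := Nat.cast_nonneg t
  have h := intermediate_value_Icc (by linarith) hcont
  have h0 : (0 : ℝ) ∈ Set.Icc ((1 : ℝ) ^ 3 - t * 1 ^ 2 - (t + 1) * 1 - 1)
      ((t + 2 : ℝ) ^ 3 - t * (t + 2) ^ 2 - (t + 1) * (t + 2) - 1) := by
    constructor <;> nlinarith
  obtain ⟨β, hβ, h1⟩ := h h0
  simp only at h1
  refine ⟨β, lt_of_le_of_ne hβ.1 ?_, by linarith⟩
  rintro rfl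
  norm_num at h1
  linarith

/-- The quintic is `s² - s + 1 > 0` times the cubic, so the cubic is non-positive at `s`. Divided by
`s³` the cubic is strictly increasing for `s > 0` and vanishes at `β`; the inequalities below are
this comparison with denominators cleared. -/
theorem IsDilation.le_of_le {t : ℕ} {β s : ℝ} (hβ : IsDilation t β)
    (hs : s ^ 5 ≤ (t + 1) * s ^ 4 + t * s + 1) : s ≤ β := by
  by_contra hlt
  rw [not_le] at hlt
  have hb : 0 < β := by linarith [hβ.one_lt]
  have hs0 : 0 < s := hb.trans hlt
  have h1 : (s ^ 2 - s + 1) * (s ^ 3 - t * s ^ 2 - (t + 1) * s - 1) ≤ 0 := by nlinarith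
  have h2 : 0 < s ^ 2 - s + 1 := by nlinarith [sq_nonneg (s - 1)]
  have h3 : s ^ 3 - t * s ^ 2 - (t + 1) * s - 1 ≤ 0 := nonpos_of_mul_nonpos_right h1 h2
  have e1 : s ^ 2 * β ^ 3 ≤ s ^ 3 * β ^ 2 := by
    have : 0 ≤ s ^ 2 * β ^ 2 * (s - β) := by
      have := sub_pos.2 hlt; positivity
    linarith
  have e2 : s * β ^ 3 ≤ s ^ 3 * β := by
    have : 0 ≤ s * β * (s + β) * (s - β) := by
      have := sub_pos.2 hlt; positivity
    linarith
  have e3 : β ^ 3 < s ^ 3 := by gcongr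
  have ht : (0 : ℝ) ≤ t := Nat.cast_nonneg t
  have e4 : s ^ 3 * β ^ 3 ≤ (t * s ^ 2 + (t + 1) * s + 1) * β ^ 3 := by
    gcongr; linarith
  have e5 : s ^ 3 * β ^ 3 = s ^ 3 * (t * β ^ 2 + (t + 1) * β + 1) := by rw [hβ.root]
  have f1 : t * (s ^ 2 * β ^ 3) ≤ t * (s ^ 3 * β ^ 2) := by gcongr
  have f2 : (t + 1) * (s * β ^ 3) ≤ (t + 1) * (s ^ 3 * β) := by gcongr
  linarith

theorem IsDilation.pow_five {t : ℕ} {β : ℝ} (hβ : IsDilation t β) :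
    β ^ 5 = (t + 1) * β ^ 4 + t * β + 1 := by
  linear_combination (β ^ 2 - β + 1) * hβ.root

theorem map_incidence_mulVec {R : Type*} [CommRing R] (t : ℕ) (v : Fin 5 → R) :
    ((incidence (sigma t)).map (Int.cast : ℤ → R)).mulVec v =
      ![(t + 1) * v 0 + t * v 3 + v 4, v 0, v 1, v 2, v 3] := by
  rw [incidence_sigma]
  ext i
  fin_cases i <;> simp [Matrix.mulVec, dotProduct, Fin.sum_univ_succ]
  ring

/-- A direct Perron–Frobenius argument: an eigenvalue satisfies a quintic with non-negative
right-hand side coefficients, so its modulus satisfies the hypothesis of `IsDilation.le_of_le`. An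
explicit eigenvector shows that `β` is attained. -/
theorem IsDilation.dominantEigenvalue_eq {t : ℕ} {β : ℝ} (hβ : IsDilation t β) :
    dominantEigenvalue (sigma t) = β := by
  have hb : 0 < β := by linarith [hβ.one_lt]
  have hmem : ∀ k : ℂ, k ∈ spectrum ℂ ((incidence (sigma t)).map (Int.cast : ℤ → ℂ)) ↔
      ∃ v : Fin 5 → ℂ, v ≠ 0 ∧
        ((incidence (sigma t)).map (Int.cast : ℤ → ℂ)).mulVec v = k • v := by
    intro k
    rw [spectrum.mem_iff, Matrix.isUnit_iff_isUnit_det, isUnit_iff_ne_zero, not_not,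
      ← Matrix.exists_mulVec_eq_zero_iff]
    refine exists_congr fun v => and_congr_right fun _ => ?_
    rw [Matrix.sub_mulVec, Matrix.algebraMap_eq_diagonal, sub_eq_zero, eq_comm]
    have : (Matrix.diagonal ((algebraMap ℂ (Fin 5 → ℂ)) k)).mulVec v = k • v := by
      ext i; simp [Matrix.mulVec_diagonal]
    rw [this]
  have hle : ∀ k ∈ spectrum ℂ ((incidence (sigma t)).map (Int.cast : ℤ → ℂ)), ‖k‖ ≤ β := by
    intro k hk
    obtain ⟨v, hv, h⟩ := (hmem k).1 hk
    rw [map_incidence_mulVec] at h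
    have h0 := congrFun h 0
    have h1 := congrFun h 1
    have h2 := congrFun h 2
    have h3 := congrFun h 3
    have h4 := congrFun h 4
    simp only [Matrix.cons_val, Pi.smul_apply, smul_eq_mul] at h0 h1 h2 h3 h4
    have hv4 : v 4 ≠ 0 := by
      intro h5
      apply hv
      ext i
      rw [h5, mul_zero] at h4
      rw [h4, mul_zero] at h3
      rw [h3, mul_zero] at h2
      rw [h2, mul_zero] at h1
      fin_cases i <;> assumption
    have hk5 : k ^ 5 = (t + 1) * k ^ 4 + t * k + 1 := by
      apply mul_right_cancel₀ hv4
      linear_combination -h0 - (k - (t + 1)) * h1 - (k - (t + 1)) * k * h2 -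
        (k - (t + 1)) * k ^ 2 * h3 - ((k - (t + 1)) * k ^ 3 - t) * h4
    apply hβ.le_of_le
    rw [← norm_pow, hk5]
    refine (norm_add_le _ _).trans ?_
    rw [norm_one]
    gcongr
    refine (norm_add_le _ _).trans ?_
    rw [norm_mul, norm_mul, norm_pow]
    have h6 : ‖((t : ℂ) + 1)‖ = t + 1 := by
      have : ((t : ℂ) + 1) = ((t + 1 : ℕ) : ℂ) := by push_cast; rfl
      rw [this, Complex.norm_natCast]; push_cast; rfl
    rw [h6, Complex.norm_natCast]
  have hβmem : (β : ℂ) ∈ spectrum ℂ ((incidence (sigma t)).map (Int.cast : ℤ → ℂ)) := by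
    refine (hmem _).2 ⟨![(β : ℂ) ^ 4, (β : ℂ) ^ 3, (β : ℂ) ^ 2, β, 1], ?_, ?_⟩
    · intro h
      have := congrFun h 4
      simp at this
    · rw [map_incidence_mulVec]
      have h5 : (β : ℂ) ^ 5 = (t + 1) * (β : ℂ) ^ 4 + t * β + 1 := by
        exact_mod_cast congrArg (fun x : ℝ => (x : ℂ)) hβ.pow_five
      ext i
      fin_cases i <;> simp <;> first | linear_combination -h5 | ring
  have hsup : spectralRadius ℂ ((incidence (sigma t)).map (Int.cast : ℤ → ℂ)) =
      ENNReal.ofReal β := by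
    apply le_antisymm
    · refine iSup₂_le fun k hk => ENNReal.coe_le_coe.2 (NNReal.coe_le_coe.1 ?_)
      rw [Real.coe_toNNReal _ hb.le]
      exact hle k hk
    · refine le_trans (ENNReal.coe_le_coe.2 (NNReal.coe_le_coe.1 ?_))
        (le_iSup₂ (f := fun k _ => (‖k‖₊ : ENNReal)) (β : ℂ) hβmem)
      rw [Real.coe_toNNReal _ hb.le, coe_nnnorm, Complex.norm_real]
      exact le_abs_self β
  rw [dominantEigenvalue, hsup, ENNReal.toReal_ofReal hb.le]

/-- The Pisot polynomial with coefficients in `R`. -/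
noncomputable def cubic (R : Type*) [CommRing R] (t : ℕ) : R[X] :=
  X ^ 3 - C (t : R) * X ^ 2 - C ((t : R) + 1) * X - 1

theorem cubic_monic (R : Type*) [CommRing R] [Nontrivial R] (t : ℕ) : (cubic R t).Monic := by
  unfold cubic
  monicity!

theorem cubic_natDegree (R : Type*) [CommRing R] [Nontrivial R] (t : ℕ) :
    (cubic R t).natDegree = 3 := by
  unfold cubic
  compute_degree!

theorem map_cubic {R S : Type*} [CommRing R] [CommRing S] (f : R →+* S) (t : ℕ) :
    (cubic R t).map f = cubic S t := by
  simp [cubic]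

/-- In degree three it is enough to exclude rational roots. Such a root is an integer dividing `1`,
and neither `1` nor `-1` is a root. -/
theorem cubic_irreducible (t : ℕ) : Irreducible (cubic ℚ t) := by
  rw [(cubic_monic ℚ t).irreducible_iff_roots_eq_zero_of_degree_le_three
    (by rw [cubic_natDegree]; norm_num) (by rw [cubic_natDegree])]
  rw [Multiset.eq_zero_iff_forall_notMem]
  intro r hr
  rw [mem_roots (cubic_monic ℚ t).ne_zero, IsRoot.def] at hr
  have hint : IsIntegral ℤ r := by
    refine ⟨cubic ℤ t, cubic_monic ℤ t, ?_⟩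
    rw [← map_cubic (algebraMap ℤ ℚ), eval_map] at hr
    exact hr
  obtain ⟨n, rfl⟩ := IsIntegrallyClosed.isIntegral_iff.1 hint
  simp only [cubic, eval_sub, eval_mul, eval_pow, eval_X, eval_C, eval_one, eq_intCast] at hr
  have h : n * (n ^ 2 - t * n - (t + 1)) = 1 := by
    have : ((n * (n ^ 2 - t * n - (t + 1)) : ℤ) : ℚ) = 1 := by push_cast; linarith
    exact_mod_cast this
  rcases Int.eq_one_or_neg_one_of_mul_eq_one h with rfl | rfl <;> omega

theorem IsDilation.pisotPoly_eq {t : ℕ} {β : ℝ} (hβ : IsDilation t β) :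
    pisotPoly (sigma t) = cubic ℝ t := by
  rw [pisotPoly, hβ.dominantEigenvalue_eq, ← minpoly.eq_of_irreducible_of_monic
    (cubic_irreducible t) ?_ (cubic_monic ℚ t), map_cubic]
  rw [aeval_def, ← eval_map, map_cubic]
  simp only [cubic, eval_sub, eval_mul, eval_pow, eval_X, eval_C, eval_one]
  linarith [hβ.root]

theorem IsDilation.pisotPoly_div {t : ℕ} {β : ℝ} (hβ : IsDilation t β) :
    pisotPoly (sigma t) /ₘ (X - C (dominantEigenvalue (sigma t))) =
      X ^ 2 + C (β - t) * X + C (β ^ 2 - t * β - (t + 1)) := by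
  rw [hβ.pisotPoly_eq, hβ.dominantEigenvalue_eq]
  have h : cubic ℝ t = (X - C β) * (X ^ 2 + C (β - t) * X + C (β ^ 2 - t * β - (t + 1))) := by
    have h1 : (1 : ℝ[X]) = C (β ^ 3 - t * β ^ 2 - (t + 1) * β) := by
      rw [← C_1]; congr 1; linarith [hβ.root]
    rw [cubic, h1]
    simp only [C_sub, C_add, C_mul, C_pow, C_1]
    ring
  rw [h, mul_divByMonic_cancel_left _ (monic_X_sub_C β)]

/-! ## The projection along the expanding and the neutral space -/

/-- The second conjugate coefficient. -/
def gam (t : ℕ) (β : ℝ) : ℝ := β ^ 2 - t * β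

/-- The linear map to the plane with kernel the sum of the expanding and the neutral space. -/
def planeMap (t : ℕ) (β : ℝ) : (Fin 5 → ℝ) →ₗ[ℝ] ℝ × ℝ where
  toFun x := (x 0 + x 3 - β * (x 1 + x 4), x 0 + x 2 + x 4 - gam t β * (x 1 + x 4))
  map_add' x y := by
    simp only [Pi.add_apply, Prod.mk_add_mk, Prod.mk.injEq]
    constructor <;> ring
  map_smul' c x := by
    simp only [Pi.smul_apply, smul_eq_mul, RingHom.id_apply, Prod.smul_mk, Prod.mk.injEq]
    constructor <;> ring

theorem planeMap_apply (t : ℕ) (β : ℝ) (x : Fin 5 → ℝ) : planeMap t β x =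
    (x 0 + x 3 - β * (x 1 + x 4), x 0 + x 2 + x 4 - gam t β * (x 1 + x 4)) := rfl

theorem incidenceEnd_apply (t : ℕ) (x : Fin 5 → ℝ) : incidenceEnd (sigma t) x =
    ![(t + 1) * x 0 + t * x 3 + x 4, x 0, x 1, x 2, x 3] := by
  rw [incidenceEnd, Matrix.toLin'_apply, map_incidence_mulVec]

theorem aeval_cubic_apply (t : ℕ) (L : Module.End ℝ (Fin 5 → ℝ)) (x : Fin 5 → ℝ) :
    aeval L (cubic ℝ t) x = L (L (L x)) - (t : ℝ) • L (L x) - ((t : ℝ) + 1) • L x - x := by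
  ext i
  simp [cubic, pow_succ]
  ring

theorem aeval_quadratic_apply (a b : ℝ) (L : Module.End ℝ (Fin 5 → ℝ)) (x : Fin 5 → ℝ) :
    aeval L (X ^ 2 + C a * X + C b) x = L (L x) + a • L x + b • x := by
  simp [pow_succ, Algebra.algebraMap_eq_smul_one]

theorem IsDilation.gam_mul {t : ℕ} {β : ℝ} (hβ : IsDilation t β) :
    β * (gam t β - t - 1) = 1 := by
  rw [gam]; linear_combination hβ.root

/-- Subtracting a multiple of the `β`-eigenvector leaves a vector `y` of class zero. There `M² = M -
1`, so the cubic in `M` acts as `(t - 2) - (2t + 1) M`, which is invertible; hence `y` lies in the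
range defining `K_n`. -/
theorem IsDilation.planeMap_ker {t : ℕ} {β : ℝ} (hβ : IsDilation t β) {x : Fin 5 → ℝ}
    (hx : planeMap t β x = 0) :
    x ∈ expandingSpace (sigma t) ⊔ neutralSpace (sigma t) := by
  have hb : 0 < β := by linarith [hβ.one_lt]
  have hN : β ^ 3 + 1 ≠ 0 := by positivity
  rw [planeMap_apply, Prod.mk_eq_zero] at hx
  obtain ⟨h1, h2⟩ := hx
  -- The eigenvector `(β⁴, β³, β², β, 1)` has class `(β³ + 1) • (β, gam t β, 1)`, so the third
  -- coordinate determines the multiple.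
  obtain ⟨c, hc⟩ : ∃ c, c = (x 1 + x 4) / (β ^ 3 + 1) := ⟨_, rfl⟩
  have hc' : x 1 + x 4 = c * (β ^ 3 + 1) := by rw [hc]; field_simp
  have hg : gam t β * (β ^ 3 + 1) = β ^ 4 + β ^ 2 + 1 := by
    rw [gam]; linear_combination (β ^ 2 - β + 1) * hβ.root
  obtain ⟨v, hv⟩ : ∃ v : Fin 5 → ℝ, v = ![β ^ 4, β ^ 3, β ^ 2, β, 1] := ⟨_, rfl⟩
  rw [show x = c • v + (x - c • v) by abel]
  refine Submodule.add_mem_sup (Submodule.smul_mem _ _ ?_) ?_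
  · rw [expandingSpace, Module.End.mem_eigenspace_iff, hβ.dominantEigenvalue_eq,
      incidenceEnd_apply, hv]
    ext i
    fin_cases i <;> simp <;> first | linear_combination -hβ.pow_five | ring
  · rw [neutralSpace, hβ.pisotPoly_eq]
    obtain ⟨y, hy⟩ : ∃ y, y = x - c • v := ⟨_, rfl⟩
    have e1 : y 1 = -y 4 := by
      rw [hy, hv]; simp; linear_combination hc'
    have e3 : y 3 = -y 0 := by
      rw [hy, hv]; simp; linear_combination h1 + β * hc'
    have e2 : y 2 = -y 0 - y 4 := by
      rw [hy, hv]; simp; linear_combination h2 + gam t β * hc' + c * hg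
    obtain ⟨N, hNdef⟩ : ∃ N : ℝ, N = (t - 2) ^ 2 - (t - 2) * (2 * t + 1) + (2 * t + 1) ^ 2 :=
      ⟨_, rfl⟩
    have hN0 : N ≠ 0 := by
      have ht : (0 : ℝ) ≤ t := Nat.cast_nonneg t
      have : 0 < N := by rw [hNdef]; nlinarith [sq_nonneg ((t : ℝ) - 2 - (2 * t + 1) / 2)]
      exact this.ne'
    -- The inverse is the conjugate of `(t - 2) - (2t + 1) M` under `M ↦ 1 - M`, divided by the norm
    -- `N`.
    refine ⟨N⁻¹ • ((-(t : ℝ) - 3) • y + (2 * (t : ℝ) + 1) • incidenceEnd (sigma t) y), ?_⟩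
    rw [← hy, map_smul, aeval_cubic_apply]
    rw [inv_smul_eq_iff₀ hN0]
    ext i
    fin_cases i <;>
      simp only [incidenceEnd_apply, Pi.add_apply, Pi.sub_apply, Pi.smul_apply, smul_eq_mul,
        Matrix.cons_val, Fin.zero_eta, Fin.mk_one, Fin.reduceFinMk, e1, e2, e3, hNdef] <;> ring

theorem planeMap_surjective (t : ℕ) (β : ℝ) : Function.Surjective (planeMap t β) := by
  rintro ⟨a, b⟩
  exact ⟨![0, 0, b, a, 0], by simp [planeMap_apply]⟩

/-- The map induced on the plane by the incidence matrix. -/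
def planeEnd (τ κ : ℝ) (w : ℝ × ℝ) : ℝ × ℝ := (-τ * w.1 + w.2, -κ * w.1)

theorem planeMap_incidenceEnd {t : ℕ} {β : ℝ} (hβ : IsDilation t β) (x : Fin 5 → ℝ) :
    planeMap t β (incidenceEnd (sigma t) x) =
      planeEnd (β - t) (gam t β - t - 1) (planeMap t β x) := by
  have h := hβ.gam_mul
  rw [incidenceEnd_apply]
  simp only [planeMap_apply, planeEnd, Matrix.cons_val, Prod.mk.injEq]
  constructor
  · rw [gam]; ring
  · linear_combination -(x 1 + x 4) * h

theorem planeEnd_solve (τ κ a b : ℝ) (h : a ^ 2 - τ * a * b + κ * b ^ 2 ≠ 0) (c : ℝ × ℝ) :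
    ∃ w, a • w + b • planeEnd τ κ w = c := by
  refine ⟨(a ^ 2 - τ * a * b + κ * b ^ 2)⁻¹ • ((a - τ * b) • c - b • planeEnd τ κ c), ?_⟩
  obtain ⟨N, hN⟩ : ∃ N, N = a ^ 2 - τ * a * b + κ * b ^ 2 := ⟨_, rfl⟩
  rw [← hN] at h ⊢
  ext
  · simp [planeEnd]; field_simp; rw [hN]; ring
  · simp [planeEnd]; field_simp; rw [hN]; ring

/-- By Cayley–Hamilton `(M - β)(M² - M + 1)` maps everything into `K_c`. On the plane `M` acts with
characteristic polynomial `X² + τX + κ`, and both factors act invertibly there, so every point is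
reached. -/
theorem IsDilation.exists_mem_contractingSpace {t : ℕ} {β : ℝ} (hβ : IsDilation t β)
    (c : ℝ × ℝ) : ∃ y ∈ contractingSpace (sigma t), planeMap t β y = c := by
  have hb : 0 < β := by linarith [hβ.one_lt]
  have hg := hβ.gam_mul
  obtain ⟨κ, hκ⟩ : ∃ κ, κ = gam t β - t - 1 := ⟨_, rfl⟩
  obtain ⟨τ, hτ⟩ : ∃ τ, τ = β - t := ⟨_, rfl⟩
  rw [← hκ] at hg
  have hκ0 : 0 < κ := pos_of_mul_pos_right (by rw [hg]; exact one_pos) hb.le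
  have hκ1 : κ < 1 := by
    by_contra hle
    nlinarith [hβ.one_lt]
  have hτ0 : 0 < τ := by
    have h1 : 0 < β ^ 2 * τ := by
      have ht : (0 : ℝ) ≤ t := Nat.cast_nonneg t
      rw [hτ, show β ^ 2 * (β - t) = (t + 1) * β + 1 by linear_combination hβ.root]
      positivity
    exact pos_of_mul_pos_right h1 (by positivity)
  obtain ⟨w1, hw1⟩ := planeEnd_solve τ κ (-β) 1 (by
    have : 0 < (-β) ^ 2 - τ * (-β) * 1 + κ * 1 ^ 2 := by
      have : 0 < τ * β := by positivity
      nlinarith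
    exact this.ne') c
  -- On the plane `M² = -τM - κ`, so `M² - M + 1` acts as `(1 - κ) - (τ + 1) M`.
  obtain ⟨w2, hw2⟩ := planeEnd_solve τ κ (1 - κ) (-(τ + 1)) (by
    have h1 : 0 < 1 - κ := by linarith
    have : 0 < (1 - κ) ^ 2 + τ * (1 - κ) * (τ + 1) + κ * (τ + 1) ^ 2 := by positivity
    have h2 : (1 - κ) ^ 2 - τ * (1 - κ) * -(τ + 1) + κ * (-(τ + 1)) ^ 2 =
      (1 - κ) ^ 2 + τ * (1 - κ) * (τ + 1) + κ * (τ + 1) ^ 2 := by ring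
    rw [h2]
    exact this.ne') w1
  obtain ⟨x, hx⟩ := planeMap_surjective t β w2
  obtain ⟨L, hL⟩ : ∃ L, L = incidenceEnd (sigma t) := ⟨_, rfl⟩
  have hPL : ∀ x, planeMap t β (L x) = planeEnd τ κ (planeMap t β x) := by
    intro x
    rw [hL, hτ, hκ]
    exact planeMap_incidenceEnd hβ x
  have hP1 : planeMap t β (L (L x) - L x + x) = w1 := by
    rw [map_add, map_sub, hPL, hPL, hx, ← hw2]
    ext <;> simp [planeEnd] <;> ring
  refine ⟨L (L (L x) - L x + x) - β • (L (L x) - L x + x), ?_, ?_⟩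
  · rw [contractingSpace, hβ.pisotPoly_div, LinearMap.mem_ker, aeval_quadratic_apply, hL]
    obtain ⟨z, hz⟩ : ∃ z, z = incidenceEnd (sigma t) (incidenceEnd (sigma t) x) -
        incidenceEnd (sigma t) x + x := ⟨_, rfl⟩
    have hCH : aeval (incidenceEnd (sigma t)) (cubic ℝ t) z = 0 := by
      rw [aeval_cubic_apply, hz]
      ext i
      fin_cases i <;>
        simp only [incidenceEnd_apply, Pi.add_apply, Pi.sub_apply, Pi.smul_apply, smul_eq_mul,
          Matrix.cons_val, Fin.zero_eta, Fin.mk_one, Fin.reduceFinMk, Pi.zero_apply] <;> ring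
    rw [← hz]
    rw [aeval_cubic_apply] at hCH
    simp only [map_sub, map_smul]
    have h1 : β * (β ^ 2 - t * β - (t + 1)) = 1 := by linear_combination hβ.root
    have h2 : (β * (β ^ 2 - t * β - (t + 1))) • z = z := by rw [h1, one_smul]
    rw [← hL] at hCH ⊢
    rw [← hCH, ← sub_eq_zero]
    rw [← sub_eq_zero, ← neg_eq_zero] at h2
    rw [← h2]
    module
  · rw [map_sub, map_smul, hPL, hP1, ← hw1]
    module

/-! ## Faces in the plane -/

/-- The determinant of two vectors of the plane. -/
def planeDet (v w : ℝ × ℝ) : ℝ := v.2 * w.1 - v.1 * w.2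

theorem planeDet_self (v : ℝ × ℝ) : planeDet v v = 0 := by rw [planeDet]; ring

theorem planeDet_add_left (u v w : ℝ × ℝ) : planeDet (u + v) w = planeDet u w + planeDet v w := by
  simp only [planeDet, Prod.fst_add, Prod.snd_add]; ring

theorem planeDet_add_right (u v w : ℝ × ℝ) : planeDet u (v + w) = planeDet u v + planeDet u w := by
  simp only [planeDet, Prod.fst_add, Prod.snd_add]; ring

theorem planeDet_smul_left (c : ℝ) (v w : ℝ × ℝ) : planeDet (c • v) w = c * planeDet v w := by
  simp only [planeDet, Prod.smul_fst, Prod.smul_snd, smul_eq_mul]; ring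

theorem planeDet_smul_right (c : ℝ) (v w : ℝ × ℝ) : planeDet v (c • w) = c * planeDet v w := by
  simp only [planeDet, Prod.smul_fst, Prod.smul_snd, smul_eq_mul]; ring

/-- Cramer's rule. -/
theorem cramer {v w : ℝ × ℝ} (h : planeDet v w ≠ 0) (z : ℝ × ℝ) :
    (planeDet z w / planeDet v w) • v + (planeDet v z / planeDet v w) • w = z := by
  have key : planeDet z w • v + planeDet v z • w = planeDet v w • z := by
    ext <;> simp [planeDet] <;> ring
  rw [div_eq_inv_mul, div_eq_inv_mul, mul_smul, mul_smul, ← smul_add, key, inv_smul_smul₀ h]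

theorem IsDilation.gam_bounds {t : ℕ} {β : ℝ} (hβ : IsDilation t β) :
    1 < gam t β ∧ β < gam t β ∧ gam t β < β + 1 := by
  have h1 := hβ.one_lt
  have ht : (0 : ℝ) ≤ t := Nat.cast_nonneg t
  have h2 : (β + 1) * (gam t β - β) = 1 := by
    rw [gam]; linear_combination hβ.root
  have h3 : 0 < gam t β - β := pos_of_mul_pos_right (by rw [h2]; exact one_pos) (by linarith)
  exact ⟨by linarith, by linarith, by nlinarith⟩

/-- The image of a basis vector in the plane. -/
def letterVec (t : ℕ) (β : ℝ) (a : Fin 5) : ℝ × ℝ := planeMap t β (Pi.single a 1)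

/-- The area of the image of a face of type `p`. -/
def area (t : ℕ) (β : ℝ) (p : Fin 10) : ℝ :=
  planeDet (letterVec t β (fstLetter p)) (letterVec t β (sndLetter p))

/-- This is the reason for the order of letters in `fstLetter` and `sndLetter`; it follows from `1 <
β < gam t β < β + 1`. -/
theorem IsDilation.area_pos {t : ℕ} {β : ℝ} (hβ : IsDilation t β) (p : Fin 10) :
    0 < area t β p := by
  have h1 := hβ.one_lt
  obtain ⟨h2, h3, h4⟩ := hβ.gam_bounds
  fin_cases p <;>
    simp [area, planeDet, letterVec, planeMap_apply, fstLetter, sndLetter] <;>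
    linarith

/-- The integral points of the plane. -/
def latticePoint (t : ℕ) (β : ℝ) (x : Fin 5 → ℤ) : ℝ × ℝ := planeMap t β fun j => (x j : ℝ)

theorem latticePoint_add_basisVec (t : ℕ) (β : ℝ) (x : Fin 5 → ℤ) (a : Fin 5) :
    latticePoint t β (x + basisVec a) = latticePoint t β x + letterVec t β a := by
  rw [latticePoint, latticePoint, letterVec, ← map_add]
  congr 1
  ext j
  simp [Pi.single_apply]

theorem mem_faceSupport_toFace {F : Cell} {y : Fin 5 → ℝ} : y ∈ faceSupport (toFace F) ↔
    ∃ s ∈ Set.Icc (0 : ℝ) 1, ∃ u ∈ Set.Icc (0 : ℝ) 1, y = (fun j => (F.1 j : ℝ)) +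
      (s • (Pi.single (fstLetter F.2) 1 : Fin 5 → ℝ) + u • Pi.single (sndLetter F.2) 1) := by
  have hne : ∀ p, fstLetter p ≠ sndLetter p := by decide
  have hs : ∀ s : Fin 5 → ℝ, ∑ i ∈ (toFace F).2.1, s i • (Pi.single i 1 : Fin 5 → ℝ) =
      s (fstLetter F.2) • (Pi.single (fstLetter F.2) 1 : Fin 5 → ℝ) +
        s (sndLetter F.2) • Pi.single (sndLetter F.2) 1 := fun s =>
    Finset.sum_pair (hne F.2)
  constructor
  · rintro ⟨s, h, rfl⟩
    exact ⟨_, h _, _, h _, by rw [hs]; rfl⟩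
  · rintro ⟨s, h, u, h', rfl⟩
    refine ⟨fun i => if i = fstLetter F.2 then s else u, fun i => ?_, ?_⟩
    · dsimp only; split_ifs <;> assumption
    · rw [hs, if_pos rfl, if_neg (hne F.2).symm]; rfl

/-- The image of a face in the plane. -/
def tile (t : ℕ) (β : ℝ) (F : Cell) : Set (ℝ × ℝ) := planeMap t β '' faceSupport (toFace F)

theorem mem_tile {t : ℕ} {β : ℝ} {F : Cell} {w : ℝ × ℝ} : w ∈ tile t β F ↔
    ∃ s ∈ Set.Icc (0 : ℝ) 1, ∃ u ∈ Set.Icc (0 : ℝ) 1, w = latticePoint t β F.1 +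
      (s • letterVec t β (fstLetter F.2) + u • letterVec t β (sndLetter F.2)) := by
  constructor
  · rintro ⟨y, hy, rfl⟩
    obtain ⟨s, hs, u, hu, rfl⟩ := mem_faceSupport_toFace.1 hy
    exact ⟨s, hs, u, hu, by simp only [map_add, map_smul]; rfl⟩
  · rintro ⟨s, hs, u, hu, rfl⟩
    exact ⟨_, mem_faceSupport_toFace.2 ⟨s, hs, u, hu, rfl⟩, by
      simp only [map_add, map_smul]; rfl⟩

theorem mem_tile_of_planeDet {t : ℕ} {β : ℝ} (hβ : IsDilation t β) {F : Cell} {w : ℝ × ℝ}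
    (h1 : planeDet (w - latticePoint t β F.1) (letterVec t β (sndLetter F.2)) ∈
      Set.Icc 0 (area t β F.2))
    (h2 : planeDet (letterVec t β (fstLetter F.2)) (w - latticePoint t β F.1) ∈
      Set.Icc 0 (area t β F.2)) : w ∈ tile t β F := by
  have ha := hβ.area_pos F.2
  refine mem_tile.2 ⟨_, ⟨div_nonneg h1.1 ha.le, div_le_one_of_le₀ h1.2 ha.le⟩, _,
    ⟨div_nonneg h2.1 ha.le, div_le_one_of_le₀ h2.2 ha.le⟩, ?_⟩
  rw [area, cramer ha.ne', add_sub_cancel]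

theorem continuous_planeMap (t : ℕ) (β : ℝ) : Continuous (planeMap t β) :=
  LinearMap.continuous_of_finiteDimensional _

/-- Overlap and covering both ask for points inside projections, so only the inclusion of the kernel
of `planeMap` in `K_e + K_n` is needed, not equality. -/
theorem mem_projC {t : ℕ} {β : ℝ} (hβ : IsDilation t β) {S : Set (Fin 5 → ℝ)}
    {y : contractingSpace (sigma t)} (h : planeMap t β y ∈ planeMap t β '' S) :
    y ∈ projC (sigma t) S := by
  obtain ⟨x, hx, hxy⟩ := h
  exact ⟨x, hx, hβ.planeMap_ker (by rw [map_sub, hxy, sub_self])⟩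

theorem preimage_interior_tile_subset {t : ℕ} {β : ℝ} (hβ : IsDilation t β) (F : Cell) :
    (fun y : contractingSpace (sigma t) => planeMap t β y) ⁻¹' interior (tile t β F) ⊆
      interior (projC (sigma t) (faceSupport (toFace F))) :=
  interior_maximal (fun _ hy => mem_projC hβ (interior_subset hy))
    (isOpen_interior.preimage ((continuous_planeMap t β).comp continuous_subtype_val))

theorem mem_interior_tile {t : ℕ} {β : ℝ} (hβ : IsDilation t β) {F : Cell} {w : ℝ × ℝ}
    (h1 : planeDet (w - latticePoint t β F.1) (letterVec t β (sndLetter F.2)) ∈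
      Set.Ioo 0 (area t β F.2))
    (h2 : planeDet (letterVec t β (fstLetter F.2)) (w - latticePoint t β F.1) ∈
      Set.Ioo 0 (area t β F.2)) : w ∈ interior (tile t β F) := by
  refine mem_interior_iff_mem_nhds.2 (Filter.mem_of_superset (Filter.inter_mem
    (ContinuousAt.preimage_mem_nhds (f := fun w =>
      planeDet (w - latticePoint t β F.1) (letterVec t β (sndLetter F.2))) (Continuous.continuousAt
        (by unfold planeDet; fun_prop)) (isOpen_Ioo.mem_nhds h1))
    (ContinuousAt.preimage_mem_nhds (f := fun w =>
      planeDet (letterVec t β (fstLetter F.2)) (w - latticePoint t β F.1)) (Continuous.continuousAt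
        (by unfold planeDet; fun_prop)) (isOpen_Ioo.mem_nhds h2)))
    fun v hv => mem_tile_of_planeDet hβ (Set.Ioo_subset_Icc_self hv.1) (Set.Ioo_subset_Icc_self hv.2))

theorem latticePoint_zero (t : ℕ) (β : ℝ) : latticePoint t β 0 = 0 := by
  rw [latticePoint, ← map_zero (planeMap t β)]
  congr 1
  ext j
  simp

/-- Two positively oriented faces at the origin with the same first letter overlap. -/
theorem not_projectsWell {t : ℕ} {β : ℝ} (hβ : IsDilation t β) {P : Chain 5 2} {p q : Fin 10}
    (hpq : p ≠ q) (h : fstLetter p = fstLetter q) (hp : toFace (0, p) ∈ P.support)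
    (hq : toFace (0, q) ∈ P.support) : ¬ProjectsWell (sigma t) P := by
  intro hP
  have hd := hP.2 _ hp _ hq fun he => hpq (Prod.ext_iff.1 (toFace_bijective.1 he)).2
  have hD := hβ.area_pos p
  have hD' := hβ.area_pos q
  obtain ⟨c, hc⟩ : ∃ c, c = planeDet (letterVec t β (sndLetter p)) (letterVec t β (sndLetter q)) :=
    ⟨_, rfl⟩
  -- The common interior point `w` is the midpoint of the common edge, pushed by `ε` along the other
  -- edge of the first face. The push changes a coordinate relative to the second face by `ε * c`,
  -- and this `N` makes `ε` small enough for all the strict inequalities.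
  obtain ⟨N, hN⟩ : ∃ N, N = 2 * (area t β p + area t β q + |c|) := ⟨_, rfl⟩
  have hN0 : 0 < N := by rw [hN]; positivity
  obtain ⟨ε, hε⟩ : ∃ ε, ε = area t β q / N := ⟨_, rfl⟩
  have hε0 : 0 < ε := by rw [hε]; positivity
  have hεN : ε * N = area t β q := by rw [hε]; field_simp
  have hε1 : ε * area t β p + ε * area t β q + ε * |c| = area t β q / 2 := by
    rw [hN] at hεN; linarith
  have hεp : 0 < ε * area t β p := by positivity
  have hεq : 0 < ε * area t β q := by positivity
  have hεc := abs_le.1 ((abs_mul ε c).trans (by rw [abs_of_pos hε0]) : |ε * c| = ε * |c|).le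
  have hε2 : ε < 1 := by
    have := abs_nonneg c
    rw [hε, div_lt_one hN0]; rw [hN]; linarith
  have hεp1 : ε * area t β p < area t β p := by nlinarith
  obtain ⟨w, hw⟩ : ∃ w, w = (1 / 2 : ℝ) • letterVec t β (fstLetter p) +
    ε • letterVec t β (sndLetter p) := ⟨_, rfl⟩
  have hcεp : 0 ≤ ε * |c| := by positivity
  obtain ⟨y, hy, hyw⟩ := hβ.exists_mem_contractingSpace w
  have h1 : w ∈ interior (tile t β (0, p)) := by
    apply mem_interior_tile hβ
    · rw [latticePoint_zero, sub_zero, hw, planeDet_add_left, planeDet_smul_left, planeDet_smul_left,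
        planeDet_self]
      change 1 / 2 * area t β p + ε * 0 ∈ Set.Ioo 0 (area t β p)
      constructor <;> linarith
    · rw [latticePoint_zero, sub_zero, hw, planeDet_add_right, planeDet_smul_right, planeDet_smul_right,
        planeDet_self]
      change 1 / 2 * 0 + ε * area t β p ∈ Set.Ioo 0 (area t β p)
      constructor <;> linarith
  have h2 : w ∈ interior (tile t β (0, q)) := by
    apply mem_interior_tile hβ
    · rw [latticePoint_zero, sub_zero, hw, planeDet_add_left, planeDet_smul_left, planeDet_smul_left,
        ← hc, h]
      change 1 / 2 * area t β q + ε * c ∈ Set.Ioo 0 (area t β q)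
      constructor <;> linarith
    · rw [latticePoint_zero, sub_zero, hw, planeDet_add_right, planeDet_smul_right, planeDet_smul_right,
        ← h, planeDet_self]
      change 1 / 2 * 0 + ε * area t β p ∈ Set.Ioo 0 (area t β q)
      constructor <;> linarith
  exact Set.disjoint_left.1 hd
    (preimage_interior_tile_subset hβ (0, p) (show (⟨y, hy⟩ : contractingSpace (sigma t)) ∈ _ from
      (by rw [Set.mem_preimage]; exact hyw ▸ h1)))
    (preimage_interior_tile_subset hβ (0, q) (show (⟨y, hy⟩ : contractingSpace (sigma t)) ∈ _ from
      (by rw [Set.mem_preimage]; exact hyw ▸ h2)))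

/-! ## Touching triples -/

/-- The coefficients of the wedge of two letters. -/
def pairCoeff (a b : Fin 5) (p : Fin 10) : ℤ :=
  if fstLetter p = a ∧ sndLetter p = b then 1
  else if fstLetter p = b ∧ sndLetter p = a then -1 else 0

/-- The coefficients of a touching triple. -/
def touchingCoeff (a b c : Fin 5) (p : Fin 10) : ℤ :=
  pairCoeff a b p + pairCoeff b c p + pairCoeff c a p

theorem combination_apply (ε : Fin 10 → ℤ) (q : Fin 10) :
    (∑ p, ε p • cellChain (0, p)) (toFace (0, q)) = ε q * orientSign q := by
  rw [Finsupp.finsetSum_apply, Finset.sum_eq_single q]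
  · rw [Finsupp.smul_apply, cellChain, show ((0, q) : Cell).1 = 0 from rfl, toFace,
      Finsupp.single_eq_same, smul_eq_mul]
  · intro p _ hp
    rw [Finsupp.smul_apply, cellChain, Finsupp.single_apply, if_neg, smul_zero]
    intro h
    exact hp (Prod.ext_iff.1 (toFace_bijective.1 (h : toFace (0, p) = toFace (0, q)))).2
  · simp

theorem wedge_pair (a b : Fin 5) (h : a ≠ b) :
    wedge 0 ![a, b] = ∑ p, pairCoeff a b p • cellChain (0, p) := by
  have hinj : Function.Injective ![a, b] := by
    intro i j hij
    fin_cases i <;> fin_cases j <;> simp_all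
  have key : ∀ a b : Fin 5, a ≠ b → ∀ q,
      (if Finset.univ.image ![a, b] = {fstLetter q, sndLetter q} then sortSign ![a, b] else 0) =
        pairCoeff a b q * orientSign q := by decide +kernel
  ext ⟨x, f⟩
  obtain ⟨q, rfl⟩ := typeOf_bijective.2 f
  by_cases hx : x = 0
  · subst hx
    have h1 := combination_apply (pairCoeff a b) q
    rw [toFace] at h1
    rw [h1, wedge, dif_pos hinj, Finsupp.single_apply, ← key a b h q]
    simp only [Prod.mk.injEq, true_and, Subtype.ext_iff, typeOf]
  · rw [wedge, dif_pos hinj, Finsupp.single_apply, if_neg (fun h => hx (Prod.ext_iff.1 h).1.symm),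
      Finsupp.finsetSum_apply, Finset.sum_eq_zero]
    intro p _
    rw [Finsupp.smul_apply, cellChain, Finsupp.single_apply,
      if_neg (fun h => hx (Prod.ext_iff.1 h).1.symm), smul_zero]

theorem touchingTriple_eq {a b c : Fin 5} (hab : a ≠ b) (hbc : b ≠ c) (hac : a ≠ c) :
    touchingTriple a b c = ∑ p, touchingCoeff a b c p • cellChain (0, p) := by
  rw [touchingTriple, wedge_pair a b hab, wedge_pair b c hbc, wedge_pair c a hac.symm,
    ← Finset.sum_add_distrib, ← Finset.sum_add_distrib]
  simp only [touchingCoeff, add_smul]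

/-- The positive types form a regular tournament on the letters. A cyclic triple is one of the five
in `tripleType`, with a common sign; a transitive triple has a letter from which two arrows leave.
-/
theorem touchingCoeff_cases : ∀ a b c : Fin 5, a ≠ b → b ≠ c → a ≠ c →
    (∃ m, (∀ p, touchingCoeff a b c p = if ∃ j, tripleType m j = p then 1 else 0) ∨
      (∀ p, touchingCoeff a b c p = if ∃ j, tripleType m j = p then -1 else 0)) ∨
    ∃ p q, p ≠ q ∧ fstLetter p = fstLetter q ∧ touchingCoeff a b c p ≠ 0 ∧
      touchingCoeff a b c q ≠ 0 := by
  decide +kernel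

theorem chainOf_tripleCells_eq (m : Fin 5) : chainOf (tripleCells m) =
    ∑ p, (if ∃ j, tripleType m j = p then (1 : ℤ) else 0) • cellChain (0, p) := by
  rw [chainOf_tripleCells, ← Finset.sum_image (s := Finset.univ) (g := tripleType m)
    (f := fun p => cellChain (0, p)) (fun _ _ _ _ h => tripleType_injective m h)]
  simp only [ite_smul, one_smul, zero_smul]
  rw [← Finset.sum_filter]
  congr 1
  ext p
  simp

/-- A touching triple that projects well is, up to a sign, one of the five positively oriented
ones. -/
theorem touchingTriple_of_projectsWell {t : ℕ} {a b c : Fin 5} (hab : a ≠ b) (hbc : b ≠ c)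
    (hac : a ≠ c) (h : ProjectsWell (sigma t) (touchingTriple a b c)) :
    ∃ m, touchingTriple a b c = chainOf (tripleCells m) ∨
      touchingTriple a b c = -chainOf (tripleCells m) := by
  obtain ⟨β, hβ⟩ := exists_isDilation t
  have hsupp : ∀ p, touchingCoeff a b c p ≠ 0 → toFace (0, p) ∈ (touchingTriple a b c).support := by
    intro p hp
    rw [Finsupp.mem_support_iff, touchingTriple_eq hab hbc hac, combination_apply]
    rcases orientSign_eq p with h | h <;> simpa [h]
  rcases touchingCoeff_cases a b c hab hbc hac with ⟨m, hm | hm⟩ | ⟨p, q, hpq, hf, hp, hq⟩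
  · refine ⟨m, Or.inl ?_⟩
    rw [touchingTriple_eq hab hbc hac, chainOf_tripleCells_eq]
    simp only [hm]
  · refine ⟨m, Or.inr ?_⟩
    rw [touchingTriple_eq hab hbc hac, chainOf_tripleCells_eq, ← Finset.sum_neg_distrib]
    refine Finset.sum_congr rfl fun p _ => ?_
    rw [hm, ← neg_smul]
    split_ifs <;> simp
  · exact absurd h (not_projectsWell hβ hpq hf (hsupp p hp) (hsupp q hq))

/-! ## Covering the plane -/

/-- The edges occurring with coefficient `1` in the boundary of a cell. -/
def IsPosEdge (e : Edge) (F : Cell) : Prop :=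
  e = (F.1, fstLetter F.2) ∨ e = (F.1 + basisVec (fstLetter F.2), sndLetter F.2)

/-- The edges occurring with coefficient `-1` in the boundary of a cell. -/
def IsNegEdge (e : Edge) (F : Cell) : Prop :=
  e = (F.1 + basisVec (sndLetter F.2), fstLetter F.2) ∨ e = (F.1, sndLetter F.2)

theorem fstLetter_ne_sndLetter : ∀ p, fstLetter p ≠ sndLetter p := by decide

theorem add_basisVec_ne (x : Fin 5 → ℤ) (a : Fin 5) : x + basisVec a ≠ x := by
  intro h
  have := congrFun h a
  simp at this

theorem boundary_cellChain_apply (F : Cell) (e : Edge) :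
    boundary (cellChain F) (edgeFace e) =
      (if (F.1, fstLetter F.2) = e then 1 else 0) +
        (if (F.1 + basisVec (fstLetter F.2), sndLetter F.2) = e then 1 else 0) -
        (if (F.1 + basisVec (sndLetter F.2), fstLetter F.2) = e then 1 else 0) -
        (if (F.1, sndLetter F.2) = e then 1 else 0) := by
  rw [show F = (F.1, F.2) from rfl, boundary_cellChain]
  simp only [Finsupp.sub_apply, Finsupp.add_apply, edgeChain, Finsupp.single_apply,
    edgeFace_bijective.1.eq_iff]

theorem boundary_pos_of_isPosEdge {F : Cell} {e : Edge} (h : IsPosEdge e F) :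
    0 < boundary (cellChain F) (edgeFace e) := by
  have h1 := fstLetter_ne_sndLetter F.2
  have h2 := add_basisVec_ne F.1 (sndLetter F.2)
  have h3 := add_basisVec_ne F.1 (fstLetter F.2)
  rw [boundary_cellChain_apply]
  rcases h with rfl | rfl
  · simp [h1.symm]
  · simp [h1, h3.symm]

theorem boundary_neg_of_isNegEdge {F : Cell} {e : Edge} (h : IsNegEdge e F) :
    boundary (cellChain F) (edgeFace e) < 0 := by
  have h1 := fstLetter_ne_sndLetter F.2
  have h2 := add_basisVec_ne F.1 (sndLetter F.2)
  have h3 := add_basisVec_ne F.1 (fstLetter F.2)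
  rw [boundary_cellChain_apply]
  rcases h with rfl | rfl
  · simp [h1.symm, h2.symm]
  · simp [h1, h3]

theorem isPosEdge_of_boundary_pos {F : Cell} {e : Edge}
    (h : 0 < boundary (cellChain F) (edgeFace e)) : IsPosEdge e F := by
  by_contra hc
  rw [IsPosEdge, not_or] at hc
  rw [boundary_cellChain_apply, if_neg (Ne.symm hc.1), if_neg (Ne.symm hc.2)] at h
  split_ifs at h <;> omega

theorem isNegEdge_of_boundary_neg {F : Cell} {e : Edge}
    (h : boundary (cellChain F) (edgeFace e) < 0) : IsNegEdge e F := by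
  by_contra hc
  rw [IsNegEdge, not_or] at hc
  rw [boundary_cellChain_apply, if_neg (Ne.symm hc.1), if_neg (Ne.symm hc.2)] at h
  split_ifs at h <;> omega

/-- The contributions to the edge add up to zero while that of `F` is positive, so some cell
contributes negatively. -/
theorem exists_isNegEdge {S : Finset Cell} {e : Edge} (h : boundary (chainOf S) (edgeFace e) = 0)
    {F : Cell} (hF : F ∈ S) (he : IsPosEdge e F) : ∃ G ∈ S, IsNegEdge e G := by
  by_contra! hc
  rw [chainOf, map_sum, Finsupp.finsetSum_apply] at h
  refine (Finset.sum_pos' (fun G hG => ?_) ⟨F, hF, boundary_pos_of_isPosEdge he⟩).ne' h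
  exact not_lt.1 fun hl => hc G hG (isNegEdge_of_boundary_neg hl)

theorem exists_isPosEdge {S : Finset Cell} {e : Edge} (h : boundary (chainOf S) (edgeFace e) = 0)
    {F : Cell} (hF : F ∈ S) (he : IsNegEdge e F) : ∃ G ∈ S, IsPosEdge e G := by
  by_contra! hc
  rw [chainOf, map_sum, Finsupp.finsetSum_apply] at h
  refine (Finset.sum_neg' (fun G hG => ?_) ⟨F, hF, boundary_neg_of_isNegEdge he⟩).ne h
  exact not_lt.1 fun hl => hc G hG (isPosEdge_of_boundary_pos hl)

/-- A point in the interior of the edge `e`. -/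
def edgePoint (t : ℕ) (β : ℝ) (e : Edge) (u : ℝ) : ℝ × ℝ :=
  latticePoint t β e.1 + u • letterVec t β e.2


theorem continuous_planeDet_left (v w : ℝ × ℝ) : Continuous fun z => planeDet (z - v) w := by
  unfold planeDet; fun_prop

theorem continuous_planeDet_right (v w : ℝ × ℝ) : Continuous fun z => planeDet w (z - v) := by
  unfold planeDet; fun_prop

theorem planeDet_sub_right (u v w : ℝ × ℝ) :
    planeDet u (v - w) = planeDet u v - planeDet u w := by
  simp only [planeDet, Prod.fst_sub, Prod.snd_sub]; ring

/-- Of the four inequalities describing the tile in Cramer coordinates, only the one belonging to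
`e` is tight at an interior point of `e`; the others hold strictly and survive nearby. A cell with
`e` as a negative edge covers the opposite half-plane near that point. -/
theorem eventually_mem_tile_of_isPosEdge {t : ℕ} {β : ℝ} (hβ : IsDilation t β) {F : Cell}
    {e : Edge} (he : IsPosEdge e F) {u : ℝ} (hu : u ∈ Set.Ioo (0 : ℝ) 1) :
    ∀ᶠ w in nhds (edgePoint t β e u),
      0 ≤ planeDet (letterVec t β e.2) (w - edgePoint t β e u) → w ∈ tile t β F := by
  have hD := hβ.area_pos F.2
  have huD : 0 < u * area t β F.2 := mul_pos hu.1 hD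
  have huD' : u * area t β F.2 < area t β F.2 := mul_lt_of_lt_one_left hD hu.2
  obtain ⟨X, hX⟩ : ∃ X, X = letterVec t β (fstLetter F.2) := ⟨_, rfl⟩
  obtain ⟨Y, hY⟩ : ∃ Y, Y = letterVec t β (sndLetter F.2) := ⟨_, rfl⟩
  have hXY : area t β F.2 = planeDet X Y := by rw [hX, hY, area]
  have cl := continuous_planeDet_left (latticePoint t β F.1) Y
  have cr := continuous_planeDet_right (latticePoint t β F.1) X
  obtain ⟨z, hz⟩ : ∃ z, z = latticePoint t β F.1 := ⟨_, rfl⟩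
  rcases he with rfl | rfl
  · have e1 : edgePoint t β (F.1, fstLetter F.2) u = z + u • X := by rw [edgePoint, hz, hX]
    rw [e1]
    have a1 : planeDet (z + u • X - z) Y ∈ Set.Ioo 0 (area t β F.2) := by
      rw [add_sub_cancel_left, planeDet_smul_left, ← hXY]; exact ⟨huD, huD'⟩
    have a2 : planeDet X (z + u • X - z) ∈ Set.Iio (area t β F.2) := by
      rw [add_sub_cancel_left, planeDet_smul_right, planeDet_self, mul_zero]; exact hD
    rw [← hz] at cl cr
    filter_upwards [cl.continuousAt.preimage_mem_nhds (isOpen_Ioo.mem_nhds a1),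
      cr.continuousAt.preimage_mem_nhds (isOpen_Iio.mem_nhds a2)] with w w1 w2 w3
    rw [← hX] at w3
    have w4 : planeDet X (w - (z + u • X)) = planeDet X (w - z) := by
      rw [← sub_sub, planeDet_sub_right X (w - z), planeDet_smul_right, planeDet_self]; ring
    rw [w4] at w3
    refine mem_tile_of_planeDet hβ ?_ ?_
    · rw [← hY, ← hz]; exact Set.Ioo_subset_Icc_self w1
    · rw [← hX, ← hz]; exact ⟨w3, le_of_lt w2⟩
  · have e1 : edgePoint t β (F.1 + basisVec (fstLetter F.2), sndLetter F.2) u =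
        z + X + u • Y := by rw [edgePoint, latticePoint_add_basisVec, hz, hX, hY]
    rw [e1]
    have a1 : planeDet X (z + X + u • Y - z) ∈ Set.Ioo 0 (area t β F.2) := by
      rw [add_assoc, add_sub_cancel_left, planeDet_add_right, planeDet_self, zero_add,
        planeDet_smul_right, ← hXY]
      exact ⟨huD, huD'⟩
    have a2 : planeDet (z + X + u • Y - z) Y ∈ Set.Ioi 0 := by
      rw [add_assoc, add_sub_cancel_left, planeDet_add_left, planeDet_smul_left, planeDet_self,
        mul_zero, add_zero, ← hXY]
      exact hD
    rw [← hz] at cl cr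
    filter_upwards [cr.continuousAt.preimage_mem_nhds (isOpen_Ioo.mem_nhds a1),
      cl.continuousAt.preimage_mem_nhds (isOpen_Ioi.mem_nhds a2)] with w w1 w2 w3
    rw [← hY] at w3
    have w4 : planeDet Y (w - (z + X + u • Y)) = planeDet X Y - planeDet (w - z) Y := by
      simp only [planeDet, Prod.fst_sub, Prod.snd_sub, Prod.fst_add, Prod.snd_add, Prod.smul_fst,
        Prod.smul_snd, smul_eq_mul]
      ring
    rw [w4, ← hXY] at w3
    refine mem_tile_of_planeDet hβ ?_ ?_
    · rw [← hY, ← hz]; exact ⟨le_of_lt w2, by linarith⟩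
    · rw [← hX, ← hz]; exact Set.Ioo_subset_Icc_self w1

theorem eventually_mem_tile_of_isNegEdge {t : ℕ} {β : ℝ} (hβ : IsDilation t β) {F : Cell}
    {e : Edge} (he : IsNegEdge e F) {u : ℝ} (hu : u ∈ Set.Ioo (0 : ℝ) 1) :
    ∀ᶠ w in nhds (edgePoint t β e u),
      planeDet (letterVec t β e.2) (w - edgePoint t β e u) ≤ 0 → w ∈ tile t β F := by
  have hD := hβ.area_pos F.2
  have huD : 0 < u * area t β F.2 := mul_pos hu.1 hD
  have huD' : u * area t β F.2 < area t β F.2 := mul_lt_of_lt_one_left hD hu.2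
  obtain ⟨X, hX⟩ : ∃ X, X = letterVec t β (fstLetter F.2) := ⟨_, rfl⟩
  obtain ⟨Y, hY⟩ : ∃ Y, Y = letterVec t β (sndLetter F.2) := ⟨_, rfl⟩
  have hXY : area t β F.2 = planeDet X Y := by rw [hX, hY, area]
  have cl := continuous_planeDet_left (latticePoint t β F.1) Y
  have cr := continuous_planeDet_right (latticePoint t β F.1) X
  obtain ⟨z, hz⟩ : ∃ z, z = latticePoint t β F.1 := ⟨_, rfl⟩
  rcases he with rfl | rfl
  · have e1 : edgePoint t β (F.1 + basisVec (sndLetter F.2), fstLetter F.2) u =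
        z + Y + u • X := by rw [edgePoint, latticePoint_add_basisVec, hz, hX, hY]
    rw [e1]
    have a1 : planeDet (z + Y + u • X - z) Y ∈ Set.Ioo 0 (area t β F.2) := by
      rw [add_assoc, add_sub_cancel_left, planeDet_add_left, planeDet_self, zero_add,
        planeDet_smul_left, ← hXY]
      exact ⟨huD, huD'⟩
    have a2 : planeDet X (z + Y + u • X - z) ∈ Set.Ioi 0 := by
      rw [add_assoc, add_sub_cancel_left, planeDet_add_right, planeDet_smul_right, planeDet_self,
        mul_zero, add_zero, ← hXY]
      exact hD
    rw [← hz] at cl cr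
    filter_upwards [cl.continuousAt.preimage_mem_nhds (isOpen_Ioo.mem_nhds a1),
      cr.continuousAt.preimage_mem_nhds (isOpen_Ioi.mem_nhds a2)] with w w1 w2 w3
    rw [← hX] at w3
    have w4 : planeDet X (w - (z + Y + u • X)) = planeDet X (w - z) - planeDet X Y := by
      simp only [planeDet, Prod.fst_sub, Prod.snd_sub, Prod.fst_add, Prod.snd_add, Prod.smul_fst,
        Prod.smul_snd, smul_eq_mul]
      ring
    rw [w4, ← hXY] at w3
    refine mem_tile_of_planeDet hβ ?_ ?_
    · rw [← hY, ← hz]; exact Set.Ioo_subset_Icc_self w1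
    · rw [← hX, ← hz]; exact ⟨le_of_lt w2, by linarith⟩
  · have e1 : edgePoint t β (F.1, sndLetter F.2) u = z + u • Y := by rw [edgePoint, hz, hY]
    rw [e1]
    have a1 : planeDet X (z + u • Y - z) ∈ Set.Ioo 0 (area t β F.2) := by
      rw [add_sub_cancel_left, planeDet_smul_right, ← hXY]; exact ⟨huD, huD'⟩
    have a2 : planeDet (z + u • Y - z) Y ∈ Set.Iio (area t β F.2) := by
      rw [add_sub_cancel_left, planeDet_smul_left, planeDet_self, mul_zero]; exact hD
    rw [← hz] at cl cr
    filter_upwards [cr.continuousAt.preimage_mem_nhds (isOpen_Ioo.mem_nhds a1),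
      cl.continuousAt.preimage_mem_nhds (isOpen_Iio.mem_nhds a2)] with w w1 w2 w3
    rw [← hY] at w3
    have w4 : planeDet Y (w - (z + u • Y)) = -planeDet (w - z) Y := by
      simp only [planeDet, Prod.fst_sub, Prod.snd_sub, Prod.fst_add, Prod.snd_add, Prod.smul_fst,
        Prod.smul_snd, smul_eq_mul]
      ring
    rw [w4] at w3
    refine mem_tile_of_planeDet hβ ?_ ?_
    · rw [← hY, ← hz]; exact ⟨by linarith, le_of_lt w2⟩
    · rw [← hX, ← hz]; exact Set.Ioo_subset_Icc_self w1

theorem mem_nhds_of_edges {t : ℕ} {β : ℝ} (hβ : IsDilation t β) {F G : Cell}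
    {e : Edge} (hF : IsPosEdge e F) (hG : IsNegEdge e G) {u : ℝ} (hu : u ∈ Set.Ioo (0 : ℝ) 1) :
    tile t β F ∪ tile t β G ∈ nhds (edgePoint t β e u) := by
  filter_upwards [eventually_mem_tile_of_isPosEdge hβ hF hu,
    eventually_mem_tile_of_isNegEdge hβ hG hu] with w h1 h2
  exact (le_total 0 _).elim (fun h => Or.inl (h1 h)) fun h => Or.inr (h2 h)

/-- The cells in the orbit of a positively oriented touching triple. -/
def orbitCells (t : ℕ) (m : Fin 5) : Set Cell := {F | ∃ j, F ∈ descend t (5 * j) (tripleCells m)}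

theorem tripleCells_based (m : Fin 5) : ∀ F ∈ tripleCells m, F.1 = 0 := by
  intro F hF
  obtain ⟨j, _, rfl⟩ := Finset.mem_image.1 hF
  rfl

theorem descend_tripleCells_mono {t : ℕ} {β : ℝ} (hβ : IsDilation t β) (m : Fin 5) {i j : ℕ}
    (h : i ≤ j) : descend t (5 * i) (tripleCells m) ⊆ descend t (5 * j) (tripleCells m) := by
  obtain ⟨k, rfl⟩ := Nat.exists_eq_add_of_le h
  rw [mul_add]
  exact descend_subset hβ (tripleCells_based m) _ _

/-- If `e` occurred in the boundary both at a level and fifteen steps later, its base point would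
lie on two disjoint boundaries. -/
theorem exists_boundary_eq_zero {t : ℕ} {β : ℝ} (hβ : IsDilation t β) {m : Fin 5} {F : Cell}
    (hF : F ∈ orbitCells t m) (e : Edge) : ∃ j, F ∈ descend t (5 * j) (tripleCells m) ∧
      boundary (chainOf (descend t (5 * j) (tripleCells m))) (edgeFace e) = 0 := by
  obtain ⟨j, hj⟩ := hF
  by_contra! hc
  have h1 := hc j hj
  have h2 := hc (j + 3) (descend_tripleCells_mono hβ m (Nat.le_add_right j 3) hj)
  have hp : (fun i => (e.1 i : ℝ)) + (0 : ℝ) • (Pi.single e.2 1 : Fin 5 → ℝ) ∈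
      faceSupport (edgeFace e) :=
    mem_faceSupport_edgeFace.2 ⟨0, ⟨le_rfl, zero_le_one⟩, rfl⟩
  refine Set.disjoint_left.1 (disjoint_boundaries hβ m (5 * j))
    (Set.mem_biUnion (Finset.mem_coe.2 (Finsupp.mem_support_iff.2 h1)) hp)
    (Set.mem_biUnion (Finset.mem_coe.2 (Finsupp.mem_support_iff.2 ?_)) hp)
  rwa [mul_add] at h2

/-- The union of the tiles of the orbit. -/
def orbitTiles (t : ℕ) (β : ℝ) (m : Fin 5) : Set (ℝ × ℝ) := ⋃ F : orbitCells t m, tile t β F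

theorem tile_subset_orbitTiles {t : ℕ} {β : ℝ} {m : Fin 5} {F : Cell} (hF : F ∈ orbitCells t m) :
    tile t β F ⊆ orbitTiles t β m :=
  Set.subset_iUnion (fun F : orbitCells t m => tile t β F) ⟨F, hF⟩

theorem edgePoint_mem_interior {t : ℕ} {β : ℝ} (hβ : IsDilation t β) {m : Fin 5} {F : Cell}
    (hF : F ∈ orbitCells t m) {e : Edge} (he : IsPosEdge e F ∨ IsNegEdge e F) {u : ℝ}
    (hu : u ∈ Set.Ioo (0 : ℝ) 1) : edgePoint t β e u ∈ interior (orbitTiles t β m) := by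
  obtain ⟨j, hj, h0⟩ := exists_boundary_eq_zero hβ hF e
  rw [mem_interior_iff_mem_nhds]
  rcases he with he | he
  · obtain ⟨G, hG, hG'⟩ := exists_isNegEdge h0 hj he
    exact Filter.mem_of_superset (mem_nhds_of_edges hβ he hG' hu)
      (Set.union_subset (tile_subset_orbitTiles hF) (tile_subset_orbitTiles ⟨j, hG⟩))
  · obtain ⟨G, hG, hG'⟩ := exists_isPosEdge h0 hj he
    exact Filter.mem_of_superset (mem_nhds_of_edges hβ hG' he hu)
      (Set.union_subset (tile_subset_orbitTiles ⟨j, hG⟩) (tile_subset_orbitTiles hF))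

/-- A point of a tile is interior to the tile, interior to one of its edges, or a vertex; vertices
are lattice points. -/
theorem mem_interior_orbitTiles {t : ℕ} {β : ℝ} (hβ : IsDilation t β) {m : Fin 5} {a : ℝ × ℝ}
    (ha : a ∈ orbitTiles t β m) (hv : a ∉ Set.range (latticePoint t β)) :
    a ∈ interior (orbitTiles t β m) := by
  obtain ⟨⟨F, hF⟩, haF⟩ := Set.mem_iUnion.1 ha
  obtain ⟨s, hs, u, hu, rfl⟩ := mem_tile.1 haF
  have hD := hβ.area_pos F.2
  have split : ∀ r ∈ Set.Icc (0 : ℝ) 1, r = 0 ∨ r = 1 ∨ r ∈ Set.Ioo (0 : ℝ) 1 := by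
    intro r hr
    rcases hr.1.eq_or_lt with h | h
    · exact Or.inl h.symm
    · rcases hr.2.eq_or_lt with h' | h'
      · exact Or.inr (Or.inl h')
      · exact Or.inr (Or.inr ⟨h, h'⟩)
  rcases split s hs with rfl | rfl | hs'
  · rcases split u hu with rfl | rfl | hu'
    · exact absurd ⟨F.1, by simp⟩ hv
    · exact absurd ⟨F.1 + basisVec (sndLetter F.2), by
        rw [latticePoint_add_basisVec]; simp⟩ hv
    · have := edgePoint_mem_interior hβ hF (Or.inr (Or.inr rfl)) hu'
      simpa [edgePoint] using this
  · rcases split u hu with rfl | rfl | hu'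
    · exact absurd ⟨F.1 + basisVec (fstLetter F.2), by
        rw [latticePoint_add_basisVec]; simp⟩ hv
    · exact absurd ⟨F.1 + basisVec (fstLetter F.2) + basisVec (sndLetter F.2), by
        rw [latticePoint_add_basisVec, latticePoint_add_basisVec]; simp [add_assoc]⟩ hv
    · have := edgePoint_mem_interior hβ hF (Or.inl (Or.inr rfl)) hu'
      simpa [edgePoint, latticePoint_add_basisVec, add_assoc] using this
  · rcases split u hu with rfl | rfl | hu'
    · have := edgePoint_mem_interior hβ hF (Or.inl (Or.inl rfl)) hs'
      simpa [edgePoint] using this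
    · have := edgePoint_mem_interior hβ hF (Or.inr (Or.inl rfl)) hs'
      rw [edgePoint, latticePoint_add_basisVec] at this
      convert this using 1
      module
    · refine interior_mono (tile_subset_orbitTiles hF) (mem_interior_tile hβ ?_ ?_)
      · rw [add_sub_cancel_left, planeDet_add_left, planeDet_smul_left, planeDet_smul_left,
          planeDet_self, mul_zero, add_zero, ← area]
        exact ⟨mul_pos hs'.1 hD, mul_lt_of_lt_one_left hD hs'.2⟩
      · rw [add_sub_cancel_left, planeDet_add_right, planeDet_smul_right, planeDet_smul_right,
          planeDet_self, mul_zero, zero_add, ← area]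
        exact ⟨mul_pos hu'.1 hD, mul_lt_of_lt_one_left hD hu'.2⟩

/-! ### Local finiteness of the orbit and the connectedness argument. -/

theorem orbitCells_spread {t : ℕ} {β : ℝ} (hβ : IsDilation t β) (m : Fin 5) :
    (∀ F ∈ orbitCells t m, Admissible β faceBound F.2 F.1) ∧
      ∀ F ∈ orbitCells t m, ∀ G ∈ orbitCells t m, F ≠ G → Separated F G := by
  have hS := fun j => (spread_tripleCells hβ.one_lt m).descend hβ (5 * j)
  refine ⟨fun F ⟨j, hj⟩ => (hS j).admissible F hj, fun F ⟨i, hi⟩ G ⟨j, hj⟩ hne => ?_⟩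
  exact (hS (max i j)).separated F (descend_tripleCells_mono hβ m (le_max_left i j) hi) G
    (descend_tripleCells_mono hβ m (le_max_right i j) hj) hne

theorem latticePoint_eq (t : ℕ) (β : ℝ) (x : Fin 5 → ℤ) : latticePoint t β x =
    ((quot x).1 - β * (quot x).2.2, (quot x).2.1 - gam t β * (quot x).2.2) := by
  simp only [latticePoint, planeMap_apply, quot]
  push_cast
  rfl

/-- Together `ell` and the two plane coordinates are linear coordinates for the class. Admissibility
bounds the first and the hypothesis bounds the others, leaving finitely many classes; by separation
a cell is determined by its type and class. -/
theorem finite_orbitCells_bounded {t : ℕ} {β : ℝ} (hβ : IsDilation t β) (m : Fin 5) (B : ℝ) :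
    {F | F ∈ orbitCells t m ∧ ‖latticePoint t β F.1‖ ≤ B}.Finite := by
  have hb := hβ.one_lt
  obtain ⟨hg, -, -⟩ := hβ.gam_bounds
  obtain ⟨hadm, hsep⟩ := orbitCells_spread hβ m
  obtain ⟨W, hW⟩ : ∃ W, W = ∑ p, |ell β (faceBound p)| := ⟨_, rfl⟩
  have hW' : ∀ p, ell β (faceBound p) ≤ W := fun p => (le_abs_self _).trans (hW ▸
    Finset.single_le_sum (f := fun p => |ell β (faceBound p)|) (fun _ _ => abs_nonneg _)
      (Finset.mem_univ p))
  obtain ⟨R, hR⟩ : ∃ R, R = W + β ^ 2 * B + β * B := ⟨_, rfl⟩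
  obtain ⟨N, hN⟩ := exists_nat_ge (max R (max (B + β * R) (B + gam t β * R)))
  have toIcc : ∀ d : ℤ, |(d : ℝ)| ≤ N → d ∈ Set.Icc (-(N : ℤ)) N := by
    intro d hd
    exact abs_le.1 (by exact_mod_cast hd)
  refine Set.Finite.of_injOn (f := fun F : Cell => (F.2, quot F.1))
    (t := Set.univ ×ˢ Set.Icc (-(N : ℤ)) N ×ˢ Set.Icc (-(N : ℤ)) N ×ˢ Set.Icc (-(N : ℤ)) N)
    ?_ ?_ (Set.toFinite _)
  · rintro ⟨x, p⟩ ⟨hF, hB⟩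
    have ha := hadm _ hF
    rw [Admissible] at ha
    simp only at ha hB
    rw [latticePoint_eq, Prod.norm_mk, max_le_iff, Real.norm_eq_abs, Real.norm_eq_abs, abs_le,
      abs_le] at hB
    obtain ⟨⟨d0, d1, d2⟩, hd⟩ : ∃ d, d = quot x := ⟨_, rfl⟩
    have hp := hW' p
    simp only [← hd, ell] at ha hB hp
    obtain ⟨⟨b1, b2⟩, b3, b4⟩ := hB
    have hB0 : 0 ≤ B := by linarith
    have hg0 : 0 < gam t β := by linarith
    -- The third class coordinate is solved for first; the other two then follow from the plane
    -- coordinates.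
    have hkey : ((β ^ 3 + β * gam t β) + 1) * (d2 : ℝ) =
        (β ^ 2 * d0 + β * d1 + d2) - β ^ 2 * (d0 - β * d2) - β * (d1 - gam t β * d2) := by ring
    have hc : 0 < β ^ 3 + β * gam t β := by positivity
    have h2 : |(d2 : ℝ)| ≤ R := by
      have : |((β ^ 3 + β * gam t β) + 1) * (d2 : ℝ)| ≤ R := by
        have q1 := mul_le_mul_of_nonneg_left b1 (sq_nonneg β)
        have q2 := mul_le_mul_of_nonneg_left b2 (sq_nonneg β)
        have q3 := mul_le_mul_of_nonneg_left b3 (by linarith : 0 ≤ β)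
        have q4 := mul_le_mul_of_nonneg_left b4 (by linarith : 0 ≤ β)
        rw [hkey, hR, abs_le]
        constructor <;> linarith
      rw [abs_mul, abs_of_pos (by linarith)] at this
      nlinarith [abs_nonneg (d2 : ℝ)]
    have h2' := abs_le.1 h2
    have h0 : |(d0 : ℝ)| ≤ B + β * R := by
      have q1 := mul_le_mul_of_nonneg_left h2'.1 (by linarith : 0 ≤ β)
      have q2 := mul_le_mul_of_nonneg_left h2'.2 (by linarith : 0 ≤ β)
      rw [abs_le]; constructor <;> linarith
    have h1 : |(d1 : ℝ)| ≤ B + gam t β * R := by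
      have q1 := mul_le_mul_of_nonneg_left h2'.1 hg0.le
      have q2 := mul_le_mul_of_nonneg_left h2'.2 hg0.le
      rw [abs_le]; constructor <;> linarith
    simp only [max_le_iff] at hN
    simp only [← hd, Set.mem_prod, Set.mem_univ, true_and]
    exact ⟨toIcc _ (h0.trans hN.2.1), toIcc _ (h1.trans hN.2.2), toIcc _ (h2.trans hN.1)⟩
  · intro F hF G hG h
    by_contra hne
    obtain ⟨e1, e2⟩ := Prod.ext_iff.1 h
    exact (hsep F hF.1 G hG.1 hne).2 ⟨e1, sub_eq_zero.2 e2.symm⟩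

theorem isClosed_tile (t : ℕ) (β : ℝ) (F : Cell) : IsClosed (tile t β F) := by
  have : tile t β F = (fun q : ℝ × ℝ => latticePoint t β F.1 +
      (q.1 • letterVec t β (fstLetter F.2) + q.2 • letterVec t β (sndLetter F.2))) ''
        (Set.Icc 0 1 ×ˢ Set.Icc 0 1) := by
    ext w
    rw [mem_tile]
    constructor
    · rintro ⟨s, hs, u, hu, rfl⟩
      exact ⟨(s, u), ⟨hs, hu⟩, rfl⟩
    · rintro ⟨⟨s, u⟩, ⟨hs, hu⟩, rfl⟩
      exact ⟨s, hs, u, hu, rfl⟩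
  rw [this]
  exact ((isCompact_Icc.prod isCompact_Icc).image (by fun_prop)).isClosed

theorem isClosed_orbitTiles {t : ℕ} {β : ℝ} (hβ : IsDilation t β) (m : Fin 5) :
    IsClosed (orbitTiles t β m) := by
  refine LocallyFinite.isClosed_iUnion (fun a => ⟨Metric.ball a 1, Metric.ball_mem_nhds a one_pos,
    ?_⟩) fun F => isClosed_tile t β F
  obtain ⟨L, hL⟩ : ∃ L, L = ∑ c, ‖letterVec t β c‖ := ⟨_, rfl⟩
  have hL' : ∀ c, ‖letterVec t β c‖ ≤ L := fun c => hL ▸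
    Finset.single_le_sum (f := fun c => ‖letterVec t β c‖) (fun _ _ => norm_nonneg _)
      (Finset.mem_univ c)
  refine Set.Finite.of_finite_image ((finite_orbitCells_bounded hβ m (‖a‖ + 1 + 2 * L)).subset ?_)
    Subtype.val_injective.injOn
  rintro _ ⟨⟨F, hF⟩, ⟨w, hw, hwa⟩, rfl⟩
  obtain ⟨s, hs, u, hu, rfl⟩ := mem_tile.1 hw
  refine ⟨hF, ?_⟩
  rw [Metric.mem_ball, dist_eq_norm] at hwa
  have key : ∀ r ∈ Set.Icc (0 : ℝ) 1, ∀ c, ‖r • letterVec t β c‖ ≤ L := by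
    intro r hr c
    rw [norm_smul, Real.norm_eq_abs, abs_of_nonneg hr.1]
    exact (mul_le_of_le_one_left (norm_nonneg _) hr.2).trans (hL' c)
  obtain ⟨z, hz⟩ : ∃ z, z = latticePoint t β F.1 := ⟨_, rfl⟩
  obtain ⟨X, hX⟩ : ∃ X, X = s • letterVec t β (fstLetter F.2) := ⟨_, rfl⟩
  obtain ⟨Y, hY⟩ : ∃ Y, Y = u • letterVec t β (sndLetter F.2) := ⟨_, rfl⟩
  have kX : ‖X‖ ≤ L := hX ▸ key s hs _
  have kY : ‖Y‖ ≤ L := hY ▸ key u hu _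
  rw [← hz, ← hX, ← hY] at hwa
  change ‖latticePoint t β F.1‖ ≤ _
  rw [← hz, show z = (z + (X + Y) - a) + a - X - Y by abel]
  have n1 := norm_sub_le (z + (X + Y) - a + a - X) Y
  have n2 := norm_sub_le (z + (X + Y) - a + a) X
  have n3 := norm_add_le (z + (X + Y) - a) a
  linarith

/-- Away from the countable set of lattice points the union is relatively open and closed, and the
complement of a countable set in the plane is connected. Density of that complement and closedness
give the lattice points as well. -/
theorem orbitTiles_eq_univ {t : ℕ} {β : ℝ} (hβ : IsDilation t β) (m : Fin 5) :
    orbitTiles t β m = Set.univ := by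
  have hcount : (Set.range (latticePoint t β)).Countable := Set.countable_range _
  have hdense : Dense (Set.range (latticePoint t β))ᶜ := hcount.dense_compl ℝ
  have hconn : IsPreconnected (Set.range (latticePoint t β))ᶜ :=
    (hcount.isPathConnected_compl_of_one_lt_rank (by
      rw [rank_prod', CommSemiring.rank_self]; norm_num)).isConnected.isPreconnected
  have hclosed := isClosed_orbitTiles hβ m
  have hne : ((Set.range (latticePoint t β))ᶜ ∩ interior (orbitTiles t β m)).Nonempty := by
    rw [Set.inter_comm]
    refine hdense.inter_open_nonempty _ isOpen_interior ?_
    have h0 : ((0, tripleType m 0) : Cell) ∈ orbitCells t m :=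
      ⟨0, Finset.mem_image_of_mem _ (Finset.mem_univ _)⟩
    exact ⟨_, edgePoint_mem_interior hβ h0 (Or.inl (Or.inl rfl)) (u := 1 / 2)
      ⟨by norm_num, by norm_num⟩⟩
  have hsub : (Set.range (latticePoint t β))ᶜ ⊆ orbitTiles t β m := by
    intro a ha
    by_contra hc
    obtain ⟨b, hb, hb1, hb2⟩ := hconn _ _ isOpen_interior hclosed.isOpen_compl
      (fun x hx => (em (x ∈ orbitTiles t β m)).imp
        (fun h => mem_interior_orbitTiles hβ h hx) id) hne ⟨a, ha, hc⟩
    exact hb2 (interior_subset hb1)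
  exact Set.eq_univ_of_univ_subset (hdense.closure_eq ▸ hclosed.closure_subset_iff.2 hsub)

/-- The projections of the faces in the orbit cover the contracting plane. -/
theorem projC_supportOf_eq_univ {t : ℕ} {β : ℝ} (hβ : IsDilation t β) (m : Fin 5)
    {S : Set (Face 5 2)} (h : ∀ F ∈ orbitCells t m, toFace F ∈ S) :
    projC (sigma t) (supportOf S) = Set.univ := by
  refine Set.eq_univ_of_forall fun y => mem_projC hβ ?_
  obtain ⟨⟨F, hF⟩, x, hx, hxy⟩ :=
    Set.mem_iUnion.1 (orbitTiles_eq_univ hβ m ▸ Set.mem_univ (planeMap t β y))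
  exact ⟨x, Set.mem_biUnion (h F hF) hx, hxy⟩

/-! ## Changing signs -/

theorem IsEdgeConnected.neg {n k : ℕ} {P : Chain n k} (h : IsEdgeConnected P) :
    IsEdgeConnected (-P) := by
  refine ⟨fun F hF => ?_, ?_⟩
  · rw [Finsupp.support_neg] at hF
    rw [Finsupp.neg_apply, neg_inj, neg_eq_iff_eq_neg]
    exact (h.1 F hF).symm
  · rw [Finsupp.support_neg]
    exact h.2

theorem Surrounds.neg {n k : ℕ} {A P : Chain n (k + 1)} (h : Surrounds A P) :
    Surrounds (-A) (-P) := by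
  refine ⟨h.1.neg, h.2.1.neg, ?_, ?_⟩
  · rw [Finsupp.support_neg, Finsupp.support_neg]
    exact h.2.2.1
  · rw [map_neg, map_neg, Finsupp.support_neg, Finsupp.support_neg]
    exact h.2.2.2

/-- The three cells have pairwise disjoint sets of descendants, so each face of the image receives
the sign of exactly one of them and nothing cancels. -/
theorem E2_pow_of_support_eq {t : ℕ} {β : ℝ} (hβ : IsDilation t β) {m : Fin 5} {V : Chain 5 2}
    (hV : IsGeometric V) (hs : V.support = (chainOf (tripleCells m)).support) (j : ℕ) :
    IsGeometric ((E2 (sigma t) ^ j) V) ∧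
      ((E2 (sigma t) ^ j) V).support = (chainOf (descend t j (tripleCells m))).support := by
  have hbase : BasedAtZero V := by
    intro f hf
    rw [hs] at hf
    obtain ⟨F, hF, rfl⟩ := mem_support_chainOf_iff.1 hf
    exact tripleCells_based m F hF
  obtain ⟨ε, hε⟩ : ∃ ε : Fin 10 → ℤ, ε = fun p => orientSign p * V (toFace (0, p)) := ⟨_, rfl⟩
  have hVε : V = ∑ p, ε p • cellChain (0, p) := by rw [hε]; exact eq_combination hbase
  have hin : ∀ p, ((0, p) : Cell) ∈ tripleCells m → ε p = 1 ∨ ε p = -1 := by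
    intro p hp
    have h1 := hV _ (hs ▸ mem_support_chainOf.2 hp)
    rw [hε]
    rcases h1 with h1 | h1 <;> rcases orientSign_eq p with h2 | h2 <;> simp [h1, h2]
  have hout : ∀ p, ((0, p) : Cell) ∉ tripleCells m → ε p = 0 := by
    intro p hp
    have h1 : V (toFace (0, p)) = 0 := by
      rw [← Finsupp.notMem_support_iff, hs, mem_support_chainOf]
      exact hp
    rw [hε]; simp [h1]
  have hdis := fun F hF F' hF' hne =>
    (spread_tripleCells hβ.one_lt m).disjoint_descend hβ (F := F) (F' := F') hF hF' hne j
  have happly : ∀ G, (E2 (sigma t) ^ j) V (toFace G) =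
      ∑ p, ε p * (if G ∈ descend t j {((0, p) : Cell)} then orientSign G.2 else 0) := by
    intro G
    rw [hVε, E2_pow_combination hβ, Finsupp.finsetSum_apply]
    simp only [Finsupp.smul_apply, chainOf_apply, smul_eq_mul]
  have hmem : ∀ G ∈ descend t j (tripleCells m),
      (E2 (sigma t) ^ j) V (toFace G) = 1 ∨ (E2 (sigma t) ^ j) V (toFace G) = -1 := by
    intro G hG
    obtain ⟨⟨x, p⟩, hF, hGF⟩ := mem_descend_iff.1 hG
    obtain rfl : x = 0 := tripleCells_based m _ hF
    rw [happly, Finset.sum_eq_single p, if_pos hGF]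
    · rcases hin p hF with h1 | h1 <;> rcases orientSign_eq G.2 with h2 | h2 <;> simp [h1, h2]
    · intro q _ hq
      by_cases hqm : ((0, q) : Cell) ∈ tripleCells m
      · rw [if_neg, mul_zero]
        exact Finset.disjoint_left.1
          (hdis _ hF _ hqm fun h => hq (Prod.ext_iff.1 h).2.symm) hGF
      · rw [hout q hqm, zero_mul]
    · simp
  have hnot : ∀ G ∉ descend t j (tripleCells m), (E2 (sigma t) ^ j) V (toFace G) = 0 := by
    intro G hG
    rw [happly]
    refine Finset.sum_eq_zero fun p _ => ?_
    by_cases hp : ((0, p) : Cell) ∈ tripleCells m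
    · rw [if_neg fun h => hG (mem_descend_iff.2 ⟨_, hp, h⟩), mul_zero]
    · rw [hout p hp, zero_mul]
  constructor
  · intro f hf
    obtain ⟨G, rfl⟩ := toFace_bijective.2 f
    exact hmem G (by_contra fun h => Finsupp.mem_support_iff.1 hf (hnot G h))
  · ext f
    obtain ⟨G, rfl⟩ := toFace_bijective.2 f
    rw [mem_support_chainOf, Finsupp.mem_support_iff]
    constructor
    · exact fun h => by_contra fun h' => h (hnot G h')
    · intro h
      rcases hmem G h with h' | h' <;> rw [h'] <;> norm_num

theorem surrounds_orbit {t : ℕ} {β : ℝ} (hβ : IsDilation t β) {m : Fin 5} {U : Chain 5 2}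
    (hU : U = chainOf (tripleCells m) ∨ U = -chainOf (tripleCells m)) (i j : ℕ) :
    Surrounds ((E2 (sigma t) ^ j) (((E2 (sigma t) ^ 15) ^ (i + 1)) U))
      ((E2 (sigma t) ^ j) (((E2 (sigma t) ^ 15) ^ i) U)) := by
  have key : Surrounds ((E2 (sigma t) ^ (j + 15 * i + 15)) (chainOf (tripleCells m)))
      ((E2 (sigma t) ^ (j + 15 * i)) (chainOf (tripleCells m))) := by
    rw [(spread_tripleCells hβ.one_lt m).E2_pow hβ, (spread_tripleCells hβ.one_lt m).E2_pow hβ]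
    exact surrounds_descend hβ m _
  simp only [← pow_mul, ← Module.End.mul_apply, ← pow_add]
  rw [show j + 15 * (i + 1) = j + 15 * i + 15 by ring]
  rcases hU with rfl | rfl
  · exact key
  · rw [map_neg, map_neg]
    exact key.neg

theorem mainTheorem10 (t : ℕ) :
    (∀ U : Chain 5 2, IsGeometric U → BasedAtZero U →
      U.support ⊆ ((E2 (sigma t) ^ 5) U).support) ∧
    (∀ a b c : Fin 5, a ≠ b → b ≠ c → a ≠ c →
      ProjectsWell (sigma t) (touchingTriple a b c) →
      (∀ i : ℕ, Surrounds (((E2 (sigma t) ^ 15) ^ (i + 1)) (touchingTriple a b c))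
        (((E2 (sigma t) ^ 15) ^ i) (touchingTriple a b c))) ∧
      (∀ i : ℕ, SurroundsUnderIteration (E2 (sigma t))
        (((E2 (sigma t) ^ 15) ^ (i + 1)) (touchingTriple a b c))
        (((E2 (sigma t) ^ 15) ^ i) (touchingTriple a b c))) ∧
      (∀ V : Chain 5 2, IsGeometric V → V.support = (touchingTriple a b c).support →
        (∀ j : ℕ, ((E2 (sigma t) ^ j) V).support =
          ((E2 (sigma t) ^ j) (touchingTriple a b c)).support) ∧
        GeometricFiniteness (sigma t) (E2 (sigma t)) V)) := by
  obtain ⟨β, hβ⟩ := exists_isDilation t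
  refine ⟨fun U _ hU => support_subset_E2_pow_five hβ hU, fun a b c hab hbc hac hP => ?_⟩
  obtain ⟨m, hm⟩ := touchingTriple_of_projectsWell hab hbc hac hP
  refine ⟨fun i => surrounds_orbit hβ hm i 0, fun i j => surrounds_orbit hβ hm i j,
    fun V hV hs => ?_⟩
  have hT : (touchingTriple a b c).support = (chainOf (tripleCells m)).support := by
    rcases hm with h | h
    · rw [h]
    · rw [h, Finsupp.support_neg]
  have hVj := E2_pow_of_support_eq hβ hV (hs.trans hT)
  have hbase : BasedAtZero V := by
    intro f hf
    rw [hs, hT] at hf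
    obtain ⟨F, hF, rfl⟩ := mem_support_chainOf_iff.1 hf
    exact tripleCells_based m F hF
  -- The finiteness property holds with `m = 5`, the period of the faces at the origin.
  refine ⟨fun j => (hVj j).2.trans (E2_pow_of_support_eq hβ hP.1 hT j).2.symm, hbase,
    ⟨hV, hs ▸ hP.2⟩, 5, by norm_num, (hVj 5).1, support_subset_E2_pow_five hβ hbase,
    projC_supportOf_eq_univ hβ m fun F ⟨j, hF⟩ => ?_⟩
  refine Set.mem_iUnion.2 ⟨j, Finset.mem_coe.2 ?_⟩
  rw [(hVj _).2]
  exact mem_support_chainOf.2 hF
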